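/- **Theorem 3.6.** Let $L_1,L_2,L_3>0$ and let $\sigma_j\in L^\infty(\mathbb R)$ $(j=1,2,3)$ be real valued with $\sigma_j(s)=0$ for almost every $s$ with $|s|\le L_j$. Put $R=\prod_j\{|x_j|\le L_j\}\subset\mathbb R^3$. Write Maxwell's equations $\partial_tE-\nabla\times H=0$, $\partial_tH+\nabla\times E=0$ for $U=E+iH$ as $LU:=\partial_tU+\sum_{j=1}^3A_j\partial_jU=0$ with the Hermitian matrices $$A_1=\begin{pmatrix}0&0&0\\0&0&-i\\0&i&0\end{pmatrix},\quad A_2=\begin{pmatrix}0&0&i\\0&0&0\\-i&0&0\end{pmatrix},\quad A_3=\begin{pmatrix}0&-i&0\\i&0&0\\0&0&0\end{pmatrix}.$$ With $\sigma_j=\sigma_j(x_j)$ let $\Sigma=\operatorname{diag}(\sigma_1,\sigma_2,\sigma_3)$, $\Sigma^{(1)}=\operatorname{diag}(\sigma_2+\sigma_3-\sigma_1,\ \sigma_3+\sigma_1-\sigma_2,\ \sigma_1+\sigma_2-\sigma_3)$, $\Sigma^{(2)}=\operatorname{diag}\big((\sigma_1-\sigma_2)(\sigma_1-\sigma_3),(\sigma_2-\sigma_1)(\sigma_2-\sigma_3),(\sigma_3-\sigma_1)(\sigma_3-\sigma_2)\big)$,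 and consider, for $(V,W)$ with values in $\mathbb C^3\times\mathbb C^3$, the system $$LV+\Sigma^{(1)}V+\Sigma^{(2)}W=0,\qquad \partial_tW+\Sigma W-V=0.\tag{3.29}$$ (For zero initial values of $W$, in terms of the Laplace transform in $t$ with dual variable $\tau$, $V=MU$ with $M=\operatorname{diag}(1+\sigma_j/\tau)$ and $W_j=V_j/(\tau+\sigma_j)$, where $U:=V-\Sigma W=\partial_tW$ is the field computed from $(V,W)$.) Solutions are understood in the sense of distributions, in the class $C^0([0,\infty[;L^2(\mathbb R^3))$. Then: 1. (Strong well-posedness.) There are $K>0$ and $\alpha\in\mathbb R$ such that for all initial values $(V_0,W_0)\in L^2(\mathbb R^3;\mathbb C^6)$ the Cauchy problem for (3.29) has a unique solution $(V,W)$, and $$\|(V,W)(t)\|_{L^2}\le Ke^{\alpha t}\|(V_0,W_0)\|_{L^2}\qquad\text{for all } t\ge0.$$ 2. (Perfect matching.) Let $U_0\in L^2(\mathbb R^3;\mathbb C^3)$ and $F\in L^1_{\rm loc}([0,\infty[;L^2(\mathbb R^3;\mathbb C^3))$ be supported in $R$, respectively in $[0,\infty[\times R$. Then each of the problems $$LV+\Sigma^{(1)}V+\Sigma^{(2)}W=F,\quad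 \partial_tW+\Sigma W-V=0\quad(t>0),\qquad V(0)=U_0,\ W(0)=0,$$ $$LU^{\rm Max}=F\quad(t>0),\qquad U^{\rm Max}(0)=U_0,$$ has a unique solution, and for every $t\ge0$ the field $U=V-\Sigma W$ satisfies $U(t,\cdot)=U^{\rm Max}(t,\cdot)$ almost everywhere in $R$. -/

import Mathlib

open MeasureTheory

noncomputable section

namespace PML

/-- The state space `L²(ℝᵈ; ℂ^ι)`, with the Hermitian norm on `ℂ^ι`. -/
abbrev L2 (d : ℕ) (ι : Type) [Fintype ι] : Type :=
  Lp (EuclideanSpace ℂ ι) 2 (volume : Measure (EuclideanSpace ℝ (Fin d)))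

/-- `u ∈ C⁰([0, ∞[; L²(ℝᵈ; ℂ^ι))` is the (weak) solution of the Cauchy problem
`∂ₜ u + ∑ₗ Aₗ ∂ₗ u + B(x) u = F` for `t > 0`, `u(0) = u₀`.
The equation holds in the sense of distributions: it is tested against `φ ∈ C_c^∞(ℝᵈ)`, the space
derivatives being moved to `φ`, and it is integrated from `0` to `t` (for `u` continuous in time
with values in `L²` this is the same as the equation in `𝒟'(]0, ∞[ × ℝᵈ)` with `u(0) = u₀`). -/
structure IsSolution {d : ℕ} {ι : Type} [Fintype ι] [DecidableEq ι]
    (A : Fin d → Matrix ι ι ℂ) (B : EuclideanSpace ℝ (Fin d) → Matrix ι ι ℂ)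
    (u₀ : L2 d ι) (F : ℝ → L2 d ι) (u : ℝ → L2 d ι) : Prop where
  continuousOn : ContinuousOn u (Set.Ici 0)
  initial : u 0 = u₀
  equation : ∀ φ : EuclideanSpace ℝ (Fin d) → ℝ,
    ContDiff ℝ (⊤ : ℕ∞) φ → HasCompactSupport φ → ∀ t : ℝ, 0 ≤ t →
      ∫ x, φ x • (u t) x =
        (∫ x, φ x • u₀ x) +
          ∫ s in (0 : ℝ)..t, ∫ x,
            ((∑ l, (fderiv ℝ φ x (EuclideanSpace.single l 1)) •
                Matrix.toEuclideanCLM (n := ι) (𝕜 := ℂ) (A l) ((u s) x))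
              - φ x • Matrix.toEuclideanCLM (n := ι) (𝕜 := ℂ) (B x) ((u s) x)
              + φ x • (F s) x)

/-- `u` is a solution, and every solution coincides with it on `[0, ∞[`. -/
def IsUniqueSolution {d : ℕ} {ι : Type} [Fintype ι] [DecidableEq ι]
    (A : Fin d → Matrix ι ι ℂ) (B : EuclideanSpace ℝ (Fin d) → Matrix ι ι ℂ)
    (u₀ : L2 d ι) (F : ℝ → L2 d ι) (u : ℝ → L2 d ι) : Prop :=
  IsSolution A B u₀ F u ∧ ∀ u', IsSolution A B u₀ F u' → Set.EqOn u' u (Set.Ici 0)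

/-- The Cauchy problem for `∂ₜ + ∑ₗ Aₗ ∂ₗ + B(x)` is strongly well posed in `L²(ℝᵈ)`. -/
def StronglyWellPosed {d : ℕ} {ι : Type} [Fintype ι] [DecidableEq ι]
    (A : Fin d → Matrix ι ι ℂ) (B : EuclideanSpace ℝ (Fin d) → Matrix ι ι ℂ) : Prop :=
  ∃ K : ℝ, 0 < K ∧ ∃ α : ℝ, ∀ u₀ : L2 d ι, ∃ u : ℝ → L2 d ι,
    IsUniqueSolution A B u₀ 0 u ∧ ∀ t : ℝ, 0 ≤ t → ‖u t‖ ≤ K * Real.exp (α * t) * ‖u₀‖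

/-- The matrices of Maxwell's equations `∂ₜE - ∇×H = 0`, `∂ₜH + ∇×E = 0`
for the unknown `U = E + iH`, that is `∂ₜU + i∇×U = 0`. -/
def maxwellA : Fin 3 → Matrix (Fin 3) (Fin 3) ℂ :=
  ![!![0, 0, 0; 0, 0, -Complex.I; 0, Complex.I, 0],
    !![0, 0, Complex.I; 0, 0, 0; -Complex.I, 0, 0],
    !![0, -Complex.I, 0; Complex.I, 0, 0; 0, 0, 0]]

/-- `Σ(x) = diag(σ₁(x₁), σ₂(x₂), σ₃(x₃))`. -/
def sigmaMat (σ : Fin 3 → ℝ → ℝ) (x : EuclideanSpace ℝ (Fin 3)) : Matrix (Fin 3) (Fin 3) ℂ :=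
  Matrix.diagonal fun j => ((σ j (x j) : ℝ) : ℂ)

/-- `Σ⁽¹⁾(x) = diag(σ₂ + σ₃ - σ₁, σ₃ + σ₁ - σ₂, σ₁ + σ₂ - σ₃)`. -/
def sigmaMat1 (σ : Fin 3 → ℝ → ℝ) (x : EuclideanSpace ℝ (Fin 3)) : Matrix (Fin 3) (Fin 3) ℂ :=
  let s : Fin 3 → ℂ := fun j => ((σ j (x j) : ℝ) : ℂ)
  Matrix.diagonal ![s 1 + s 2 - s 0, s 2 + s 0 - s 1, s 0 + s 1 - s 2]

/-- `Σ⁽²⁾(x) = diag((σ₁-σ₂)(σ₁-σ₃), (σ₂-σ₁)(σ₂-σ₃), (σ₃-σ₁)(σ₃-σ₂))`. -/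
def sigmaMat2 (σ : Fin 3 → ℝ → ℝ) (x : EuclideanSpace ℝ (Fin 3)) : Matrix (Fin 3) (Fin 3) ℂ :=
  let s : Fin 3 → ℂ := fun j => ((σ j (x j) : ℝ) : ℂ)
  Matrix.diagonal ![(s 0 - s 1) * (s 0 - s 2), (s 1 - s 0) * (s 1 - s 2),
    (s 2 - s 0) * (s 2 - s 1)]

/-- Principal part of the system for `(V, W)`: only `V` is differentiated in space. -/
def pmlA (l : Fin 3) : Matrix (Fin 3 ⊕ Fin 3) (Fin 3 ⊕ Fin 3) ℂ :=
  Matrix.fromBlocks (maxwellA l) 0 0 0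

/-- Zero order part of the system for `(V, W)`:
`L V + Σ⁽¹⁾ V + Σ⁽²⁾ W = 0`, `∂ₜ W + Σ W - V = 0`. -/
def pmlB (σ : Fin 3 → ℝ → ℝ) (x : EuclideanSpace ℝ (Fin 3)) :
    Matrix (Fin 3 ⊕ Fin 3) (Fin 3 ⊕ Fin 3) ℂ :=
  Matrix.fromBlocks (sigmaMat1 σ x) (sigmaMat2 σ x) (-1) (sigmaMat σ x)

/-- `v ↦ (v, 0)`, as a map `ℂ³ → ℂ³ × ℂ³`. -/
def inV : EuclideanSpace ℂ (Fin 3) →L[ℂ] EuclideanSpace ℂ (Fin 3 ⊕ Fin 3) :=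
  LinearMap.toContinuousLinearMap
    { toFun := fun v => WithLp.toLp 2 (Sum.elim (fun j => v j) (fun _ => 0))
      map_add' := by
        intro v w
        ext j
        rcases j with j | j <;> simp
      map_smul' := by
        intro c v
        ext j
        rcases j with j | j <;> simp }

/-- The field `U = V - Σ W` at the point `x`, recovered from the value `y = (V, W)` there. -/
def recoverU (σ : Fin 3 → ℝ → ℝ) (x : EuclideanSpace ℝ (Fin 3))
    (y : EuclideanSpace ℂ (Fin 3 ⊕ Fin 3)) : EuclideanSpace ℂ (Fin 3) :=
  WithLp.toLp 2 fun j => y (Sum.inl j) - ((σ j (x j) : ℝ) : ℂ) * y (Sum.inr j)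

/-- The box `∏ⱼ {|xⱼ| ≤ Lⱼ}`. -/
def box (L : Fin 3 → ℝ) : Set (EuclideanSpace ℝ (Fin 3)) := {x | ∀ j, |x j| ≤ L j}

/-- `f ∈ L²` vanishes almost everywhere outside the set `R`. -/
def SupportedIn (R : Set (EuclideanSpace ℝ (Fin 3))) (f : L2 3 (Fin 3)) : Prop :=
  ∀ᵐ x, x ∉ R → f x = 0

/-- For all sources supported in the box (an initial value `U₀ ∈ L²` and a right hand side
`F ∈ L¹_loc([0, ∞[; L²)`), the problem for `(V, W)` with right hand side `(F, 0)` and initial value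
`(U₀, 0)`, and Maxwell's equations with right hand side `F` and initial value `U₀`, have unique
solutions, and `V - Σ W` is equal to the solution of Maxwell's equations in the box. -/
def PerfectlyMatched (σ : Fin 3 → ℝ → ℝ) (L : Fin 3 → ℝ) : Prop :=
  ∀ (U₀ : L2 3 (Fin 3)) (F : ℝ → L2 3 (Fin 3)),
    SupportedIn (box L) U₀ →
    (∀ T : ℝ, 0 ≤ T → IntegrableOn F (Set.Icc 0 T)) →
    (∀ᵐ t ∂(volume.restrict (Set.Ioi (0 : ℝ))), SupportedIn (box L) (F t)) →
    ∃ (Y : ℝ → L2 3 (Fin 3 ⊕ Fin 3)) (U : ℝ → L2 3 (Fin 3)),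
      IsUniqueSolution pmlA (pmlB σ) (inV.compLp U₀) (fun t => inV.compLp (F t)) Y ∧
      IsUniqueSolution maxwellA (fun _ => 0) U₀ F U ∧
      ∀ t : ℝ, 0 ≤ t → ∀ᵐ x, x ∈ box L → recoverU σ x ((Y t) x) = (U t) x

end PML

end

open MeasureTheory Filter Topology Set

noncomputable section

namespace PML

/-! ### An integrated product rule for Banach space valued functions. -/

section ProductRule

variable {E G : Type*} [NormedAddCommGroup E] [NormedSpace ℝ E]
  [NormedAddCommGroup G] [NormedSpace ℝ G]

/-! Well-posedness. Since the matrices `Aₗ` are Hermitian, `-∑ₗ Aₗ ∂ₗ` is a Fourier multiplier with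
skew-adjoint symbol. Cut off to balls in frequency it becomes a bounded skew-adjoint operator, and
the exponentials of these truncations converge to a strongly continuous group `S` of contractions
(`TruncatedGenerator.exists_group`). For a bounded zero order term, the unknown `z(t) = S(-t) u(t)`
satisfies a Volterra equation with Lipschitz kernel: a weighted contraction argument gives existence
and exponential growth, Gronwall's inequality gives uniqueness. By Plancherel and duality the
distributional solutions are exactly these evolutions (`weakRel_iff_rel`,
`isSolution_iff_isEvolution`). The layer system is of this type: its principal part is Hermitian and
its coefficients are essentially bounded.

Perfect matching. A Laplace transform in time, at large real `a`, turns both evolutions into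
stationary problems. For real `a` and smooth bounded `σ`, the primitive of `1 + σⱼ/a` is a genuine
real change of variables in `xⱼ`, equal to the identity where `|xⱼ| ≤ Lⱼ`. Composing the stationary
Maxwell field with this change of variables and rescaling its components gives a solution of the
stationary layer problem which coincides with the Maxwell field in the box (`exists_weakRel_pml`).
No complex contour is involved.

The resolvent estimate `TruncatedGenerator.Rel.norm_le` makes stationary solutions unique and stable
under strong perturbations of the zero order term, so mollifying `σ` extends the matching to
essentially bounded coefficients (`exists_stationary_matching`). Real Laplace values near infinity
determine a continuous function of exponential growth (`eqOn_zero_of_laplace_eq_zero`), which brings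
the matching back to the time domain. Sources that are only locally integrable in time are truncated
at the time of observation, which does not change the solution up to that time. In the box `Σ`
vanishes, so there `V - Σ W` is simply `V`. -/

theorem intervalIntegrable_clm_apply {k : ℝ → E →L[ℝ] G} {m : ℝ → E} {a b : ℝ}
    (hk : Continuous k) (hm : IntervalIntegrable m volume a b) :
    IntervalIntegrable (fun s => k s (m s)) volume a b := by
  obtain ⟨C, hC⟩ := (isCompact_uIcc (a := a) (b := b)).exists_bound_of_continuousOn
    hk.continuousOn
  rw [intervalIntegrable_iff] at hm ⊢
  refine Integrable.mono' (hm.norm.const_mul C) ?_ ?_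
  · exact (ContinuousLinearMap.apply ℝ G).flip.aestronglyMeasurable_comp₂
      hk.aestronglyMeasurable hm.aestronglyMeasurable
  · filter_upwards [ae_restrict_mem measurableSet_uIoc] with s hs
    exact ((k s).le_opNorm _).trans (by gcongr; exact hC s (uIoc_subset_uIcc hs))

/-- Fubini's theorem on a triangle. -/
theorem integral_deriv_apply_primitive [CompleteSpace E] [CompleteSpace G]
    {k k' : ℝ → E →L[ℝ] G} {m : ℝ → E} {T : ℝ}
    (hT : 0 ≤ T) (hk : ∀ s, HasDerivAt k (k' s) s) (hk' : Continuous k')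
    (hm : IntervalIntegrable m volume 0 T) :
    ∫ s in (0 : ℝ)..T, k' s (∫ r in (0 : ℝ)..s, m r) =
      ∫ r in (0 : ℝ)..T, (k T (m r) - k r (m r)) := by
  obtain ⟨C, hC⟩ := (isCompact_Icc (a := (0 : ℝ)) (b := T)).exists_bound_of_continuousOn
    hk'.continuousOn
  have hm' : IntegrableOn m (Ioc 0 T) := by
    rwa [intervalIntegrable_iff_integrableOn_Ioc_of_le hT] at hm
  let μ : Measure ℝ := volume.restrict (Ioc 0 T)
  let f : ℝ → ℝ → G := fun s r => (Iic s).indicator (fun r => k' s (m r)) r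
  have hf : Integrable (Function.uncurry f) (μ.prod μ) := by
    have h1 : Integrable (fun p : ℝ × ℝ => C * ‖m p.2‖) (μ.prod μ) :=
      (Integrable.comp_snd (μ := μ) (ν := μ) hm'.norm).const_mul C
    have h2 : AEStronglyMeasurable (fun p : ℝ × ℝ => k' p.1 (m p.2)) (μ.prod μ) :=
      (ContinuousLinearMap.apply ℝ G).flip.aestronglyMeasurable_comp₂
        (hk'.comp continuous_fst).aestronglyMeasurable hm'.aestronglyMeasurable.comp_snd
    have h3 : MeasurableSet {p : ℝ × ℝ | p.2 ≤ p.1} :=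
      measurableSet_le measurable_snd measurable_fst
    have h4 : Function.uncurry f =
        {p : ℝ × ℝ | p.2 ≤ p.1}.indicator (fun p => k' p.1 (m p.2)) := by
      ext ⟨s, r⟩
      simp [f, Set.indicator]
    rw [h4]
    refine Integrable.mono' h1 (h2.indicator h3) ?_
    have h5 : ∀ᵐ p ∂(μ.prod μ), p.1 ∈ Ioc 0 T := by
      exact Measure.quasiMeasurePreserving_fst.ae (ae_restrict_mem measurableSet_Ioc)
    filter_upwards [h5] with p hp
    refine (norm_indicator_le_norm_self _ _).trans (((k' p.1).le_opNorm _).trans ?_)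
    gcongr
    exact hC _ ⟨hp.1.le, hp.2⟩
  have hswap := integral_integral_swap hf
  rw [intervalIntegral.integral_of_le hT, intervalIntegral.integral_of_le hT]
  refine Eq.trans ?_ (hswap.trans ?_)
  · refine setIntegral_congr_fun measurableSet_Ioc fun s hs => ?_
    simp only [f, μ]
    rw [integral_indicator measurableSet_Iic, Measure.restrict_restrict measurableSet_Iic,
      Set.inter_comm, Ioc_inter_Iic, min_eq_right hs.2,
      ← intervalIntegral.integral_of_le hs.1.le, ContinuousLinearMap.intervalIntegral_comp_comm]
    exact hm.mono_set (by
      rw [uIcc_of_le hs.1.le, uIcc_of_le hT]; exact Icc_subset_Icc_right hs.2)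
  · refine setIntegral_congr_fun measurableSet_Ioc fun r hr => ?_
    simp only [f, μ]
    have h6 : (fun s => (Iic s).indicator (fun r => k' s (m r)) r) =
        (Ici r).indicator (fun s => k' s (m r)) := by
      ext s
      simp [Set.indicator]
    rw [h6, integral_indicator measurableSet_Ici, Measure.restrict_restrict measurableSet_Ici]
    have h7 : Ici r ∩ Ioc 0 T = Icc r T := by
      ext s
      simp only [mem_inter_iff, mem_Ici, mem_Ioc, mem_Icc]
      exact ⟨fun h => ⟨h.1, h.2.2⟩, fun h => ⟨h.1, hr.1.trans_le h.1, h.2⟩⟩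
    rw [h7, integral_Icc_eq_integral_Ioc, ← intervalIntegral.integral_of_le hr.2]
    have h8 : ∀ s ∈ uIcc r T, HasDerivAt (fun s => k s (m r)) (k' s (m r)) s := fun s _ => by
      simpa using (hk s).clm_apply (hasDerivAt_const s (m r))
    exact intervalIntegral.integral_eq_sub_of_hasDerivAt h8
      (hk'.clm_apply continuous_const).continuousOn.intervalIntegrable

/-- The product rule, in integrated form, for an operator valued function of class `C¹` and the
primitive of an integrable function. -/
theorem clm_apply_primitive [CompleteSpace E] [CompleteSpace G]
    {k k' : ℝ → E →L[ℝ] G} {m : ℝ → E} {T : ℝ}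
    (hT : 0 ≤ T) (hk : ∀ s, HasDerivAt k (k' s) s) (hk' : Continuous k')
    (hm : IntervalIntegrable m volume 0 T) (x₀ : E) :
    k T (x₀ + ∫ r in (0 : ℝ)..T, m r) = k 0 x₀ +
      ∫ s in (0 : ℝ)..T, (k' s (x₀ + ∫ r in (0 : ℝ)..s, m r) + k s (m s)) := by
  have hkc : Continuous k := continuous_iff_continuousAt.2 fun s => (hk s).continuousAt
  have hprim : ContinuousOn (fun s => ∫ r in (0 : ℝ)..s, m r) (uIcc 0 T) :=
    intervalIntegral.continuousOn_primitive_interval (by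
      rw [← intervalIntegrable_iff']; exact hm)
  have i1 : IntervalIntegrable (fun s => k' s x₀) volume 0 T :=
    (hk'.clm_apply continuous_const).intervalIntegrable _ _
  have i2 : IntervalIntegrable (fun s => k' s (∫ r in (0 : ℝ)..s, m r)) volume 0 T :=
    (hk'.continuousOn.clm_apply hprim).intervalIntegrable
  have i3 := intervalIntegrable_clm_apply hkc hm
  have i4 : IntervalIntegrable (fun s => k T (m s)) volume 0 T :=
    intervalIntegrable_clm_apply continuous_const hm
  have e1 : ∫ s in (0 : ℝ)..T, k' s x₀ = k T x₀ - k 0 x₀ :=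
    intervalIntegral.integral_eq_sub_of_hasDerivAt
      (fun s _ => by simpa using (hk s).clm_apply (hasDerivAt_const s x₀)) i1
  -- As `m` is only integrable, its primitive need not be differentiable everywhere; Fubini's
  -- theorem replaces differentiation of the product.
  have e2 := integral_deriv_apply_primitive hT hk hk' hm
  simp only [map_add]
  rw [intervalIntegral.integral_add (i1.add i2) i3, intervalIntegral.integral_add i1 i2, e1, e2,
    intervalIntegral.integral_sub i4 i3, ContinuousLinearMap.intervalIntegral_comp_comm _ hm]
  abel

end ProductRule

/-! ### Contraction groups as limits of exponentials of truncated generators. -/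

/-- Bounded approximations `generator n` of a skew-adjoint operator, cut off by the contractions
`cutoff n`, which commute with it. -/
structure TruncatedGenerator (H : Type*) [NormedAddCommGroup H] [InnerProductSpace ℂ H]
    [CompleteSpace H] where
  cutoff : ℕ → H →L[ℂ] H
  generator : ℕ → H →L[ℂ] H
  skew : ∀ n, generator n ∈ skewAdjoint (H →L[ℂ] H)
  tendsto_cutoff : ∀ x, Tendsto (fun n => cutoff n x) atTop (𝓝 x)
  cutoff_mul_generator : ∀ m n, m ≤ n → cutoff m * generator n = generator m
  generator_mul_cutoff : ∀ m n, m ≤ n → generator n * cutoff m = generator m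

/-- A strongly continuous group of contractions. -/
structure IsContractionGroup {H : Type*} [NormedAddCommGroup H] [InnerProductSpace ℂ H]
    (S : ℝ → H →L[ℂ] H) : Prop where
  norm_le : ∀ t x, ‖S t x‖ ≤ ‖x‖
  zero : ∀ x, S 0 x = x
  add : ∀ s t x, S (s + t) x = S s (S t x)
  continuous : ∀ x, Continuous fun t => S t x

namespace IsContractionGroup

variable {H : Type*} [NormedAddCommGroup H] [InnerProductSpace ℂ H] {S : ℝ → H →L[ℂ] H}

theorem neg_apply (hS : IsContractionGroup S) (t : ℝ) (x : H) : S (-t) (S t x) = x := by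
  rw [← hS.add, neg_add_cancel, hS.zero]

theorem apply_neg (hS : IsContractionGroup S) (t : ℝ) (x : H) : S t (S (-t) x) = x := by
  rw [← hS.add, add_neg_cancel, hS.zero]

/-- Strong continuity handles the time variable at a fixed vector; the contraction bound makes the
dependence on the vector uniform in time. -/
theorem continuous_uncurry (hS : IsContractionGroup S) :
    Continuous fun p : ℝ × H => S p.1 p.2 := by
  rw [continuous_iff_continuousAt]
  rintro ⟨t, x⟩
  have h1 : Tendsto (fun p : ℝ × H => S p.1 x) (𝓝 (t, x)) (𝓝 (S t x)) :=
    ((hS.continuous x).tendsto t).comp (continuous_fst.tendsto (t, x))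
  have h2 : Tendsto (fun p : ℝ × H => S p.1 (p.2 - x)) (𝓝 (t, x)) (𝓝 0) := by
    refine squeeze_zero_norm (fun p => hS.norm_le _ _) ?_
    have : Continuous fun p : ℝ × H => ‖p.2 - x‖ := by fun_prop
    simpa using this.tendsto (t, x)
  have h3 := h1.add h2
  simp only [← map_add, add_sub_cancel, add_zero] at h3
  exact h3

theorem intervalIntegrable (hS : IsContractionGroup S) {g : ℝ → H} {a b : ℝ}
    (hg : IntervalIntegrable g volume a b) {c : ℝ → ℝ} (hc : Continuous c) :
    IntervalIntegrable (fun s => S (c s) (g s)) volume a b := by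
  rw [intervalIntegrable_iff] at hg ⊢
  refine Integrable.mono' hg.norm ?_ (ae_of_all _ fun s => hS.norm_le _ _)
  exact hS.continuous_uncurry.comp_aestronglyMeasurable
    (hc.aestronglyMeasurable.prodMk hg.aestronglyMeasurable)

end IsContractionGroup

namespace TruncatedGenerator

variable {H : Type*} [NormedAddCommGroup H] [InnerProductSpace ℂ H] [CompleteSpace H]
  (𝒢 : TruncatedGenerator H)

/-- The group generated by the `n`-th truncation. -/
def expGen (n : ℕ) (t : ℝ) : H →L[ℂ] H := NormedSpace.exp (t • 𝒢.generator n)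

theorem smul_generator_mem (n : ℕ) (t : ℝ) :
    t • 𝒢.generator n ∈ skewAdjoint (H →L[ℂ] H) :=
  skewAdjoint.smul_mem t (𝒢.skew n)

theorem norm_expGen_apply (n : ℕ) (t : ℝ) (x : H) : ‖𝒢.expGen n t x‖ = ‖x‖ := by
  let _ := NormedAlgebra.restrictScalars ℚ ℂ (H →L[ℂ] H)
  have h : 𝒢.expGen n t ∈ unitary (H →L[ℂ] H) :=
    NormedSpace.exp_mem_unitary_of_mem_skewAdjoint (𝒢.smul_generator_mem n t)
  exact ContinuousLinearMap.norm_map_of_mem_unitary h x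

theorem expGen_zero (n : ℕ) : 𝒢.expGen n 0 = 1 := by
  let _ := NormedAlgebra.restrictScalars ℚ ℂ (H →L[ℂ] H)
  simp [expGen]

theorem expGen_add (n : ℕ) (s t : ℝ) :
    𝒢.expGen n (s + t) = 𝒢.expGen n s * 𝒢.expGen n t := by
  let _ := NormedAlgebra.restrictScalars ℚ ℂ (H →L[ℂ] H)
  rw [expGen, add_smul, NormedSpace.exp_add_of_commute]
  · rfl
  · exact ((Commute.refl _).smul_left s).smul_right t

theorem hasDerivAt_expGen (n : ℕ) (t : ℝ) :
    HasDerivAt (𝒢.expGen n) (𝒢.expGen n t * 𝒢.generator n) t :=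
  hasDerivAt_exp_smul_const (𝒢.generator n) t

theorem continuous_expGen (n : ℕ) : Continuous (𝒢.expGen n) :=
  continuous_iff_continuousAt.2 fun t => (𝒢.hasDerivAt_expGen n t).continuousAt

/-- The cutoff intertwines the two generators, hence every power of them and their exponentials. -/
theorem cutoff_mul_expGen {m n : ℕ} (h : m ≤ n) (t : ℝ) :
    𝒢.cutoff m * 𝒢.expGen n t = 𝒢.expGen m t * 𝒢.cutoff m := by
  let _ := NormedAlgebra.restrictScalars ℚ ℂ (H →L[ℂ] H)
  have h1 : SemiconjBy (𝒢.cutoff m) (t • 𝒢.generator n) (t • 𝒢.generator m) := by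
    rw [SemiconjBy, mul_smul_comm, smul_mul_assoc, 𝒢.cutoff_mul_generator m n h,
      𝒢.generator_mul_cutoff m m le_rfl]
  exact h1.exp_right

theorem expGen_mul_cutoff {m n : ℕ} (h : m ≤ n) (t : ℝ) :
    𝒢.expGen n t * 𝒢.cutoff m = 𝒢.expGen m t * 𝒢.cutoff m := by
  let _ := NormedAlgebra.restrictScalars ℚ ℂ (H →L[ℂ] H)
  have h1 : SemiconjBy (𝒢.cutoff m) (t • 𝒢.generator m) (t • 𝒢.generator n) := by
    rw [SemiconjBy, mul_smul_comm, smul_mul_assoc, 𝒢.cutoff_mul_generator m m le_rfl,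
      𝒢.generator_mul_cutoff m n h]
  have h2 : 𝒢.cutoff m * 𝒢.expGen m t = 𝒢.expGen n t * 𝒢.cutoff m := h1.exp_right
  rw [← h2, 𝒢.cutoff_mul_expGen le_rfl]

/-- Both groups agree on the range of `cutoff m`, and each carries the remainder `cutoff m x - x`
isometrically. The bound does not depend on `t`, which gives convergence uniform in time and hence
continuity of the limit. -/
theorem dist_expGen_le {m n : ℕ} (h : m ≤ n) (t : ℝ) (x : H) :
    dist (𝒢.expGen n t x) (𝒢.expGen m t x) ≤ 2 * dist (𝒢.cutoff m x) x := by
  have e : 𝒢.expGen n t (𝒢.cutoff m x) = 𝒢.expGen m t (𝒢.cutoff m x) :=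
    DFunLike.congr_fun (𝒢.expGen_mul_cutoff h t) x
  have h1 : ∀ k, dist (𝒢.expGen k t (𝒢.cutoff m x)) (𝒢.expGen k t x) =
      dist (𝒢.cutoff m x) x := fun k => by
    rw [dist_eq_norm, ← map_sub, norm_expGen_apply, dist_eq_norm]
  calc dist (𝒢.expGen n t x) (𝒢.expGen m t x)
      ≤ dist (𝒢.expGen n t (𝒢.cutoff m x)) (𝒢.expGen n t x) +
          dist (𝒢.expGen n t (𝒢.cutoff m x)) (𝒢.expGen m t x) := dist_triangle_left _ _ _
    _ = 2 * dist (𝒢.cutoff m x) x := by rw [e, ← e, h1, e, h1]; ring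

theorem exists_tendstoUniformly (x : H) :
    ∃ f : ℝ → H, TendstoUniformly (fun n t => 𝒢.expGen n t x) f atTop := by
  have h0 : Tendsto (fun n => 2 * dist (𝒢.cutoff n x) x) atTop (𝓝 0) := by
    have := (tendsto_iff_dist_tendsto_zero.1 (𝒢.tendsto_cutoff x)).const_mul 2
    simpa using this
  have hC : UniformCauchySeqOn (fun n t => 𝒢.expGen n t x) atTop univ := by
    rw [Metric.uniformCauchySeqOn_iff]
    intro ε hε
    obtain ⟨N, hN⟩ := ((h0.eventually (gt_mem_nhds (half_pos hε)))).exists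
    refine ⟨N, fun m hm n hn t _ => ?_⟩
    calc _ ≤ dist (𝒢.expGen m t x) (𝒢.expGen N t x) + dist (𝒢.expGen n t x) (𝒢.expGen N t x) :=
          dist_triangle_right _ _ _
      _ < ε / 2 + ε / 2 := add_lt_add ((𝒢.dist_expGen_le hm t x).trans_lt hN)
          ((𝒢.dist_expGen_le hn t x).trans_lt hN)
      _ = ε := add_halves ε
  choose f hf using fun t => cauchySeq_tendsto_of_complete (hC.cauchySeq (mem_univ t))
  refine ⟨f, ?_⟩
  rw [← tendstoUniformlyOn_univ]
  exact hC.tendstoUniformlyOn_of_tendsto fun t _ => hf t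

/-- The group generated by the limit of the truncations. -/
theorem exists_group : ∃ S : ℝ → H →L[ℂ] H, IsContractionGroup S ∧
    ∀ n t x, 𝒢.cutoff n (S t x) = 𝒢.expGen n t (𝒢.cutoff n x) := by
  choose f hf using 𝒢.exists_tendstoUniformly
  have hlim : ∀ t x, Tendsto (fun n => 𝒢.expGen n t x) atTop (𝓝 (f x t)) :=
    fun t x => (hf x).tendsto_at t
  have hnorm : ∀ t x, ‖f x t‖ = ‖x‖ := fun t x =>
    tendsto_nhds_unique (hlim t x).norm (by simp only [norm_expGen_apply]; exact tendsto_const_nhds)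
  let S : ℝ → H →L[ℂ] H := fun t => LinearMap.mkContinuous
    { toFun := fun x => f x t
      map_add' := fun x y => tendsto_nhds_unique (hlim t (x + y)) (by
        simp only [map_add]; exact (hlim t x).add (hlim t y))
      map_smul' := fun c x => tendsto_nhds_unique (hlim t (c • x)) (by
        simp only [map_smul]; exact (hlim t x).const_smul c) } 1
    (fun x => by simpa using (hnorm t x).le)
  have hS : ∀ t x, S t x = f x t := fun t x => rfl
  refine ⟨S, ⟨fun t x => (hnorm t x).le, fun x => ?_, fun s t x => ?_, fun x => ?_⟩, ?_⟩
  · refine tendsto_nhds_unique (hlim 0 x) ?_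
    simp only [expGen_zero]
    exact tendsto_const_nhds
  · refine tendsto_nhds_unique (hlim (s + t) x) ?_
    -- The operators and the vectors converge simultaneously; isometry of `expGen n s` makes the
    -- second term harmless.
    have h1 : ∀ n, 𝒢.expGen n (s + t) x =
        𝒢.expGen n s (f x t) + 𝒢.expGen n s (𝒢.expGen n t x - f x t) := fun n => by
      rw [expGen_add, ← map_add, add_sub_cancel]; rfl
    simp only [h1]
    have h2 : Tendsto (fun n => 𝒢.expGen n s (𝒢.expGen n t x - f x t)) atTop (𝓝 0) := by
      rw [tendsto_zero_iff_norm_tendsto_zero]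
      simp only [norm_expGen_apply]
      exact tendsto_iff_norm_sub_tendsto_zero.1 (hlim t x)
    have h3 := (hlim s (f x t)).add h2
    rwa [add_zero] at h3
  · exact (hf x).continuous (Frequently.of_forall fun n =>
      (𝒢.continuous_expGen n).clm_apply continuous_const)
  · intro n t x
    refine tendsto_nhds_unique (((𝒢.cutoff n).continuous.tendsto _).comp (hlim t x)) ?_
    refine tendsto_const_nhds.congr' ?_
    filter_upwards [eventually_ge_atTop n] with k hk
    exact (DFunLike.congr_fun (𝒢.cutoff_mul_expGen hk t) x).symm

end TruncatedGenerator

end PML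

end

open MeasureTheory Filter Topology Set

noncomputable section

namespace PML

/-! ### Volterra equations with a Lipschitz kernel. -/

section Volterra

variable {H : Type*} [NormedAddCommGroup H] [NormedSpace ℝ H]

/-- The free term `h` cancels in `z - w`, whose right derivative is then bounded by `b ‖z - w‖`;
Gronwall's inequality with zero initial value concludes. -/
theorem volterra_unique [CompleteSpace H] {C : ℝ → H → H} {b : ℝ}
    (hC : Continuous fun p : ℝ × H => C p.1 p.2)
    (hb : ∀ s x y, ‖C s x - C s y‖ ≤ b * ‖x - y‖) {h z w : ℝ → H} {T : ℝ}
    (hz : ContinuousOn z (Icc 0 T)) (hw : ContinuousOn w (Icc 0 T))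
    (ez : ∀ t ∈ Icc 0 T, z t = h t - ∫ s in (0 : ℝ)..t, C s (z s))
    (ew : ∀ t ∈ Icc 0 T, w t = h t - ∫ s in (0 : ℝ)..t, C s (w s)) :
    EqOn z w (Icc 0 T) := by
  have hcz : ContinuousOn (fun s => C s (z s)) (Icc 0 T) :=
    hC.comp_continuousOn (continuousOn_id.prodMk hz)
  have hcw : ContinuousOn (fun s => C s (w s)) (Icc 0 T) :=
    hC.comp_continuousOn (continuousOn_id.prodMk hw)
  let D : ℝ → H := fun s => C s (w s) - C s (z s)
  have hD : ContinuousOn D (Icc 0 T) := hcw.sub hcz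
  have hint : ∀ t ∈ Icc 0 T, z t - w t = ∫ s in (0 : ℝ)..t, D s := by
    intro t ht
    have hsub : uIcc 0 t ⊆ Icc 0 T := by
      rw [uIcc_of_le ht.1]; exact Icc_subset_Icc_right ht.2
    rw [ez t ht, ew t ht, intervalIntegral.integral_sub
      (hcw.mono hsub).intervalIntegrable (hcz.mono hsub).intervalIntegrable]
    abel
  have hder : ∀ x ∈ Ico 0 T, HasDerivWithinAt (fun t => z t - w t) (D x) (Ici x) x := by
    intro x hx
    have hsub : Icc 0 T ∈ 𝓝[>] x :=
      mem_of_superset (Ioo_mem_nhdsGT hx.2)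
        fun y hy => ⟨hx.1.trans hy.1.le, hy.2.le⟩
    have hsub' : Icc 0 T ∈ 𝓝[≥] x :=
      mem_of_superset (Ico_mem_nhdsGE hx.2)
        fun y hy => ⟨hx.1.trans hy.1, hy.2.le⟩
    have h1 : HasDerivWithinAt (fun t => ∫ s in (0 : ℝ)..t, D s) (D x) (Ici x) x := by
      refine intervalIntegral.integral_hasDerivWithinAt_right ?_ ?_ ?_
      · refine (hD.mono ?_).intervalIntegrable
        rw [uIcc_of_le hx.1]; exact Icc_subset_Icc_right hx.2.le
      · exact ⟨Icc 0 T, hsub, hD.aestronglyMeasurable measurableSet_Icc⟩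
      · exact (hD x ⟨hx.1, hx.2.le⟩).mono_of_mem_nhdsWithin hsub
    exact (h1.congr_of_eventuallyEq (by
      filter_upwards [hsub'] with t ht using hint t ht) (hint x ⟨hx.1, hx.2.le⟩))
  intro t ht
  have h0 := norm_le_gronwallBound_of_norm_deriv_right_le (hz.sub hw) hder (δ := 0) (K := b)
    (ε := 0) (by
      have := hint 0 ⟨le_rfl, ht.1.trans ht.2⟩
      simp only [Pi.sub_apply]
      rw [this]; simp) (fun x hx => by
      simp only [D, add_zero, Pi.sub_apply]
      rw [norm_sub_rev]
      exact hb x _ _) t ht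
  simp only [gronwallBound_ε0, zero_mul] at h0
  exact sub_eq_zero.1 (norm_le_zero_iff.1 h0)

open BoundedContinuousFunction in
-- Substituting `z t = exp (a t) v t` with a large weight `a` makes the integral operator a
-- contraction on bounded continuous functions over all times at once. The growth bound on `z` is
-- the bound on the fixed point `v`.
theorem volterra_exists_of_bounded [CompleteSpace H] {C : ℝ → H → H} {b : ℝ} (hb0 : 0 ≤ b)
    (hC : Continuous fun p : ℝ × H => C p.1 p.2)
    (hb : ∀ s x y, ‖C s x - C s y‖ ≤ b * ‖x - y‖) (hC0 : ∀ s, C s 0 = 0) {h : ℝ → H}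
    (hh : ContinuousOn h (Ici 0)) {M : ℝ} (hM : ∀ t, 0 ≤ t → ‖h t‖ ≤ M) :
    ∃ z : ℝ → H, Continuous z ∧ (∀ t, 0 ≤ t → z t = h t - ∫ s in (0 : ℝ)..t, C s (z s)) ∧
      ∀ t, 0 ≤ t → ‖z t‖ ≤ 2 * M * Real.exp ((2 * b + 1) * t) := by
  -- This weight makes `b / a ≤ 1 / 2`, the contraction factor; the added `1` keeps it positive when
  -- `b = 0`.
  set a : ℝ := 2 * b + 1 with ha
  have ha0 : 0 < a := by positivity
  have hab : b / a ≤ 1 / 2 := by rw [div_le_div_iff₀ ha0 two_pos]; linarith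
  have hexp : ∀ s, Real.exp (a * s) * Real.exp (-(a * s)) = 1 := fun s => by
    rw [← Real.exp_add, add_neg_cancel, Real.exp_zero]
  let k : (ℝ → H) → ℝ → H := fun v s => C s (Real.exp (a * s) • v s)
  have hk : ∀ v : ℝ →ᵇ H, Continuous (k v) := fun v => by
    refine hC.comp (continuous_id.prodMk ?_)
    exact (by fun_prop : Continuous fun s => Real.exp (a * s)).smul v.continuous
  -- Negative times are frozen at `0`, so that the fixed point problem lives on functions over the
  -- whole line.
  let P : (ℝ →ᵇ H) → ℝ → H := fun v t =>
    Real.exp (-(a * max t 0)) • (h (max t 0) - ∫ s in (0 : ℝ)..max t 0, k v s)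
  have hPc : ∀ v, Continuous (P v) := fun v => by
    refine Continuous.smul (by fun_prop) (Continuous.sub ?_ ?_)
    · exact hh.comp_continuous (by fun_prop) fun t => le_max_right t 0
    · exact (intervalIntegral.continuous_primitive
        (fun x y => (hk v).intervalIntegrable x y) 0).comp (by fun_prop)
  have hPdiff : ∀ (v w : ℝ → H) (_ : Continuous (k v)) (_ : Continuous (k w)) (D : ℝ)
      (_ : ∀ s, ‖v s - w s‖ ≤ D) (t : ℝ) (_ : 0 ≤ t), Real.exp (-(a * t)) *
      ‖(∫ s in (0 : ℝ)..t, k v s) - ∫ s in (0 : ℝ)..t, k w s‖ ≤ 1 / 2 * D := by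
    intro v w hv hw D hD t ht
    have hD0 : 0 ≤ D := (norm_nonneg _).trans (hD 0)
    rw [← intervalIntegral.integral_sub (hv.intervalIntegrable _ _) (hw.intervalIntegrable _ _)]
    have h1 : ∀ s, ‖k v s - k w s‖ ≤ b * D * Real.exp (a * s) := fun s => by
      refine (hb _ _ _).trans ?_
      rw [← smul_sub, norm_smul, Real.norm_of_nonneg (Real.exp_pos _).le]
      calc b * (Real.exp (a * s) * ‖v s - w s‖) ≤ b * (Real.exp (a * s) * D) := by gcongr; exact hD s
        _ = _ := by ring
    have h2 : ‖∫ s in (0 : ℝ)..t, (k v s - k w s)‖ ≤ ∫ s in (0 : ℝ)..t, b * D * Real.exp (a * s) :=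
      intervalIntegral.norm_integral_le_of_norm_le ht (ae_of_all _ fun s _ => h1 s)
        (Continuous.intervalIntegrable (by fun_prop) _ _)
    have h3 : ∫ s in (0 : ℝ)..t, b * D * Real.exp (a * s) =
        b * D * ((Real.exp (a * t) - 1) / a) := by
      rw [intervalIntegral.integral_const_mul]
      congr 1
      have : ∀ s ∈ uIcc 0 t, HasDerivAt (fun s => Real.exp (a * s) / a) (Real.exp (a * s)) s := by
        intro s _
        have h := ((hasDerivAt_id s).const_mul a).exp.div_const a
        simpa [mul_div_assoc, ha0.ne'] using h
      rw [intervalIntegral.integral_eq_sub_of_hasDerivAt this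
        (Continuous.intervalIntegrable (by fun_prop) _ _)]
      simp [sub_div]
    calc _ ≤ Real.exp (-(a * t)) * (b * D * ((Real.exp (a * t) - 1) / a)) := by
          rw [← h3]; gcongr
      _ = b / a * (1 - Real.exp (-(a * t))) * D := by
          have e := hexp t
          have : Real.exp (-(a * t)) * (b * D * ((Real.exp (a * t) - 1) / a)) =
            b / a * (Real.exp (a * t) * Real.exp (-(a * t)) - Real.exp (-(a * t))) * D := by ring
          rw [this, e]
      _ ≤ 1 / 2 * 1 * D := by
          gcongr
          · have : Real.exp (-(a * t)) ≤ 1 := Real.exp_le_one_iff.2 (by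
              have := mul_nonneg ha0.le ht; linarith)
            linarith
          · linarith [Real.exp_pos (-(a * t))]
      _ = _ := by ring
  have hk0 : k 0 = 0 := by
    ext s; simp [k, hC0]
  have hexp1 : ∀ t, 0 ≤ t → Real.exp (-(a * t)) ≤ 1 := fun t ht =>
    Real.exp_le_one_iff.2 (by have := mul_nonneg ha0.le ht; linarith)
  have hPb : ∀ v t, ‖P v t‖ ≤ M + 1 / 2 * ‖v‖ := fun v t => by
    have ht := le_max_right t 0
    have h1 := hPdiff v 0 (hk v) (by rw [hk0]; exact continuous_zero) ‖v‖
      (fun s => by simpa using v.norm_coe_le_norm s) _ ht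
    simp only [hk0, Pi.zero_apply, intervalIntegral.integral_zero, sub_zero] at h1
    simp only [P]
    rw [norm_smul, Real.norm_of_nonneg (Real.exp_pos _).le]
    calc _ ≤ Real.exp (-(a * max t 0)) * (‖h (max t 0)‖ + ‖∫ s in (0 : ℝ)..max t 0, k v s‖) := by
          gcongr; exact norm_sub_le _ _
      _ ≤ 1 * ‖h (max t 0)‖ + 1 / 2 * ‖v‖ := by
          rw [mul_add]
          gcongr
          exact hexp1 _ ht
      _ ≤ _ := by rw [one_mul]; gcongr; exact hM _ ht
  let Φ : (ℝ →ᵇ H) → (ℝ →ᵇ H) := fun v =>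
    BoundedContinuousFunction.ofNormedAddCommGroup (P v) (hPc v) (M + 1 / 2 * ‖v‖) (hPb v)
  have hΦ : ContractingWith (1 / 2) Φ := by
    refine ⟨by rw [← NNReal.coe_lt_coe]; push_cast; norm_num, LipschitzWith.of_dist_le_mul fun v w => ?_⟩
    rw [BoundedContinuousFunction.dist_le (by positivity)]
    intro t
    have ht := le_max_right t 0
    have h1 := hPdiff v w (hk v) (hk w) (dist v w) (fun s => by
      rw [← dist_eq_norm]; exact BoundedContinuousFunction.dist_coe_le_dist s) _ ht
    have h2 : Φ v t - Φ w t = -(Real.exp (-(a * max t 0)) •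
        ((∫ s in (0 : ℝ)..max t 0, k v s) - ∫ s in (0 : ℝ)..max t 0, k w s)) := by
      simp only [Φ, P, BoundedContinuousFunction.coe_ofNormedAddCommGroup]
      rw [← smul_sub, ← smul_neg]
      congr 1
      abel
    rw [dist_eq_norm, h2, norm_neg, norm_smul, Real.norm_of_nonneg (Real.exp_pos _).le]
    simpa using h1
  obtain ⟨v, hv⟩ : ∃ v, Φ v = v := ⟨_, hΦ.fixedPoint_isFixedPt⟩
  have hvt : ∀ t, 0 ≤ t → v t = Real.exp (-(a * t)) • (h t - ∫ s in (0 : ℝ)..t, k v s) := by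
    intro t ht
    conv_lhs => rw [← hv]
    simp only [Φ, P, BoundedContinuousFunction.coe_ofNormedAddCommGroup, max_eq_left ht]
  have hvn : ‖v‖ ≤ 2 * M := by
    have h0 : 0 ≤ M := (norm_nonneg _).trans (hM 0 le_rfl)
    have : ‖v‖ ≤ M + 1 / 2 * ‖v‖ := by
      rw [BoundedContinuousFunction.norm_le (by positivity)]
      intro t
      have := hPb v t
      conv_lhs => rw [← hv]
      exact this
    linarith
  refine ⟨fun t => Real.exp (a * t) • v t, ?_, fun t ht => ?_, fun t ht => ?_⟩
  · exact (by fun_prop : Continuous fun s => Real.exp (a * s)).smul v.continuous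
  · simp only
    rw [hvt t ht, smul_smul, hexp, one_smul]
  · rw [norm_smul, Real.norm_of_nonneg (Real.exp_pos _).le, mul_comm]
    gcongr
    exact (v.norm_coe_le_norm t).trans hvn

/-- On `[0, T]` the free term can be frozen after `T` and becomes bounded. Uniqueness makes the
solutions for different `T` compatible, and the diagonal `z t t` glues them. -/
theorem volterra_exists [CompleteSpace H] {C : ℝ → H → H} {b : ℝ} (hb0 : 0 ≤ b)
    (hC : Continuous fun p : ℝ × H => C p.1 p.2)
    (hb : ∀ s x y, ‖C s x - C s y‖ ≤ b * ‖x - y‖) (hC0 : ∀ s, C s 0 = 0) {h : ℝ → H}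
    (hh : ContinuousOn h (Ici 0)) :
    ∃ z : ℝ → H, ContinuousOn z (Ici 0) ∧
      ∀ t, 0 ≤ t → z t = h t - ∫ s in (0 : ℝ)..t, C s (z s) := by
  have key : ∀ T : ℝ, ∃ z : ℝ → H, Continuous z ∧
      (0 ≤ T → ∀ t ∈ Icc 0 T, z t = h t - ∫ s in (0 : ℝ)..t, C s (z s)) := by
    intro T
    rcases lt_or_ge T 0 with hT | hT
    · exact ⟨0, continuous_zero, fun h => absurd h (not_le.2 hT)⟩
    obtain ⟨M, hM⟩ := isCompact_Icc.exists_bound_of_continuousOn (hh.mono Icc_subset_Ici_self :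
      ContinuousOn h (Icc 0 T))
    obtain ⟨z, hz, ez, -⟩ := volterra_exists_of_bounded hb0 hC hb hC0 (h := fun t => h (min t T))
      (hh.comp (by fun_prop) fun t ht => le_min ht hT) (M := M)
      (fun t ht => hM _ ⟨le_min ht hT, min_le_right _ _⟩)
    refine ⟨z, hz, fun _ t ht => ?_⟩
    rw [ez t ht.1, min_eq_left ht.2]
  choose z hz ez using key
  have hcompat : ∀ s t, 0 ≤ s → s ≤ t → z s s = z t s := fun s t hs hst =>
    volterra_unique hC hb (T := s) (hz s).continuousOn (hz t).continuousOn (ez s hs)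
      (fun r hr => ez t (hs.trans hst) r ⟨hr.1, hr.2.trans hst⟩) ⟨hs, le_rfl⟩
  refine ⟨fun t => z t t, fun t ht => ?_, fun t ht => ?_⟩
  · have : (fun s => z s s) =ᶠ[𝓝[Ici 0] t] z (t + 1) := by
      filter_upwards [self_mem_nhdsWithin, mem_nhdsWithin_of_mem_nhds (Iio_mem_nhds (lt_add_one t))]
        with s hs hs'
      exact hcompat s _ hs hs'.le
    exact ((hz (t + 1)).continuousWithinAt).congr_of_eventuallyEq this
      (hcompat t _ ht (lt_add_one t).le)
  · simp only
    rw [ez t ht t ⟨ht, le_rfl⟩]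
    congr 1
    refine intervalIntegral.integral_congr fun s hs => ?_
    rw [uIcc_of_le ht] at hs
    rw [hcompat s t hs.1 hs.2]

end Volterra

/-! ### Duhamel's formula for the limit of the truncations. -/

theorem intervalIntegrable_clm_comp {E G : Type*} [NormedAddCommGroup E] [NormedSpace ℂ E]
    [NormedAddCommGroup G] [NormedSpace ℂ G] (L : E →L[ℂ] G) {m : ℝ → E} {a b : ℝ}
    (hm : IntervalIntegrable m volume a b) :
    IntervalIntegrable (fun s => L (m s)) volume a b := by
  rw [intervalIntegrable_iff] at hm ⊢
  exact L.integrable_comp hm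

namespace TruncatedGenerator

variable {H : Type*} [NormedAddCommGroup H] [InnerProductSpace ℂ H] [CompleteSpace H]
  (𝒢 : TruncatedGenerator H)

/-- `p` is the image of `q` under the (unbounded) operator approximated by `𝒢`. -/
def Rel (q p : H) : Prop := ∀ n, 𝒢.cutoff n p = 𝒢.generator n q

variable {𝒢} {S : ℝ → H →L[ℂ] H}

theorem hasDerivAt_expGen_real (n : ℕ) (t : ℝ) :
    HasDerivAt (fun s => (𝒢.expGen n s).restrictScalars ℝ)
      ((𝒢.expGen n t * 𝒢.generator n).restrictScalars ℝ) t :=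
  ((ContinuousLinearMap.restrictScalarsL ℂ H H ℝ ℝ).hasFDerivAt.comp_hasDerivAt t
    (𝒢.hasDerivAt_expGen n t) :)

theorem continuous_expGen_mul_real (n : ℕ) :
    Continuous fun t => (𝒢.expGen n t * 𝒢.generator n).restrictScalars ℝ :=
  (ContinuousLinearMap.restrictScalarsL ℂ H H ℝ ℝ).continuous.comp
    ((𝒢.continuous_expGen n).mul continuous_const)

theorem hasDerivAt_expGen_neg_real (n : ℕ) (t : ℝ) :
    HasDerivAt (fun s => (𝒢.expGen n (-s)).restrictScalars ℝ)
      (-(𝒢.expGen n (-t) * 𝒢.generator n).restrictScalars ℝ) t := by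
  have h := (𝒢.hasDerivAt_expGen_real n (-t)).scomp t (hasDerivAt_neg t)
  simpa [Function.comp_def] using h

theorem expGen_mul_generator (n : ℕ) (t : ℝ) :
    𝒢.expGen n t * 𝒢.generator n = 𝒢.generator n * 𝒢.expGen n t := by
  let _ := NormedAlgebra.restrictScalars ℚ ℂ (H →L[ℂ] H)
  have h : SemiconjBy (𝒢.generator n) (t • 𝒢.generator n) (t • 𝒢.generator n) :=
    (Commute.refl (𝒢.generator n)).smul_right t
  exact h.exp_right.eq.symm

theorem expGen_apply_neg (n : ℕ) (t : ℝ) (x : H) : 𝒢.expGen n t (𝒢.expGen n (-t) x) = x := by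
  have h := 𝒢.expGen_add n t (-t)
  rw [add_neg_cancel, expGen_zero] at h
  exact (DFunLike.congr_fun h x).symm

/-- After applying `cutoff n` the equation involves only the bounded operator `generator n`, so the
integrating factor `expGen n (-t)` is available. The identity obtained holds for every `n`, and the
cutoffs tend strongly to the identity. -/
theorem duhamel_of_rel (hS : IsContractionGroup S)
    (hSn : ∀ n t x, 𝒢.cutoff n (S t x) = 𝒢.expGen n t (𝒢.cutoff n x))
    {u g : ℝ → H} {u₀ : H} {T : ℝ} (hT : 0 ≤ T) (hu : ContinuousOn u (Icc 0 T))
    (hg : IntervalIntegrable g volume 0 T)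
    (h : ∀ t ∈ Icc 0 T, 𝒢.Rel (∫ s in (0 : ℝ)..t, u s) (u t - u₀ - ∫ s in (0 : ℝ)..t, g s)) :
    u T = S T (u₀ + ∫ s in (0 : ℝ)..T, S (-s) (g s)) := by
  have hu' : IntervalIntegrable u volume 0 T := by
    rw [← uIcc_of_le hT] at hu; exact hu.intervalIntegrable
  have hsub : ∀ t ∈ Icc 0 T, uIcc 0 t ⊆ uIcc 0 T := fun t ht => by
    rw [uIcc_of_le ht.1, uIcc_of_le hT]; exact Icc_subset_Icc_right ht.2
  have hSg : IntervalIntegrable (fun s => S (-s) (g s)) volume 0 T :=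
    hS.intervalIntegrable hg continuous_neg
  have key : ∀ n, 𝒢.cutoff n (S (-T) (u T)) =
      𝒢.cutoff n (u₀ + ∫ s in (0 : ℝ)..T, S (-s) (g s)) := by
    intro n
    let m : ℝ → H := fun s => 𝒢.generator n (u s) + 𝒢.cutoff n (g s)
    have i1 : IntervalIntegrable (fun s => 𝒢.generator n (u s)) volume 0 T :=
      intervalIntegrable_clm_comp (𝒢.generator n) hu'
    have i2 : IntervalIntegrable (fun s => 𝒢.cutoff n (g s)) volume 0 T :=
      intervalIntegrable_clm_comp (𝒢.cutoff n) hg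
    have hm : IntervalIntegrable m volume 0 T := i1.add i2
    have e1 : ∀ t ∈ Icc 0 T, 𝒢.cutoff n u₀ + ∫ s in (0 : ℝ)..t, m s = 𝒢.cutoff n (u t) := by
      intro t ht
      have h1 := h t ht n
      simp only [map_sub] at h1
      rw [← (𝒢.generator n).intervalIntegral_comp_comm (hu'.mono_set (hsub t ht)),
        ← (𝒢.cutoff n).intervalIntegral_comp_comm (hg.mono_set (hsub t ht))] at h1
      simp only [m]
      rw [intervalIntegral.integral_add (i1.mono_set (hsub t ht)) (i2.mono_set (hsub t ht)), ← h1]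
      abel
    have e2 := clm_apply_primitive hT (𝒢.hasDerivAt_expGen_neg_real n)
      ((𝒢.continuous_expGen_mul_real n).comp continuous_neg).neg hm (𝒢.cutoff n u₀)
    rw [e1 T ⟨hT, le_rfl⟩] at e2
    rw [hSn, map_add, ← (𝒢.cutoff n).intervalIntegral_comp_comm hSg]
    refine e2.trans ?_
    congr 1
    · simp [expGen_zero]
    · refine intervalIntegral.integral_congr fun s hs => ?_
      rw [uIcc_of_le hT] at hs
      rw [e1 s hs, hSn]
      have e3 : 𝒢.generator n (𝒢.cutoff n (u s)) = 𝒢.generator n (u s) :=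
        DFunLike.congr_fun (𝒢.generator_mul_cutoff n n le_rfl) (u s)
      simp [m, e3]
  have h1 : S (-T) (u T) = u₀ + ∫ s in (0 : ℝ)..T, S (-s) (g s) :=
    tendsto_nhds_unique (𝒢.tendsto_cutoff _) (by simp only [key]; exact 𝒢.tendsto_cutoff _)
  rw [← h1, hS.apply_neg]

/-- The converse is checked at each truncation level by the product rule with the factor `expGen n
t`; no limit is needed, since `Rel` is a statement about every level. -/
theorem rel_of_duhamel (hS : IsContractionGroup S)
    (hSn : ∀ n t x, 𝒢.cutoff n (S t x) = 𝒢.expGen n t (𝒢.cutoff n x))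
    {u g : ℝ → H} {u₀ : H} {T : ℝ} (hT : 0 ≤ T) (hu : ContinuousOn u (Icc 0 T))
    (hg : IntervalIntegrable g volume 0 T)
    (h : ∀ t ∈ Icc 0 T, u t = S t (u₀ + ∫ s in (0 : ℝ)..t, S (-s) (g s))) :
    𝒢.Rel (∫ s in (0 : ℝ)..T, u s) (u T - u₀ - ∫ s in (0 : ℝ)..T, g s) := by
  intro n
  have hu' : IntervalIntegrable u volume 0 T := by
    rw [← uIcc_of_le hT] at hu; exact hu.intervalIntegrable
  have hSg : IntervalIntegrable (fun s => S (-s) (g s)) volume 0 T :=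
    hS.intervalIntegrable hg continuous_neg
  have hsub : ∀ t ∈ Icc 0 T, uIcc 0 t ⊆ uIcc 0 T := fun t ht => by
    rw [uIcc_of_le ht.1, uIcc_of_le hT]; exact Icc_subset_Icc_right ht.2
  let m : ℝ → H := fun s => 𝒢.cutoff n (S (-s) (g s))
  have hm : IntervalIntegrable m volume 0 T := intervalIntegrable_clm_comp (𝒢.cutoff n) hSg
  have e1 : ∀ t ∈ Icc 0 T, 𝒢.expGen n t (𝒢.cutoff n u₀ + ∫ s in (0 : ℝ)..t, m s) =
      𝒢.cutoff n (u t) := by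
    intro t ht
    rw [h t ht, hSn, map_add (𝒢.cutoff n),
      ← (𝒢.cutoff n).intervalIntegral_comp_comm (hSg.mono_set (hsub t ht))]
  have e2 := clm_apply_primitive hT (𝒢.hasDerivAt_expGen_real n)
    (𝒢.continuous_expGen_mul_real n) hm (𝒢.cutoff n u₀)
  have e3 : ∀ s ∈ uIcc 0 T, ((𝒢.expGen n s * 𝒢.generator n).restrictScalars ℝ)
      (𝒢.cutoff n u₀ + ∫ r in (0 : ℝ)..s, m r) + ((𝒢.expGen n s).restrictScalars ℝ) (m s) =
      𝒢.generator n (u s) + 𝒢.cutoff n (g s) := by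
    intro s hs
    rw [uIcc_of_le hT] at hs
    rw [expGen_mul_generator]
    have e4 : 𝒢.generator n (𝒢.cutoff n (u s)) = 𝒢.generator n (u s) :=
      DFunLike.congr_fun (𝒢.generator_mul_cutoff n n le_rfl) (u s)
    have e5 := e1 s hs
    simp only [ContinuousLinearMap.coe_restrictScalars', mul_apply_eq_comp, m]
    simp only [m] at e5
    rw [e5, e4, hSn, expGen_apply_neg]
  rw [intervalIntegral.integral_congr e3, intervalIntegral.integral_add
    (intervalIntegrable_clm_comp (𝒢.generator n) hu') (intervalIntegrable_clm_comp (𝒢.cutoff n) hg),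
    (𝒢.generator n).intervalIntegral_comp_comm hu',
    (𝒢.cutoff n).intervalIntegral_comp_comm hg] at e2
  have e6 := e1 T ⟨hT, le_rfl⟩
  simp only [ContinuousLinearMap.coe_restrictScalars', expGen_zero,
    one_apply_eq_self] at e2
  rw [e6] at e2
  rw [map_sub, map_sub, e2]
  abel

end TruncatedGenerator

end PML

end

open MeasureTheory Filter Topology Set

noncomputable section

namespace PML

/-! ### Evolutions with a bounded perturbation and a source. -/

namespace TruncatedGenerator

variable {H : Type*} [NormedAddCommGroup H] [InnerProductSpace ℂ H] [CompleteSpace H]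
  (𝒢 : TruncatedGenerator H)

/-- `u` solves `u' = G u - B u + F`, `u(0) = u₀`, in integrated form, where `G` is the operator
approximated by `𝒢`. -/
structure IsEvolution (B : H →L[ℂ] H) (u₀ : H) (F u : ℝ → H) : Prop where
  continuousOn : ContinuousOn u (Ici 0)
  rel : ∀ t, 0 ≤ t → 𝒢.Rel (∫ s in (0 : ℝ)..t, u s)
    (u t - u₀ - ∫ s in (0 : ℝ)..t, (F s - B (u s)))

variable {𝒢} {S : ℝ → H →L[ℂ] H} {B : H →L[ℂ] H}

theorem continuous_conj (hS : IsContractionGroup S) (B : H →L[ℂ] H) :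
    Continuous fun p : ℝ × H => S (-p.1) (B (S p.1 p.2)) := by
  have h1 : Continuous fun p : ℝ × H => B (S p.1 p.2) := B.continuous.comp hS.continuous_uncurry
  exact hS.continuous_uncurry.comp ((continuous_fst.neg).prodMk h1)

theorem norm_conj_sub_le (hS : IsContractionGroup S) (B : H →L[ℂ] H) (s : ℝ) (x y : H) :
    ‖S (-s) (B (S s x)) - S (-s) (B (S s y))‖ ≤ ‖B‖ * ‖x - y‖ := by
  rw [← map_sub, ← map_sub, ← map_sub]
  exact (hS.norm_le _ _).trans ((B.le_opNorm _).trans (by gcongr; exact hS.norm_le _ _))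

theorem continuousOn_duhamel (hS : IsContractionGroup S) {F : ℝ → H}
    (hF : ∀ T, 0 ≤ T → IntervalIntegrable F volume 0 T) (u₀ : H) :
    ContinuousOn (fun t => u₀ + ∫ s in (0 : ℝ)..t, S (-s) (F s)) (Ici 0) := by
  refine continuousOn_const.add fun t ht => ?_
  have h1 : IntervalIntegrable (fun s => S (-s) (F s)) volume 0 (t + 1) :=
    hS.intervalIntegrable (hF _ (add_nonneg ht zero_le_one)) continuous_neg
  have h2 := intervalIntegral.continuousOn_primitive_interval (μ := volume)
    ((intervalIntegrable_iff').1 h1)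
  rw [uIcc_of_le (add_nonneg (mem_Ici.1 ht) zero_le_one)] at h2
  refine (h2 t ⟨ht, (lt_add_one t).le⟩).mono_of_mem_nhdsWithin ?_
  filter_upwards [self_mem_nhdsWithin, mem_nhdsWithin_of_mem_nhds (Iio_mem_nhds (lt_add_one t))]
    with s hs hs'
  exact ⟨hs, hs'.le⟩

/-- This is the interaction picture: Duhamel's formula, with `-B u` counted as a source, read for
the unknown `S (-t) (u t)`. The unbounded operator disappears and the kernel `S (-s) B S s` has norm
at most `‖B‖`. -/
theorem IsEvolution.volterra (hS : IsContractionGroup S)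
    (hSn : ∀ n t x, 𝒢.cutoff n (S t x) = 𝒢.expGen n t (𝒢.cutoff n x))
    {u₀ : H} {F u : ℝ → H} (hF : ∀ T, 0 ≤ T → IntervalIntegrable F volume 0 T)
    (h : 𝒢.IsEvolution B u₀ F u) {t : ℝ} (ht : 0 ≤ t) :
    S (-t) (u t) = (u₀ + ∫ s in (0 : ℝ)..t, S (-s) (F s)) -
      ∫ s in (0 : ℝ)..t, S (-s) (B (S s (S (-s) (u s)))) := by
  have hu : ∀ T, ContinuousOn u (Icc 0 T) := fun T => h.continuousOn.mono Icc_subset_Ici_self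
  have hu' : IntervalIntegrable u volume 0 t := by
    have := hu t
    rw [← uIcc_of_le ht] at this; exact this.intervalIntegrable
  have hBu : IntervalIntegrable (fun s => B (u s)) volume 0 t := intervalIntegrable_clm_comp B hu'
  have h1 := duhamel_of_rel hS hSn ht (hu t) ((hF t ht).sub hBu) (fun s hs => h.rel s hs.1)
  rw [h1, hS.neg_apply]
  simp only [map_sub, hS.apply_neg]
  rw [intervalIntegral.integral_sub (hS.intervalIntegrable (hF t ht) continuous_neg)
    (hS.intervalIntegrable hBu continuous_neg)]
  abel

theorem isEvolution_of_volterra (hS : IsContractionGroup S)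
    (hSn : ∀ n t x, 𝒢.cutoff n (S t x) = 𝒢.expGen n t (𝒢.cutoff n x))
    {u₀ : H} {F z : ℝ → H} (hF : ∀ T, 0 ≤ T → IntervalIntegrable F volume 0 T)
    (hz : ContinuousOn z (Ici 0))
    (h : ∀ t, 0 ≤ t → z t = (u₀ + ∫ s in (0 : ℝ)..t, S (-s) (F s)) -
      ∫ s in (0 : ℝ)..t, S (-s) (B (S s (z s)))) :
    𝒢.IsEvolution B u₀ F fun t => S t (z t) := by
  have hu : ContinuousOn (fun t => S t (z t)) (Ici 0) :=
    hS.continuous_uncurry.comp_continuousOn (continuousOn_id.prodMk hz)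
  refine ⟨hu, fun T hT => ?_⟩
  have hBu : ∀ t, 0 ≤ t → IntervalIntegrable (fun s => B (S s (z s))) volume 0 t := fun t ht => by
    refine ContinuousOn.intervalIntegrable ?_
    rw [uIcc_of_le ht]
    exact B.continuous.comp_continuousOn (hu.mono Icc_subset_Ici_self)
  refine rel_of_duhamel hS hSn hT (hu.mono Icc_subset_Ici_self) ((hF T hT).sub (hBu T hT))
    fun t ht => ?_
  rw [h t ht.1]
  simp only [map_sub (S (-_))]
  rw [intervalIntegral.integral_sub (hS.intervalIntegrable (hF t ht.1) continuous_neg)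
    (hS.intervalIntegrable (hBu t ht.1) continuous_neg)]
  congr 1
  abel

/-- The solution on `[0, T]` only depends on the source on `[0, T]`. -/
theorem IsEvolution.eqOn {u₀ : H} {F F' u u' : ℝ → H}
    (hF : ∀ T, 0 ≤ T → IntervalIntegrable F volume 0 T)
    (hF' : ∀ T, 0 ≤ T → IntervalIntegrable F' volume 0 T)
    (h : 𝒢.IsEvolution B u₀ F u) (h' : 𝒢.IsEvolution B u₀ F' u') {T : ℝ}
    (hFF : ∀ t ∈ Icc 0 T, F t = F' t) : EqOn u u' (Icc 0 T) := by
  obtain ⟨S, hS, hSn⟩ := 𝒢.exists_group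
  have hc : ∀ {v : ℝ → H}, ContinuousOn v (Ici 0) →
      ContinuousOn (fun t => S (-t) (v t)) (Icc 0 T) := fun hv =>
    hS.continuous_uncurry.comp_continuousOn
      (continuousOn_id.neg.prodMk (hv.mono Icc_subset_Ici_self))
  have h1 := volterra_unique (continuous_conj hS B) (norm_conj_sub_le hS B)
    (hc h.continuousOn) (hc h'.continuousOn) (fun t ht => h.volterra hS hSn hF ht.1)
    (fun t ht => by
      rw [h'.volterra hS hSn hF' ht.1]
      congr 2
      refine intervalIntegral.integral_congr fun s hs => ?_
      rw [uIcc_of_le ht.1] at hs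
      simp only [hFF s ⟨hs.1, hs.2.trans ht.2⟩])
  intro t ht
  have h2 := congrArg (S t) (h1 ht)
  simpa only [hS.apply_neg] using h2

theorem exists_isEvolution (B : H →L[ℂ] H) (u₀ : H) {F : ℝ → H}
    (hF : ∀ T, 0 ≤ T → IntervalIntegrable F volume 0 T) :
    ∃ u, 𝒢.IsEvolution B u₀ F u := by
  obtain ⟨S, hS, hSn⟩ := 𝒢.exists_group
  obtain ⟨z, hz, ez⟩ := volterra_exists (norm_nonneg B) (continuous_conj hS B)
    (norm_conj_sub_le hS B) (fun s => by simp) (continuousOn_duhamel hS hF u₀)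
  exact ⟨_, isEvolution_of_volterra hS hSn hF hz ez⟩

/-- A uniform bound on the time integrals of `‖F‖` makes the free term of the Volterra equation
bounded. The resulting exponential growth gives the well-posedness estimate and allows Laplace
transforms. -/
theorem exists_isEvolution_of_bounded (B : H →L[ℂ] H) (u₀ : H) {F : ℝ → H} {M : ℝ}
    (hF : ∀ T, 0 ≤ T → IntervalIntegrable F volume 0 T)
    (hM : ∀ T, 0 ≤ T → ∫ s in (0 : ℝ)..T, ‖F s‖ ≤ M) :
    ∃ u, 𝒢.IsEvolution B u₀ F u ∧
      ∀ t, 0 ≤ t → ‖u t‖ ≤ 2 * (‖u₀‖ + M) * Real.exp ((2 * ‖B‖ + 1) * t) := by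
  obtain ⟨S, hS, hSn⟩ := 𝒢.exists_group
  obtain ⟨z, hz, ez, nz⟩ := volterra_exists_of_bounded (norm_nonneg B) (continuous_conj hS B)
    (norm_conj_sub_le hS B) (fun s => by simp) (continuousOn_duhamel hS hF u₀)
    (M := ‖u₀‖ + M) (fun t ht => by
      refine (norm_add_le _ _).trans ?_
      gcongr
      refine le_trans ?_ (hM t ht)
      exact intervalIntegral.norm_integral_le_of_norm_le ht
        (ae_of_all _ fun s _ => hS.norm_le _ _) (hF t ht).norm)
  exact ⟨_, isEvolution_of_volterra hS hSn hF hz.continuousOn ez,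
    fun t ht => (hS.norm_le _ _).trans (nz t ht)⟩

end TruncatedGenerator

end PML

end

open MeasureTheory Filter Topology Set

noncomputable section

namespace PML

/-! ### Multiplication operators and dominated convergence in `L²`. -/

section MulOp

variable {α : Type*} [MeasurableSpace α] {μ : Measure α} {E E' : Type*}
  [NormedAddCommGroup E] [NormedSpace ℂ E] [NormedAddCommGroup E'] [NormedSpace ℂ E']

/-- Multiplication by an essentially bounded operator valued function, as an operator on `L²`. -/
def mulOp {m : α → E →L[ℂ] E'} (hm : MemLp m ⊤ μ) : Lp E 2 μ →L[ℂ] Lp E' 2 μ :=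
  (ContinuousLinearMap.id ℂ (E →L[ℂ] E')).holderL μ ⊤ 2 2 hm.toLp

theorem coeFn_mulOp {m : α → E →L[ℂ] E'} (hm : MemLp m ⊤ μ) (f : Lp E 2 μ) :
    mulOp hm f =ᵐ[μ] fun x => m x (f x) := by
  filter_upwards [(ContinuousLinearMap.id ℂ (E →L[ℂ] E')).coeFn_holder (r := 2) hm.toLp f,
    hm.coeFn_toLp] with x h1 h2
  exact h1.trans (by rw [h2]; rfl)

theorem norm_mulOp_apply_le {m : α → E →L[ℂ] E'} (hm : MemLp m ⊤ μ) {C : ℝ}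
    (hC : ∀ᵐ x ∂μ, ‖m x‖ ≤ C) (f : Lp E 2 μ) : ‖mulOp hm f‖ ≤ C * ‖f‖ := by
  refine Lp.norm_le_mul_norm_of_ae_le_mul ?_
  filter_upwards [coeFn_mulOp hm f, hC] with x h1 h2
  rw [h1]
  exact ((m x).le_opNorm _).trans (by gcongr)

theorem norm_mulOp_le {m : α → E →L[ℂ] E'} (hm : MemLp m ⊤ μ) {C : ℝ}
    (hC0 : 0 ≤ C) (hC : ∀ᵐ x ∂μ, ‖m x‖ ≤ C) : ‖mulOp hm‖ ≤ C :=
  ContinuousLinearMap.opNorm_le_bound _ hC0 (norm_mulOp_apply_le hm hC)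

end MulOp

section Dominated

variable {α : Type*} [MeasurableSpace α] {μ : Measure α} {E : Type*}
  [NormedAddCommGroup E] [InnerProductSpace ℂ E]

theorem norm_sq_eq_integral_norm_sq (f : Lp E 2 μ) : ‖f‖ ^ 2 = ∫ x, ‖f x‖ ^ 2 ∂μ := by
  have h1 : inner ℂ f f = ((‖f‖ ^ 2 : ℝ) : ℂ) := by
    rw [inner_self_eq_norm_sq_to_K]; norm_cast
  have h2 : inner ℂ f f = ((∫ x, ‖f x‖ ^ 2 ∂μ : ℝ) : ℂ) := by
    rw [L2.inner_def, ← integral_complex_ofReal]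
    refine integral_congr_ae (ae_of_all _ fun x => ?_)
    simp only
    rw [inner_self_eq_norm_sq_to_K]; norm_cast
  exact_mod_cast h1.symm.trans h2

theorem integrable_norm_sq (f : Lp E 2 μ) : Integrable (fun x => ‖f x‖ ^ 2) μ := by
  have h := (Lp.memLp f).integrable_norm_pow (p := 2) (by norm_num)
  simpa using h

/-- Dominated convergence in `L²`. -/
theorem tendsto_zero_of_dominated {F : ℕ → Lp E 2 μ} {G : Lp E 2 μ} {C : ℝ}
    (hb : ∀ n, ∀ᵐ x ∂μ, ‖F n x‖ ≤ C * ‖G x‖)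
    (hlim : ∀ᵐ x ∂μ, Tendsto (fun n => F n x) atTop (𝓝 0)) :
    Tendsto F atTop (𝓝 0) := by
  have h1 : Tendsto (fun n => ∫ x, ‖F n x‖ ^ 2 ∂μ) atTop (𝓝 (∫ _, (0 : ℝ) ∂μ)) := by
    refine tendsto_integral_of_dominated_convergence (fun x => C ^ 2 * ‖G x‖ ^ 2)
      (fun n => (Lp.aestronglyMeasurable (F n)).norm.pow 2)
      ((integrable_norm_sq G).const_mul _) (fun n => ?_) ?_
    · filter_upwards [hb n] with x hx
      rw [Real.norm_of_nonneg (by positivity), ← mul_pow]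
      gcongr
    · filter_upwards [hlim] with x hx
      simpa using hx.norm.pow 2
  simp only [← norm_sq_eq_integral_norm_sq, integral_zero] at h1
  rw [tendsto_zero_iff_norm_tendsto_zero]
  have h2 := h1.sqrt
  simpa using h2

end Dominated

/-! ### First order operators with Hermitian matrices as truncated Fourier multipliers. -/

section Symbol

variable {d : ℕ} {ι : Type} [Fintype ι] [DecidableEq ι]

/-- The action of a matrix on `ℂ^ι`. -/
abbrev matOp (M : Matrix ι ι ℂ) : EuclideanSpace ℂ ι →L[ℂ] EuclideanSpace ℂ ι :=
  Matrix.toEuclideanCLM (n := ι) (𝕜 := ℂ) M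

/-- The symbol of `-∑ₗ Aₗ ∂ₗ`. -/
def symbol (A : Fin d → Matrix ι ι ℂ) (ξ : EuclideanSpace ℝ (Fin d)) :
    EuclideanSpace ℂ ι →L[ℂ] EuclideanSpace ℂ ι :=
  ∑ l, (-(2 * Real.pi * Complex.I) * (ξ l : ℂ)) • matOp (A l)

theorem continuous_symbol (A : Fin d → Matrix ι ι ℂ) : Continuous (symbol A) := by
  unfold symbol
  fun_prop

theorem symbol_mem_skewAdjoint {A : Fin d → Matrix ι ι ℂ} (hA : ∀ l, (A l).IsHermitian)
    (ξ : EuclideanSpace ℝ (Fin d)) : symbol A ξ ∈ skewAdjoint _ := by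
  refine sum_mem fun l _ => ?_
  rw [skewAdjoint.mem_iff, star_smul, matOp, ← map_star, Matrix.star_eq_conjTranspose, (hA l).eq,
    show -((-(2 * Real.pi * Complex.I) * (ξ l : ℂ)) • matOp (A l)) =
      (-(-(2 * Real.pi * Complex.I) * (ξ l : ℂ))) • matOp (A l) from (neg_smul _ _).symm]
  congr 1
  simp

/-- Multiplication operator with `m` cut off to a ball. -/
def truncMul (m : EuclideanSpace ℝ (Fin d) → EuclideanSpace ℂ ι →L[ℂ] EuclideanSpace ℂ ι)
    (n : ℕ) : EuclideanSpace ℝ (Fin d) → EuclideanSpace ℂ ι →L[ℂ] EuclideanSpace ℂ ι :=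
  (Metric.closedBall 0 (n : ℝ)).indicator m

theorem memLp_truncMul
    {m : EuclideanSpace ℝ (Fin d) → EuclideanSpace ℂ ι →L[ℂ] EuclideanSpace ℂ ι}
    (hm : Continuous m) (n : ℕ) : MemLp (truncMul m n) ⊤ volume := by
  obtain ⟨C, hC⟩ := (isCompact_closedBall (0 : EuclideanSpace ℝ (Fin d)) (n : ℝ)
    ).exists_bound_of_continuousOn hm.continuousOn
  refine memLp_top_of_bound (hm.aestronglyMeasurable.indicator measurableSet_closedBall)
    (max C 0) (ae_of_all _ fun x => ?_)
  by_cases hx : x ∈ Metric.closedBall (0 : EuclideanSpace ℝ (Fin d)) (n : ℝ)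
  · rw [truncMul, indicator_of_mem hx]; exact (hC x hx).trans (le_max_left _ _)
  · rw [truncMul, indicator_of_notMem hx, norm_zero]; exact le_max_right _ _

/-- The Fourier transform on `L²(ℝᵈ; ℂ^ι)`. -/
def fourierL2 : L2 d ι ≃ₗᵢ[ℂ] L2 d ι :=
  Lp.fourierTransformₗᵢ (EuclideanSpace ℝ (Fin d)) (EuclideanSpace ℂ ι)

/-- The Fourier multiplier with symbol `m` cut off to a ball. -/
def fourierMul {m : EuclideanSpace ℝ (Fin d) → EuclideanSpace ℂ ι →L[ℂ] EuclideanSpace ℂ ι}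
    (hm : Continuous m) (n : ℕ) : L2 d ι →L[ℂ] L2 d ι :=
  (fourierL2 (d := d) (ι := ι)).symm.toContinuousLinearEquiv.toContinuousLinearMap ∘L
    mulOp (memLp_truncMul hm n) ∘L
    (fourierL2 (d := d) (ι := ι)).toContinuousLinearEquiv.toContinuousLinearMap

variable {m : EuclideanSpace ℝ (Fin d) → EuclideanSpace ℂ ι →L[ℂ] EuclideanSpace ℂ ι}

theorem fourier_fourierMul (hm : Continuous m) (n : ℕ) (f : L2 d ι) :
    fourierL2 (fourierMul hm n f) = mulOp (memLp_truncMul hm n) (fourierL2 f) :=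
  fourierL2.apply_symm_apply (mulOp (memLp_truncMul hm n) (fourierL2 f))

theorem coeFn_fourier_fourierMul (hm : Continuous m) (n : ℕ) (f : L2 d ι) :
    fourierL2 (fourierMul hm n f) =ᵐ[volume] fun ξ => truncMul m n ξ (fourierL2 f ξ) := by
  rw [fourier_fourierMul]
  exact coeFn_mulOp _ _

theorem fourierMul_mul {m₁ m₂ m₃ : EuclideanSpace ℝ (Fin d) →
    EuclideanSpace ℂ ι →L[ℂ] EuclideanSpace ℂ ι} (h₁ : Continuous m₁) (h₂ : Continuous m₂)
    (h₃ : Continuous m₃) {n₁ n₂ n₃ : ℕ}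
    (h : ∀ ξ v, truncMul m₁ n₁ ξ (truncMul m₂ n₂ ξ v) = truncMul m₃ n₃ ξ v) :
    fourierMul h₁ n₁ * fourierMul h₂ n₂ = fourierMul h₃ n₃ := by
  ext1 f
  apply fourierL2.injective
  refine Lp.ext ?_
  filter_upwards [coeFn_fourier_fourierMul h₁ n₁ (fourierMul h₂ n₂ f),
    coeFn_fourier_fourierMul h₂ n₂ f, coeFn_fourier_fourierMul h₃ n₃ f] with ξ e1 e2 e3
  exact e1.trans (by rw [e2, h, e3])

/-- By Plancherel, skew-adjointness reduces to that of the symbol at each frequency. -/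
theorem fourierMul_mem_skewAdjoint (hm : Continuous m)
    (h : ∀ ξ, m ξ ∈ skewAdjoint (EuclideanSpace ℂ ι →L[ℂ] EuclideanSpace ℂ ι)) (n : ℕ) :
    fourierMul hm n ∈ skewAdjoint (L2 d ι →L[ℂ] L2 d ι) := by
  rw [skewAdjoint.mem_iff, ContinuousLinearMap.star_eq_adjoint, eq_comm,
    ContinuousLinearMap.eq_adjoint_iff]
  intro f g
  rw [← fourierL2.inner_map_map, ← fourierL2.inner_map_map f, L2.inner_def, L2.inner_def]
  have e0 : fourierL2 ((-fourierMul hm n) f) = -fourierL2 (fourierMul hm n f) :=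
    map_neg fourierL2 (fourierMul hm n f)
  rw [e0]
  refine integral_congr_ae ?_
  filter_upwards [coeFn_fourier_fourierMul hm n f, coeFn_fourier_fourierMul hm n g,
    Lp.coeFn_neg (fourierL2 (fourierMul hm n f))] with ξ e1 e2 e3
  rw [e2, e3, Pi.neg_apply, e1]
  have hs : ∀ v w, inner ℂ (m ξ v) w = - inner ℂ v (m ξ w) := fun v w => by
    have h1 := skewAdjoint.mem_iff.1 (h ξ)
    rw [ContinuousLinearMap.star_eq_adjoint] at h1
    rw [← ContinuousLinearMap.adjoint_inner_left (m ξ) w v, h1, neg_apply,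
      inner_neg_left, neg_neg]
  by_cases hx : ξ ∈ Metric.closedBall (0 : EuclideanSpace ℝ (Fin d)) (n : ℝ)
  · rw [truncMul, indicator_of_mem hx, inner_neg_left, hs, neg_neg]
  · simp [truncMul, indicator_of_notMem hx]

theorem tendsto_fourierMul_one (x : L2 d ι) :
    Tendsto (fun n => fourierMul (d := d) (ι := ι) (m := fun _ => 1) continuous_const n x) atTop
      (𝓝 x) := by
  have h1 : Tendsto (fun n => fourierL2 (fourierMul (d := d) (ι := ι) (m := fun _ => 1)
      continuous_const n x) - fourierL2 x) atTop (𝓝 0) := by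
    have hco : ∀ n, fourierL2 (fourierMul (d := d) (ι := ι) (m := fun _ => 1) continuous_const n x) - fourierL2 x
        =ᵐ[volume] fun ξ => truncMul (fun _ => 1) n ξ (fourierL2 x ξ) - fourierL2 x ξ := fun n => by
      filter_upwards [Lp.coeFn_sub (fourierL2 (fourierMul (d := d) (ι := ι) (m := fun _ => 1)
        continuous_const n x)) (fourierL2 x),
        coeFn_fourier_fourierMul (d := d) (ι := ι) (m := fun _ => 1) continuous_const n x]
        with ξ e1 e2
      rw [e1, Pi.sub_apply]
      congr 1
    refine tendsto_zero_of_dominated (G := fourierL2 x) (C := 1) (fun n => ?_) ?_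
    · filter_upwards [hco n] with ξ e
      rw [e]
      by_cases hx : ξ ∈ Metric.closedBall (0 : EuclideanSpace ℝ (Fin d)) (n : ℝ)
      · simp [truncMul, indicator_of_mem hx]
      · simp [truncMul, indicator_of_notMem hx]
    · filter_upwards [ae_all_iff.2 hco] with ξ e
      refine tendsto_const_nhds.congr' ?_
      filter_upwards [eventually_ge_atTop ⌈‖ξ‖⌉₊] with n hn
      have hx : ξ ∈ Metric.closedBall (0 : EuclideanSpace ℝ (Fin d)) (n : ℝ) := by
        rw [mem_closedBall_zero_iff]; exact (Nat.le_ceil _).trans (by exact_mod_cast hn)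
      rw [e n]
      simp [truncMul, indicator_of_mem hx]
  rw [tendsto_iff_norm_sub_tendsto_zero]
  have h2 := h1.norm
  simp only [← map_sub, fourierL2.norm_map, norm_zero] at h2
  exact h2

/-- Truncations of the operator `-∑ₗ Aₗ ∂ₗ` on `L²` in Fourier space. -/
def hyperbolicGenerator (A : Fin d → Matrix ι ι ℂ) (hA : ∀ l, (A l).IsHermitian) :
    TruncatedGenerator (L2 d ι) where
  cutoff n := fourierMul (m := fun _ => 1) continuous_const n
  generator n := fourierMul (continuous_symbol A) n
  skew n := fourierMul_mem_skewAdjoint _ (symbol_mem_skewAdjoint hA) n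
  tendsto_cutoff := tendsto_fourierMul_one
  cutoff_mul_generator k n hkn := by
    refine fourierMul_mul _ _ _ fun ξ v => ?_
    by_cases hx : ξ ∈ Metric.closedBall (0 : EuclideanSpace ℝ (Fin d)) (k : ℝ)
    · have hx' := Metric.closedBall_subset_closedBall (Nat.cast_le.2 hkn) hx
      simp [truncMul, indicator_of_mem hx, indicator_of_mem hx']
    · simp [truncMul, indicator_of_notMem hx]
  generator_mul_cutoff k n hkn := by
    refine fourierMul_mul _ _ _ fun ξ v => ?_
    by_cases hx : ξ ∈ Metric.closedBall (0 : EuclideanSpace ℝ (Fin d)) (k : ℝ)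
    · have hx' := Metric.closedBall_subset_closedBall (Nat.cast_le.2 hkn) hx
      simp [truncMul, indicator_of_mem hx, indicator_of_mem hx']
    · simp [truncMul, indicator_of_notMem hx]

/-- Every frequency lies in one of the countably many balls, so the truncated identities together
amount to one identity almost everywhere. -/
theorem rel_iff_fourier {A : Fin d → Matrix ι ι ℂ} (hA : ∀ l, (A l).IsHermitian) {q p : L2 d ι} :
    (hyperbolicGenerator A hA).Rel q p ↔
      ∀ᵐ ξ, fourierL2 p ξ = symbol A ξ (fourierL2 q ξ) := by
  have hn : ∀ n, fourierMul (m := fun _ => 1) continuous_const n p =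
      fourierMul (continuous_symbol A) n q ↔ ∀ᵐ ξ, truncMul (fun _ => 1) n ξ (fourierL2 p ξ) =
        truncMul (symbol A) n ξ (fourierL2 q ξ) := fun n => by
    rw [← fourierL2.injective.eq_iff, Lp.ext_iff]
    have h1 := coeFn_fourier_fourierMul (d := d) (ι := ι) (m := fun _ => 1) continuous_const n p
    have h2 := coeFn_fourier_fourierMul (continuous_symbol A) n q
    constructor
    · intro h
      filter_upwards [h, h1, h2] with ξ e e1 e2
      rw [← e1, ← e2]; exact e
    · intro h
      filter_upwards [h, h1, h2] with ξ e e1 e2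
      exact e1.trans (e.trans e2.symm)
  refine (forall_congr' hn).trans (ae_all_iff.symm.trans ?_)
  refine eventually_congr (ae_of_all _ fun ξ => ⟨fun h => ?_, fun h n => ?_⟩)
  · have hx : ξ ∈ Metric.closedBall (0 : EuclideanSpace ℝ (Fin d)) (⌈‖ξ‖⌉₊ : ℝ) := by
      rw [mem_closedBall_zero_iff]; exact Nat.le_ceil _
    simpa [truncMul, indicator_of_mem hx] using h ⌈‖ξ‖⌉₊
  · by_cases hx : ξ ∈ Metric.closedBall (0 : EuclideanSpace ℝ (Fin d)) (n : ℝ)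
    · simpa [truncMul, indicator_of_mem hx] using h
    · simp [truncMul, indicator_of_notMem hx]

end Symbol

end PML

end

open MeasureTheory Filter Topology Set
open scoped FourierTransform SchwartzMap LineDeriv ContDiff

noncomputable section

namespace PML

/-! ### Distributional and Fourier formulations of the spatial operator. -/

section WeakRel

variable {d : ℕ} {ι : Type} [Fintype ι] [DecidableEq ι]

/-- `p = -∑ₗ Aₗ ∂ₗ q` in the sense of distributions. -/
def WeakRel (A : Fin d → Matrix ι ι ℂ) (q p : L2 d ι) : Prop :=
  ∀ φ : EuclideanSpace ℝ (Fin d) → ℝ, ContDiff ℝ (⊤ : ℕ∞) φ → HasCompactSupport φ →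
    ∫ x, φ x • p x =
      ∫ x, ∑ l, (fderiv ℝ φ x (EuclideanSpace.single l 1)) • matOp (A l) (q x)

theorem integrable_smul_of_memLp {𝕜 : Type*} [RCLike 𝕜] [NormedSpace 𝕜 (EuclideanSpace ℂ ι)]
    {φ : EuclideanSpace ℝ (Fin d) → 𝕜}
    (hφ : MemLp φ 2 volume) (p : L2 d ι) : Integrable (fun x => φ x • p x) :=
  memLp_one_iff_integrable.1 ((Lp.memLp p).smul hφ)

theorem integrable_smul_matOp {𝕜 : Type*} [RCLike 𝕜] [NormedSpace 𝕜 (EuclideanSpace ℂ ι)]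
    {φ : EuclideanSpace ℝ (Fin d) → 𝕜}
    (hφ : MemLp φ 2 volume) (M : Matrix ι ι ℂ) (p : L2 d ι) :
    Integrable (fun x => φ x • matOp M (p x)) :=
  memLp_one_iff_integrable.1 (((matOp M).comp_memLp p).smul hφ)

theorem memLp_of_hasCompactSupport {φ : EuclideanSpace ℝ (Fin d) → ℝ} (hφ : Continuous φ)
    (hc : HasCompactSupport φ) : MemLp φ 2 volume :=
  hφ.memLp_of_hasCompactSupport hc

theorem continuous_partial {φ : EuclideanSpace ℝ (Fin d) → ℝ} (hφ : ContDiff ℝ (⊤ : ℕ∞) φ)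
    (v : EuclideanSpace ℝ (Fin d)) : Continuous fun x => fderiv ℝ φ x v :=
  (hφ.continuous_fderiv (by simp)).clm_apply continuous_const

theorem memLp_partial {φ : EuclideanSpace ℝ (Fin d) → ℝ} (hφ : ContDiff ℝ (⊤ : ℕ∞) φ)
    (hc : HasCompactSupport φ) (v : EuclideanSpace ℝ (Fin d)) :
    MemLp (fun x => fderiv ℝ φ x v) 2 volume :=
  memLp_of_hasCompactSupport (continuous_partial hφ v)
    (hc.fderiv_apply (𝕜 := ℝ) v)

/-- The weak relation may be tested against square integrable functions with square integrable
derivatives. -/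
theorem WeakRel.of_memLp {A : Fin d → Matrix ι ι ℂ} {q p : L2 d ι} (h : WeakRel A q p)
    {φ : EuclideanSpace ℝ (Fin d) → ℝ} (hφ : ContDiff ℝ (⊤ : ℕ∞) φ) (h2 : MemLp φ 2 volume)
    (h2' : ∀ l, MemLp (fun x => fderiv ℝ φ x (EuclideanSpace.single l 1)) 2 volume) :
    ∫ x, φ x • p x =
      ∫ x, ∑ l, (fderiv ℝ φ x (EuclideanSpace.single l 1)) • matOp (A l) (q x) := by
  -- The test function is multiplied by the dilated cutoffs `χ (c n • x)` with `c n → 0`; the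
  -- derivative that falls on the cutoff carries a factor `c n` and disappears in the limit.
  let χ : ContDiffBump (0 : EuclideanSpace ℝ (Fin d)) := ⟨1, 2, one_pos, one_lt_two⟩
  have hχ : ContDiff ℝ (⊤ : ℕ∞) χ := χ.contDiff
  obtain ⟨C, hC⟩ := (hχ.continuous_fderiv (by simp)).bounded_above_of_compact_support
    (χ.hasCompactSupport.fderiv (𝕜 := ℝ))
  let c : ℕ → ℝ := fun n => ((n : ℝ) + 1)⁻¹
  have hc0 : ∀ n, 0 < c n := fun n => by positivity
  have hc1 : ∀ n, c n ≤ 1 := fun n => inv_le_one_of_one_le₀ (by simp)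
  have hclim : Tendsto c atTop (𝓝 0) := by
    simpa [c] using tendsto_one_div_add_atTop_nhds_zero_nat (𝕜 := ℝ)
  let χn : ℕ → EuclideanSpace ℝ (Fin d) → ℝ := fun n x => χ (c n • x)
  have hχn : ∀ n, ContDiff ℝ (⊤ : ℕ∞) (χn n) := fun n => hχ.comp (contDiff_const_smul _)
  have hχd : ∀ n x v, fderiv ℝ (χn n) x v = c n * fderiv ℝ χ (c n • x) v := fun n x v => by
    have h1 : HasFDerivAt (χn n) ((fderiv ℝ χ (c n • x)).comp
        (c n • ContinuousLinearMap.id ℝ (EuclideanSpace ℝ (Fin d)))) x :=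
      ((hχ.differentiable (by simp)) (c n • x)).hasFDerivAt.comp x
        ((hasFDerivAt_id x).const_smul (c n))
    rw [h1.fderiv]
    simp
  have hχc : ∀ n, HasCompactSupport (χn n) := fun n =>
    χ.hasCompactSupport.comp_homeomorph (Homeomorph.smulOfNeZero (c n) (hc0 n).ne')
  have hχ1 : ∀ x, ∀ᶠ n in atTop, χn n x = 1 := fun x => by
    have h1 : Tendsto (fun n => c n • x) atTop (𝓝 (0 : EuclideanSpace ℝ (Fin d))) := by
      simpa using hclim.smul_const x
    filter_upwards [h1.eventually (Metric.closedBall_mem_nhds 0 one_pos)] with n hn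
    exact χ.one_of_mem_closedBall hn
  have hχb : ∀ n x, ‖χn n x‖ ≤ 1 := fun n x => by
    rw [Real.norm_of_nonneg χ.nonneg]; exact χ.le_one
  have hψd : ∀ n x v, fderiv ℝ (fun x => χn n x * φ x) x v =
      χn n x * fderiv ℝ φ x v + (c n * fderiv ℝ χ (c n • x) v) * φ x := fun n x v => by
    rw [fderiv_fun_mul ((hχn n).differentiable (by simp) x) (hφ.differentiable (by simp) x)]
    simp only [add_apply, smul_apply, smul_eq_mul, hχd]
    ring
  have key := fun n => h (fun x => χn n x * φ x) ((hχn n).mul hφ) ((hχc n).mul_right)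
  have lim1 : Tendsto (fun n => ∫ x, (χn n x * φ x) • p x) atTop (𝓝 (∫ x, φ x • p x)) := by
    refine tendsto_integral_of_dominated_convergence (fun x => ‖φ x • p x‖) (fun n => ?_)
      (integrable_smul_of_memLp h2 p).norm (fun n => ae_of_all _ fun x => ?_)
      (ae_of_all _ fun x => ?_)
    · exact (((hχn n).continuous.mul hφ.continuous).aestronglyMeasurable).smul
        (Lp.aestronglyMeasurable p)
    · rw [mul_smul, norm_smul]
      exact mul_le_of_le_one_left (norm_nonneg _) (hχb n x)
    · refine tendsto_const_nhds.congr' ?_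
      filter_upwards [hχ1 x] with n hn
      rw [hn, one_mul]
  have lim2 : Tendsto (fun n => ∫ x, ∑ l, (fderiv ℝ (fun x => χn n x * φ x) x
      (EuclideanSpace.single l 1)) • matOp (A l) (q x)) atTop
      (𝓝 (∫ x, ∑ l, (fderiv ℝ φ x (EuclideanSpace.single l 1)) • matOp (A l) (q x))) := by
    refine tendsto_integral_of_dominated_convergence
      (fun x => ∑ l, (‖(fderiv ℝ φ x (EuclideanSpace.single l 1)) • matOp (A l) (q x)‖ +
        C * ‖φ x • matOp (A l) (q x)‖)) (fun n => ?_)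
      (integrable_finsetSum _ fun l _ => (integrable_smul_matOp (h2' l) _ _).norm.add
        ((integrable_smul_matOp h2 _ _).norm.const_mul C))
      (fun n => ae_of_all _ fun x => ?_)
      (ae_of_all _ fun x => ?_)
    · refine Finset.aestronglyMeasurable_fun_sum _ fun l _ => ?_
      exact (continuous_partial ((hχn n).mul hφ) _).aestronglyMeasurable.smul
        ((matOp (A l)).continuous.comp_aestronglyMeasurable (Lp.aestronglyMeasurable q))
    · refine norm_sum_le_of_le _ fun l _ => ?_
      rw [hψd, add_smul]
      refine (norm_add_le _ _).trans (add_le_add ?_ ?_)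
      · rw [mul_smul, norm_smul]
        exact mul_le_of_le_one_left (norm_nonneg _) (hχb n x)
      · rw [mul_smul, norm_smul, norm_mul]
        have h3 : ‖fderiv ℝ χ (c n • x) (EuclideanSpace.single l 1)‖ ≤ C := by
          refine ((fderiv ℝ χ (c n • x)).le_opNorm _).trans ?_
          simpa using hC (c n • x)
        have h4 : ‖c n‖ ≤ 1 := by rw [Real.norm_of_nonneg (hc0 n).le]; exact hc1 n
        have h5 : ‖c n‖ * ‖fderiv ℝ χ (c n • x) (EuclideanSpace.single l 1)‖ ≤ 1 * C := by gcongr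
        rw [one_mul] at h5
        gcongr
    · refine tendsto_finsetSum _ fun l _ => ?_
      refine Tendsto.smul_const ?_ _
      simp only [hψd]
      have h3 : Tendsto (fun n => χn n x * fderiv ℝ φ x (EuclideanSpace.single l 1)) atTop
          (𝓝 (fderiv ℝ φ x (EuclideanSpace.single l 1))) := by
        refine tendsto_const_nhds.congr' ?_
        filter_upwards [hχ1 x] with n hn
        rw [hn, one_mul]
      have h4 : Tendsto (fun n => c n * fderiv ℝ χ (c n • x) (EuclideanSpace.single l 1)) atTop
          (𝓝 0) := by
        refine hclim.zero_mul_isBoundedUnder_le ?_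
        refine isBoundedUnder_of ⟨C, fun n => ?_⟩
        refine ((fderiv ℝ χ (c n • x)).le_opNorm _).trans ?_
        simpa using hC (c n • x)
      simpa using h3.add (h4.mul_const (φ x))
  exact tendsto_nhds_unique lim1 (by simp only [key]; exact lim2)

/-- The weak relation may be tested against complex valued Schwartz functions. -/
theorem WeakRel.schwartz {A : Fin d → Matrix ι ι ℂ} {q p : L2 d ι} (h : WeakRel A q p)
    (φ : 𝓢(EuclideanSpace ℝ (Fin d), ℂ)) :
    ∫ x, φ x • p x =
      ∫ x, ∑ l, (∂_{(EuclideanSpace.single l (1 : ℝ) : EuclideanSpace ℝ (Fin d))} φ) x •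
        matOp (A l) (q x) := by
  have hφ : ContDiff ℝ (⊤ : ℕ∞) φ := φ.smooth ⊤
  -- Only real test functions are allowed so far; the complex case is recombined from `L = re` and
  -- `L = im`.
  have key : ∀ L : ℂ →L[ℝ] ℝ, ∫ x, L (φ x) • p x = ∫ x, ∑ l,
      (L ((∂_{(EuclideanSpace.single l (1 : ℝ) : EuclideanSpace ℝ (Fin d))} φ) x)) •
        matOp (A l) (q x) := by
    intro L
    have hd : ∀ x v, fderiv ℝ (fun x => L (φ x)) x v = L ((∂_{v} φ) x) := fun x v => by
      have h1 := L.hasFDerivAt.comp x (hφ.differentiable (by simp) x).hasFDerivAt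
      rw [SchwartzMap.lineDerivOp_apply_eq_fderiv]
      rw [show (fun x => L (φ x)) = L ∘ φ from rfl, h1.fderiv]
      rfl
    have h1 := h.of_memLp (φ := fun x => L (φ x)) (L.contDiff.comp hφ)
      (L.comp_memLp' (φ.memLp 2)) (fun l => by
        simp only [hd]
        exact L.comp_memLp' ((∂_{(EuclideanSpace.single l (1 : ℝ))} φ).memLp 2))
    simpa only [hd] using h1
  have hre := key Complex.reCLM
  have him := key Complex.imCLM
  have hsplit : ∀ (z : ℂ) (v : EuclideanSpace ℂ ι), z • v = z.re • v + Complex.I • (z.im • v) := by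
    intro z v
    conv_lhs => rw [← Complex.re_add_im z]
    rw [add_smul, mul_comm, mul_smul]
    simp
  have m1 : ∀ (ψ : 𝓢(EuclideanSpace ℝ (Fin d), ℂ)) (L : ℂ →L[ℝ] ℝ),
    MemLp (fun x => L (ψ x)) 2 volume := fun ψ L => L.comp_memLp' (ψ.memLp 2)
  have e1 : ∫ x, φ x • p x = (∫ x, (φ x).re • p x) + Complex.I • ∫ x, (φ x).im • p x := by
    rw [← integral_smul, ← integral_add]
    · exact integral_congr_ae (ae_of_all _ fun x => hsplit _ _)
    · exact integrable_smul_of_memLp (m1 φ Complex.reCLM) p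
    · exact (integrable_smul_of_memLp (m1 φ Complex.imCLM) p).smul Complex.I
  rw [e1]
  refine (congrArg₂ (fun a b => a + Complex.I • b) hre him).trans ?_
  rw [← integral_smul, ← integral_add]
  · refine integral_congr_ae (ae_of_all _ fun x => ?_)
    simp only [Finset.smul_sum, ← Finset.sum_add_distrib]
    exact Finset.sum_congr rfl fun l _ => (hsplit _ _).symm
  · exact integrable_finsetSum _ fun l _ => integrable_smul_matOp (m1 _ Complex.reCLM) _ q
  · exact (integrable_finsetSum _ fun l _ =>
      integrable_smul_matOp (m1 _ Complex.imCLM) _ q).smul Complex.I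

/-- Duality for the Fourier transform on `L²`: it agrees with the transform of tempered
distributions, which is defined by this transposition. -/
theorem integral_fourier_smul (ψ : 𝓢(EuclideanSpace ℝ (Fin d), ℂ)) (p : L2 d ι) :
    ∫ x, (𝓕 ψ) x • p x = ∫ x, ψ x • fourierL2 p x := by
  have h1 := DFunLike.congr_fun (Lp.fourier_toTemperedDistribution_eq p) ψ
  rw [TemperedDistribution.fourier_apply, Lp.toTemperedDistribution_apply,
    Lp.toTemperedDistribution_apply] at h1
  exact h1

/-- Both sides of the weak relation, tested against a Fourier transform. -/
theorem integral_lineDeriv_fourier (A : Fin d → Matrix ι ι ℂ) (q : L2 d ι)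
    (ψ : 𝓢(EuclideanSpace ℝ (Fin d), ℂ)) :
    ∫ x, ∑ l, (∂_{(EuclideanSpace.single l (1 : ℝ) : EuclideanSpace ℝ (Fin d))} (𝓕 ψ)) x •
        matOp (A l) (q x) = ∫ ξ, ψ ξ • symbol A ξ (fourierL2 q ξ) := by
  have htg : ∀ m : EuclideanSpace ℝ (Fin d),
      Function.HasTemperateGrowth (fun x : EuclideanSpace ℝ (Fin d) => (inner ℝ x m : ℝ)) :=
    fun m => by fun_prop
  have i1 : ∀ (χ : 𝓢(EuclideanSpace ℝ (Fin d), ℂ)) (l : Fin d) (r : L2 d ι),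
      Integrable fun x => χ x • matOp (A l) (r x) := fun χ l r =>
    integrable_smul_matOp (χ.memLp 2) _ r
  have hcomm : ∀ (χ : 𝓢(EuclideanSpace ℝ (Fin d), ℂ)) (l : Fin d) (r : L2 d ι),
      ∫ x, χ x • matOp (A l) (r x) = matOp (A l) (∫ x, χ x • r x) := fun χ l r => by
    rw [← ContinuousLinearMap.integral_comp_comm _ (integrable_smul_of_memLp (χ.memLp 2) r)]
    simp only [map_smul]
  -- The derivative of a Fourier transform is the transform of `ψ` times `-2πi ξₗ`; this produces
  -- the symbol once the transform has been moved to `q`.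
  rw [integral_finsetSum _ fun l _ => i1 _ l q]
  simp only [hcomm, SchwartzMap.lineDerivOp_fourier_eq, integral_fourier_smul]
  simp only [← hcomm]
  rw [← integral_finsetSum _ fun l _ => i1 _ l _]
  refine integral_congr_ae (ae_of_all _ fun ξ => ?_)
  simp only [symbol, sum_apply, Finset.smul_sum]
  refine Finset.sum_congr rfl fun l _ => ?_
  rw [smul_apply, SchwartzMap.smulLeftCLM_apply_apply (htg _)]
  simp only [smul_apply, smul_smul, EuclideanSpace.inner_single_right, one_mul, smul_eq_mul]
  congr 1
  simp
  ring

/-- Test functions of the form `𝓕 ψ` turn the weak relation into the pointwise identity on the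
Fourier side integrated against `ψ`. In one direction `ψ` runs through compactly supported smooth
functions, which determine a locally integrable function; in the other, every Schwartz function is a
Fourier transform. -/
theorem weakRel_iff_rel {A : Fin d → Matrix ι ι ℂ} (hA : ∀ l, (A l).IsHermitian) {q p : L2 d ι} :
    WeakRel A q p ↔ (hyperbolicGenerator A hA).Rel q p := by
  rw [rel_iff_fourier]
  constructor
  · intro h
    refine ae_eq_of_integral_contDiff_smul_eq ?_ ?_ fun g hg hgc => ?_
    · exact (Lp.memLp (fourierL2 p)).locallyIntegrable one_le_two
    -- The symbol is unbounded in general, so the right-hand side need not be in `L²`; local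
    -- integrability suffices.
    · have h1 : LocallyIntegrable (fourierL2 q) volume :=
        (Lp.memLp (fourierL2 q)).locallyIntegrable one_le_two
      rw [locallyIntegrable_iff] at h1 ⊢
      intro k hk
      obtain ⟨C, hC⟩ := hk.exists_bound_of_continuousOn (continuous_symbol A).continuousOn
      refine Integrable.mono' ((h1 k hk).norm.const_mul C) ?_ ?_
      · exact (ContinuousLinearMap.apply ℂ (EuclideanSpace ℂ ι)).flip.aestronglyMeasurable_comp₂
          (continuous_symbol A).aestronglyMeasurable
          (Lp.aestronglyMeasurable (fourierL2 q)).restrict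
      · filter_upwards [ae_restrict_mem hk.measurableSet] with ξ hξ
        exact ((symbol A ξ).le_opNorm _).trans (by gcongr; exact hC ξ hξ)
    · have hg₁ : HasCompactSupport (Complex.ofRealCLM ∘ g) := hgc.comp_left rfl
      have hg₂ : ContDiff ℝ ∞ (Complex.ofRealCLM ∘ g) := Complex.ofRealCLM.contDiff.comp hg
      have h1 := h.schwartz (𝓕 (hg₁.toSchwartzMap hg₂))
      rw [integral_fourier_smul, integral_lineDeriv_fourier] at h1
      simpa using h1
  · intro h φ hφ hc
    have hg₁ : HasCompactSupport (Complex.ofRealCLM ∘ φ) := hc.comp_left rfl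
    have hg₂ : ContDiff ℝ ∞ (Complex.ofRealCLM ∘ φ) := Complex.ofRealCLM.contDiff.comp hφ
    set Φ := hg₁.toSchwartzMap hg₂ with hΦ
    have h1 : ∫ x, Φ x • p x = ∫ x, ∑ l,
        (∂_{(EuclideanSpace.single l (1 : ℝ) : EuclideanSpace ℝ (Fin d))} Φ) x •
          matOp (A l) (q x) := by
      have e : Φ = 𝓕 (𝓕⁻ Φ) := (FourierTransform.fourier_fourierInv_eq Φ).symm
      rw [e, integral_fourier_smul, integral_lineDeriv_fourier]
      refine integral_congr_ae ?_
      filter_upwards [h] with ξ hξ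
      rw [hξ]
    have hd : ∀ x v, (∂_{v} Φ) x = ((fderiv ℝ φ x v : ℝ) : ℂ) := fun x v => by
      rw [SchwartzMap.lineDerivOp_apply_eq_fderiv]
      have h2 := Complex.ofRealCLM.hasFDerivAt.comp x (hφ.differentiable (by simp) x).hasFDerivAt
      have h3 : fderiv ℝ Φ x = Complex.ofRealCLM ∘L fderiv ℝ φ x := h2.fderiv
      rw [h3]; rfl
    simp only [hd] at h1
    simpa [hΦ] using h1

end WeakRel

end PML

end

open MeasureTheory Filter Topology Set

noncomputable section

namespace PML

/-! ### Weak solutions as evolutions, and strong well-posedness. -/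

section Pairing

variable {d : ℕ} {ι : Type} [Fintype ι]

/-- The pairing with a real valued square integrable function. -/
def pairing {φ : EuclideanSpace ℝ (Fin d) → ℝ} (hφ : MemLp φ 2 volume) :
    L2 d ι →L[ℝ] EuclideanSpace ℂ ι :=
  (ContinuousLinearMap.lsmul ℝ ℝ).lpPairing volume 2 2 hφ.toLp

theorem pairing_apply {φ : EuclideanSpace ℝ (Fin d) → ℝ} (hφ : MemLp φ 2 volume) (p : L2 d ι) :
    pairing hφ p = ∫ x, φ x • p x := by
  rw [pairing, ContinuousLinearMap.lpPairing_eq_integral]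
  refine integral_congr_ae ?_
  filter_upwards [hφ.coeFn_toLp] with x hx
  rw [hx]; rfl

end Pairing

section Solutions

variable {d : ℕ} {ι : Type} [Fintype ι] [DecidableEq ι] {A : Fin d → Matrix ι ι ℂ}
  {B : EuclideanSpace ℝ (Fin d) → Matrix ι ι ℂ}

/-- The pairing of `-∑ₗ Aₗ ∂ₗ q` with a test function. -/
def gradPairing (A : Fin d → Matrix ι ι ℂ) {φ : EuclideanSpace ℝ (Fin d) → ℝ}
    (hφ : ContDiff ℝ (⊤ : ℕ∞) φ) (hc : HasCompactSupport φ) :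
    L2 d ι →L[ℝ] EuclideanSpace ℂ ι :=
  ∑ l, ((matOp (A l)).restrictScalars ℝ) ∘L
    pairing (memLp_partial hφ hc (EuclideanSpace.single l 1))

theorem gradPairing_apply {φ : EuclideanSpace ℝ (Fin d) → ℝ}
    (hφ : ContDiff ℝ (⊤ : ℕ∞) φ) (hc : HasCompactSupport φ) (q : L2 d ι) :
    gradPairing A hφ hc q =
      ∫ x, ∑ l, (fderiv ℝ φ x (EuclideanSpace.single l 1)) • matOp (A l) (q x) := by
  rw [integral_finsetSum _ fun l _ => integrable_smul_matOp (memLp_partial hφ hc _) _ q]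
  simp only [gradPairing, sum_apply, ContinuousLinearMap.comp_apply, pairing_apply,
    ContinuousLinearMap.coe_restrictScalars']
  refine Finset.sum_congr rfl fun l _ => ?_
  rw [← ContinuousLinearMap.integral_comp_comm _
    (integrable_smul_of_memLp (memLp_partial hφ hc _) q)]
  simp only [ContinuousLinearMap.map_smul_of_tower]

/-- Written with continuous linear maps, the tested relation can be interchanged with Bochner
integrals in time. -/
theorem weakRel_iff_pairing {q p : L2 d ι} : WeakRel A q p ↔
    ∀ φ : EuclideanSpace ℝ (Fin d) → ℝ, ∀ (hφ : ContDiff ℝ (⊤ : ℕ∞) φ)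
      (hc : HasCompactSupport φ),
      pairing (memLp_of_hasCompactSupport hφ.continuous hc) p = gradPairing A hφ hc q := by
  simp only [pairing_apply, gradPairing_apply]
  rfl

/-- Each space integral is a continuous linear map applied to `u s` or to `F s - B u s`, so it can
be pulled out of the time integral. What remains is the weak relation between `∫ u` and `u t - u₀ -
∫ (F - B u)`. -/
theorem isSolution_iff_isEvolution (hA : ∀ l, (A l).IsHermitian)
    (hB : MemLp (fun x => matOp (B x)) ⊤ volume) {u₀ : L2 d ι} {F u : ℝ → L2 d ι}
    (hF : ∀ T, 0 ≤ T → IntervalIntegrable F volume 0 T) :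
    IsSolution A B u₀ F u ↔ (hyperbolicGenerator A hA).IsEvolution (mulOp hB) u₀ F u := by
  have hinner : ∀ φ : EuclideanSpace ℝ (Fin d) → ℝ, ∀ (hφ : ContDiff ℝ (⊤ : ℕ∞) φ)
      (hc : HasCompactSupport φ) (s : ℝ),
      ∫ x, ((∑ l, (fderiv ℝ φ x (EuclideanSpace.single l 1)) • matOp (A l) ((u s) x))
              - φ x • matOp (B x) ((u s) x) + φ x • (F s) x) =
        gradPairing A hφ hc (u s) +
          pairing (memLp_of_hasCompactSupport hφ.continuous hc) (F s - mulOp hB (u s)) := by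
    intro φ hφ hc s
    have hm := memLp_of_hasCompactSupport hφ.continuous hc
    rw [map_sub, pairing_apply, pairing_apply, gradPairing_apply]
    have i1 : Integrable (fun x => ∑ l, (fderiv ℝ φ x (EuclideanSpace.single l 1)) •
        matOp (A l) ((u s) x)) :=
      integrable_finsetSum _ fun l _ => integrable_smul_matOp (memLp_partial hφ hc _) _ _
    have e2 : (fun x => φ x • mulOp hB (u s) x) =ᵐ[volume]
        fun x => φ x • matOp (B x) ((u s) x) := by
      filter_upwards [coeFn_mulOp hB (u s)] with x hx
      rw [hx]
    have i2 : Integrable (fun x => φ x • matOp (B x) ((u s) x)) :=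
      (integrable_smul_of_memLp hm (mulOp hB (u s))).congr e2
    have i3 : Integrable (fun x => (∑ l, (fderiv ℝ φ x (EuclideanSpace.single l 1)) •
        matOp (A l) ((u s) x)) - φ x • matOp (B x) ((u s) x)) := i1.sub i2
    rw [integral_add i3 (integrable_smul_of_memLp hm _), integral_sub i1 i2,
      ← integral_congr_ae e2]
    abel
  have key : ContinuousOn u (Ici 0) → ∀ t, 0 ≤ t → ∀ φ : EuclideanSpace ℝ (Fin d) → ℝ,
      ∀ (hφ : ContDiff ℝ (⊤ : ℕ∞) φ) (hc : HasCompactSupport φ),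
      ((∫ x, φ x • (u t) x = (∫ x, φ x • u₀ x) + ∫ s in (0 : ℝ)..t, ∫ x,
            ((∑ l, (fderiv ℝ φ x (EuclideanSpace.single l 1)) • matOp (A l) ((u s) x))
              - φ x • matOp (B x) ((u s) x) + φ x • (F s) x)) ↔
        pairing (memLp_of_hasCompactSupport hφ.continuous hc)
          (u t - u₀ - ∫ s in (0 : ℝ)..t, (F s - mulOp hB (u s))) =
        gradPairing A hφ hc (∫ s in (0 : ℝ)..t, u s)) := by
    intro hu t ht φ hφ hc
    have hu' : IntervalIntegrable u volume 0 t := by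
      refine ContinuousOn.intervalIntegrable ?_
      rw [uIcc_of_le ht]
      exact hu.mono Icc_subset_Ici_self
    have hg : IntervalIntegrable (fun s => F s - mulOp hB (u s)) volume 0 t :=
      (hF t ht).sub (intervalIntegrable_clm_comp _ hu')
    have hcomp : ∀ (L : L2 d ι →L[ℝ] EuclideanSpace ℂ ι) {m : ℝ → L2 d ι},
        IntervalIntegrable m volume 0 t → IntervalIntegrable (fun s => L (m s)) volume 0 t := by
      intro L m hm
      rw [intervalIntegrable_iff] at hm ⊢
      exact L.integrable_comp hm
    simp only [hinner φ hφ hc]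
    rw [intervalIntegral.integral_add (hcomp _ hu') (hcomp _ hg),
      ContinuousLinearMap.intervalIntegral_comp_comm _ hu',
      ContinuousLinearMap.intervalIntegral_comp_comm _ hg, map_sub, map_sub,
      ← pairing_apply (memLp_of_hasCompactSupport hφ.continuous hc),
      ← pairing_apply (memLp_of_hasCompactSupport hφ.continuous hc), sub_sub, sub_eq_iff_eq_add]
    constructor <;> intro h <;> rw [h] <;> abel
  constructor
  · intro h
    refine ⟨h.continuousOn, fun t ht => ?_⟩
    rw [← weakRel_iff_rel, weakRel_iff_pairing]
    exact fun φ hφ hc => (key h.continuousOn t ht φ hφ hc).1 (h.equation φ hφ hc t ht)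
  · intro h
    refine ⟨h.continuousOn, ?_, fun φ hφ hc t ht => ?_⟩
    -- An evolution carries its initial condition in the relation at time `0`: the cutoffs of `u 0 -
    -- u₀` all vanish.
    · have h0 := h.rel 0 le_rfl
      simp only [intervalIntegral.integral_same, sub_zero] at h0
      have h1 : ∀ n, (hyperbolicGenerator A hA).cutoff n (u 0 - u₀) = 0 := fun n => by
        rw [h0 n, map_zero]
      have h2 := (hyperbolicGenerator A hA).tendsto_cutoff (u 0 - u₀)
      simp only [h1] at h2
      exact sub_eq_zero.1 (tendsto_nhds_unique h2 tendsto_const_nhds)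
    · refine (key h.continuousOn t ht φ hφ hc).2 ?_
      have h1 := h.rel t ht
      rw [← weakRel_iff_rel, weakRel_iff_pairing] at h1
      exact h1 φ hφ hc

theorem exists_isUniqueSolution (hA : ∀ l, (A l).IsHermitian)
    (hB : MemLp (fun x => matOp (B x)) ⊤ volume) (u₀ : L2 d ι) {F : ℝ → L2 d ι}
    (hF : ∀ T, 0 ≤ T → IntervalIntegrable F volume 0 T) :
    ∃ u, IsUniqueSolution A B u₀ F u := by
  obtain ⟨u, hu⟩ := (hyperbolicGenerator A hA).exists_isEvolution (mulOp hB) u₀ hF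
  refine ⟨u, (isSolution_iff_isEvolution hA hB hF).2 hu, fun u' hu' t ht => ?_⟩
  exact ((isSolution_iff_isEvolution hA hB hF).1 hu').eqOn hF hF hu (fun _ _ => rfl)
    (right_mem_Icc.2 ht)

theorem stronglyWellPosed (hA : ∀ l, (A l).IsHermitian)
    (hB : MemLp (fun x => matOp (B x)) ⊤ volume) : StronglyWellPosed A B := by
  refine ⟨2, two_pos, 2 * ‖mulOp hB‖ + 1, fun u₀ => ?_⟩
  have hF : ∀ T, 0 ≤ T → IntervalIntegrable (0 : ℝ → L2 d ι) volume 0 T :=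
    fun T _ => intervalIntegrable_const (c := (0 : L2 d ι))
  obtain ⟨u, hu, hb⟩ := (hyperbolicGenerator A hA).exists_isEvolution_of_bounded (mulOp hB) u₀
    hF (M := 0) (fun T _ => by simp)
  refine ⟨u, ⟨(isSolution_iff_isEvolution hA hB hF).2 hu, fun u' hu' t ht => ?_⟩, fun t ht => ?_⟩
  · exact ((isSolution_iff_isEvolution hA hB hF).1 hu').eqOn hF hF hu (fun _ _ => rfl)
      (right_mem_Icc.2 ht)
  · refine (hb t ht).trans_eq ?_
    ring

end Solutions

/-! ### The resolvent estimate. -/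

namespace TruncatedGenerator

variable {H : Type*} [NormedAddCommGroup H] [InnerProductSpace ℂ H] [CompleteSpace H]
  {𝒢 : TruncatedGenerator H}

theorem Rel.sub {q p q' p' : H} (h : 𝒢.Rel q p) (h' : 𝒢.Rel q' p') :
    𝒢.Rel (q - q') (p - p') := fun n => by
  rw [map_sub, map_sub, h n, h' n]

/-- At each level `cutoff n p` is the image of `q` under a skew-adjoint operator, so its inner
product with `q` is imaginary; this passes to the limit. -/
theorem Rel.re_inner_eq_zero {q p : H} (h : 𝒢.Rel q p) : (inner ℂ q p).re = 0 := by
  have h1 : ∀ n, (inner ℂ q (𝒢.cutoff n p)).re = 0 := fun n => by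
    rw [h n]
    have h2 := skewAdjoint.mem_iff.1 (𝒢.skew n)
    rw [ContinuousLinearMap.star_eq_adjoint] at h2
    have h3 : inner ℂ q (𝒢.generator n q) = - inner ℂ (𝒢.generator n q) q := by
      rw [← ContinuousLinearMap.adjoint_inner_left, h2, neg_apply, inner_neg_left]
    have h4 := congrArg Complex.re h3
    have h5 : (inner ℂ (𝒢.generator n q) q).re = (inner ℂ q (𝒢.generator n q)).re := by
      rw [← inner_conj_symm, Complex.conj_re]
    rw [Complex.neg_re, h5] at h4
    linarith
  have h2 : Tendsto (fun n => (inner ℂ q (𝒢.cutoff n p)).re) atTop (𝓝 (inner ℂ q p).re) :=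
    (Complex.continuous_re.tendsto _).comp
      ((continuous_const.inner continuous_id).tendsto p |>.comp (𝒢.tendsto_cutoff p))
  simp only [h1] at h2
  exact (tendsto_nhds_unique h2 tendsto_const_nhds)

/-- The resolvent estimate. -/
theorem Rel.norm_le {B : H →L[ℂ] H} {a : ℝ} {u f : H}
    (h : 𝒢.Rel u (a • u + B u - f)) : (a - ‖B‖) * ‖u‖ ≤ ‖f‖ := by
  have h1 := h.re_inner_eq_zero
  rcases eq_or_ne u 0 with rfl | hu
  · simp
  have hu' : 0 < ‖u‖ := norm_pos_iff.2 hu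
  have h2 : (inner ℂ u (a • u)).re = a * ‖u‖ ^ 2 := by
    rw [show a • u = (a : ℂ) • u from rfl, inner_smul_right, inner_self_eq_norm_sq_to_K]
    change ((a : ℂ) * (‖u‖ : ℂ) ^ 2).re = _
    rw [← Complex.ofReal_pow, ← Complex.ofReal_mul, Complex.ofReal_re]
  rw [inner_sub_right, inner_add_right, Complex.sub_re, Complex.add_re, h2] at h1
  have h3 : -(‖u‖ * (‖B‖ * ‖u‖)) ≤ (inner ℂ u (B u)).re := by
    have := (abs_le.1 ((Complex.abs_re_le_norm (inner ℂ u (B u))).trans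
      (norm_inner_le_norm u (B u)))).1
    have h4 : ‖u‖ * ‖B u‖ ≤ ‖u‖ * (‖B‖ * ‖u‖) := by gcongr; exact B.le_opNorm u
    linarith
  have h5 : (inner ℂ u f).re ≤ ‖u‖ * ‖f‖ :=
    (Complex.re_le_norm _).trans (norm_inner_le_norm u f)
  have h6 : ‖u‖ * ((a - ‖B‖) * ‖u‖) ≤ ‖u‖ * ‖f‖ := by nlinarith
  exact le_of_mul_le_mul_left h6 hu'

end TruncatedGenerator

end PML

end

open MeasureTheory Filter Topology Set

noncomputable section

namespace PML

/-! ### The Laplace transform: uniqueness, and its action on evolutions. -/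

section Laplace

/-- The Laplace transform of a function with values in a Banach space. -/
def laplace {E : Type*} [NormedAddCommGroup E] [NormedSpace ℝ E] (u : ℝ → E) (a : ℝ) : E :=
  ∫ t in Ioi (0 : ℝ), Real.exp (-(a * t)) • u t

variable {E : Type*} [NormedAddCommGroup E] [NormedSpace ℝ E]

theorem integrableOn_exp_smul {u : ℝ → E} (hu : ContinuousOn u (Ici 0)) {K b a : ℝ}
    (hb : ∀ t, 0 ≤ t → ‖u t‖ ≤ K * Real.exp (b * t)) (hab : b < a) :
    IntegrableOn (fun t => Real.exp (-(a * t)) • u t) (Ioi 0) := by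
  have h1 : IntegrableOn (fun t => K * Real.exp (-(a - b) * t)) (Ioi 0) :=
    (exp_neg_integrableOn_Ioi 0 (sub_pos.2 hab)).const_mul K
  refine Integrable.mono' h1 ?_ ?_
  · exact ((by fun_prop : Continuous fun t => Real.exp (-(a * t))).continuousOn.smul
      (hu.mono Ioi_subset_Ici_self)).aestronglyMeasurable measurableSet_Ioi
  · filter_upwards [ae_restrict_mem measurableSet_Ioi] with t ht
    rw [norm_smul, Real.norm_of_nonneg (Real.exp_pos _).le]
    calc _ ≤ Real.exp (-(a * t)) * (K * Real.exp (b * t)) := by gcongr; exact hb t (le_of_lt ht)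
      _ = K * (Real.exp (-(a * t)) * Real.exp (b * t)) := by ring
      _ = _ := by rw [← Real.exp_add]; ring_nf

theorem integrableOn_exp_smul_of_integrable {F : ℝ → E} (hF : IntegrableOn F (Ioi 0)) {a : ℝ}
    (ha : 0 ≤ a) : IntegrableOn (fun t => Real.exp (-(a * t)) • F t) (Ioi 0) := by
  refine Integrable.mono' hF.norm ?_ ?_
  · exact (by fun_prop : Continuous fun t => Real.exp (-(a * t))).aestronglyMeasurable.smul
      hF.aestronglyMeasurable
  · filter_upwards [ae_restrict_mem measurableSet_Ioi] with t ht
    rw [norm_smul, Real.norm_of_nonneg (Real.exp_pos _).le]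
    refine mul_le_of_le_one_left (norm_nonneg _) (Real.exp_le_one_iff.2 ?_)
    have := mul_nonneg ha (le_of_lt (mem_Ioi.1 ht))
    linarith

theorem integral_polynomial_smul {G : ℝ → E} (hG : IntegrableOn G (Ioi 0))
    (h0 : ∀ n : ℕ, ∫ t in Ioi (0 : ℝ), (Real.exp (-t)) ^ n • G t = 0) (p : Polynomial ℝ) :
    IntegrableOn (fun t => p.eval (Real.exp (-t)) • G t) (Ioi 0) ∧
      ∫ t in Ioi (0 : ℝ), p.eval (Real.exp (-t)) • G t = 0 := by
  induction p using Polynomial.induction_on' with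
  | add p q hp hq =>
    simp only [Polynomial.eval_add, add_smul]
    exact ⟨hp.1.add hq.1, by rw [integral_add hp.1 hq.1, hp.2, hq.2, add_zero]⟩
  | monomial n c =>
    simp only [Polynomial.eval_monomial, mul_smul]
    refine ⟨Integrable.smul c ?_, by rw [integral_smul, h0, smul_zero]⟩
    refine Integrable.mono' hG.norm ?_ ?_
    · exact (by fun_prop : Continuous fun t => Real.exp (-t) ^ n).aestronglyMeasurable.smul
        hG.aestronglyMeasurable
    · filter_upwards [ae_restrict_mem measurableSet_Ioi] with t ht
      rw [norm_smul, Real.norm_of_nonneg (by positivity)]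
      refine mul_le_of_le_one_left (norm_nonneg _) (pow_le_one₀ (Real.exp_pos _).le ?_)
      exact Real.exp_le_one_iff.2 (neg_nonpos.2 (le_of_lt ht))

/-- In the variable `x = exp (-t)` the hypothesis says that all moments vanish; Weierstrass
approximation on `[0, 1]` extends this from polynomials to continuous functions. -/
theorem integral_comp_exp_smul_eq_zero {G : ℝ → E} (hG : IntegrableOn G (Ioi 0))
    (h0 : ∀ n : ℕ, ∫ t in Ioi (0 : ℝ), (Real.exp (-t)) ^ n • G t = 0) {g : ℝ → ℝ}
    (hg : ContinuousOn g (Icc 0 1)) : ∫ t in Ioi (0 : ℝ), g (Real.exp (-t)) • G t = 0 := by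
  have hmem : ∀ t ∈ Ioi (0 : ℝ), Real.exp (-t) ∈ Icc (0 : ℝ) 1 := fun t ht =>
    ⟨(Real.exp_pos _).le, Real.exp_le_one_iff.2 (neg_nonpos.2 (le_of_lt ht))⟩
  obtain ⟨C, hC⟩ := isCompact_Icc.exists_bound_of_continuousOn hg
  have hint : IntegrableOn (fun t => g (Real.exp (-t)) • G t) (Ioi 0) := by
    refine Integrable.mono' (hG.norm.const_mul C) ?_ ?_
    · exact ((hg.comp (by fun_prop : Continuous fun t => Real.exp (-t)).continuousOn
        hmem).aestronglyMeasurable measurableSet_Ioi).smul hG.aestronglyMeasurable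
    · filter_upwards [ae_restrict_mem measurableSet_Ioi] with t ht
      rw [norm_smul]
      gcongr
      exact hC _ (hmem t ht)
  rw [← norm_le_zero_iff]
  refine le_of_forall_pos_le_add fun ε hε => ?_
  set N := ∫ t in Ioi (0 : ℝ), ‖G t‖ with hN
  have hN0 : 0 ≤ N := integral_nonneg fun _ => norm_nonneg _
  obtain ⟨p, hp⟩ := exists_polynomial_near_of_continuousOn 0 1 g hg (ε / (N + 1)) (by positivity)
  obtain ⟨ip, ep⟩ := integral_polynomial_smul hG h0 p
  have e1 : ∫ t in Ioi (0 : ℝ), g (Real.exp (-t)) • G t =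
      ∫ t in Ioi (0 : ℝ), (g (Real.exp (-t)) - p.eval (Real.exp (-t))) • G t := by
    simp only [sub_smul]
    rw [integral_sub hint ip, ep, sub_zero]
  rw [e1, zero_add]
  calc _ ≤ ∫ t in Ioi (0 : ℝ), ε / (N + 1) * ‖G t‖ := by
        refine norm_integral_le_of_norm_le (hG.norm.const_mul _) ?_
        filter_upwards [ae_restrict_mem measurableSet_Ioi] with t ht
        rw [norm_smul]
        gcongr
        rw [Real.norm_eq_abs, abs_sub_comm]
        exact (hp _ (hmem t ht)).le
    _ = ε / (N + 1) * N := integral_const_mul _ _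
    _ ≤ ε := by
        rw [div_mul_eq_mul_div, div_le_iff₀ (by positivity)]
        nlinarith

/-- Lerch's theorem: a continuous function of exponential growth is determined by its Laplace
transform near infinity. -/
theorem eqOn_zero_of_laplace_eq_zero [CompleteSpace E] {D : ℝ → E} (hD : ContinuousOn D (Ici 0))
    {K b a₀ : ℝ} (hb : ∀ t, 0 ≤ t → ‖D t‖ ≤ K * Real.exp (b * t))
    (h : ∀ a, a₀ ≤ a → laplace D a = 0) : EqOn D 0 (Ici 0) := by
  -- Beyond `b` the weighted function is integrable, and beyond `a₀` its moments in `exp (-t)` are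
  -- Laplace values at `c + n`, hence zero.
  set c : ℝ := max a₀ (b + 1) with hc
  have hbc : b < c := (lt_add_one b).trans_le (le_max_right _ _)
  let G : ℝ → E := fun t => Real.exp (-(c * t)) • D t
  have hG : IntegrableOn G (Ioi 0) := integrableOn_exp_smul hD hb hbc
  have h0 : ∀ n : ℕ, ∫ t in Ioi (0 : ℝ), (Real.exp (-t)) ^ n • G t = 0 := fun n => by
    have h1 := h (c + n) ((le_max_left _ _).trans (le_add_of_nonneg_right n.cast_nonneg))
    rw [laplace] at h1
    rw [← h1]
    congr 1
    ext t
    rw [smul_smul, ← Real.exp_nat_mul, ← Real.exp_add]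
    ring_nf
  have key : ∀ ψ : ℝ → ℝ, ContDiff ℝ (⊤ : ℕ∞) ψ → HasCompactSupport ψ → tsupport ψ ⊆ Ioi 0 →
      ∫ t, ψ t • G t = 0 := by
    intro ψ hψ hψc hψs
    have hψ0 : ∀ t ≤ 0, ψ t = 0 := fun t ht => by
      by_contra hne
      exact not_lt.2 ht (hψs (subset_tsupport _ hne))
    obtain ⟨R, hR⟩ := hψc.isCompact.isBounded.subset_closedBall 0
    have hψR : ∀ t, R < t → ψ t = 0 := fun t ht => by
      by_contra hne
      have := hR (subset_tsupport _ hne)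
      rw [mem_closedBall_zero_iff] at this
      exact not_lt.2 ((le_abs_self t).trans this) ht
    -- Small `x` correspond to large `t`, where `ψ` vanishes; at `x = 0` the convention `log 0 = 0`
    -- gives `ψ 0 = 0`, the right value.
    have hg : ContinuousOn (fun x => ψ (-Real.log x)) (Icc 0 1) := by
      intro x hx
      rcases hx.1.eq_or_lt with rfl | hx0
      · have : (fun x => ψ (-Real.log x)) =ᶠ[𝓝[Icc 0 1] 0] fun _ => 0 := by
          filter_upwards [self_mem_nhdsWithin,
            mem_nhdsWithin_of_mem_nhds (Iio_mem_nhds (Real.exp_pos (-R)))] with y hy hy'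
          rcases hy.1.eq_or_lt with rfl | hy0
          · simp [hψ0]
          · refine hψR _ ?_
            have := (Real.log_lt_iff_lt_exp hy0).2 hy'
            linarith
        exact (continuousWithinAt_const.congr_of_eventuallyEq this (by simp [hψ0]))
      · exact (hψ.continuous.continuousAt.comp
          (Real.continuousAt_log hx0.ne').neg).continuousWithinAt
    have h2 := integral_comp_exp_smul_eq_zero hG h0 hg
    simp only [Real.log_exp, neg_neg] at h2
    rw [← h2]
    symm
    refine setIntegral_eq_integral_of_forall_compl_eq_zero fun t ht => ?_
    rw [hψ0 t (not_lt.1 ht), zero_smul]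
  have h3 : ∀ᵐ t, t ∈ Ioi (0 : ℝ) → G t = 0 :=
    isOpen_Ioi.ae_eq_zero_of_integral_contDiff_smul_eq_zero hG.locallyIntegrableOn key
  have h4 : D =ᵐ[volume.restrict (Ici 0)] (0 : ℝ → E) := by
    rw [← Measure.restrict_congr_set Ioi_ae_eq_Ici, EventuallyEq, ae_restrict_iff' measurableSet_Ioi]
    filter_upwards [h3] with t ht h
    exact (smul_eq_zero.1 (ht h)).resolve_left (Real.exp_pos _).ne'
  exact Measure.eqOn_of_ae_eq h4 hD continuousOn_const (by simp)

end Laplace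

namespace TruncatedGenerator

variable {H : Type*} [NormedAddCommGroup H] [InnerProductSpace ℂ H] [CompleteSpace H]
  {𝒢 : TruncatedGenerator H} {B : H →L[ℂ] H}

/-- The Laplace transform of the evolution equation. -/
theorem IsEvolution.laplace {u₀ : H} {F u : ℝ → H} (hF : IntegrableOn F (Ioi 0))
    (h : 𝒢.IsEvolution B u₀ F u) {K b a : ℝ}
    (hb : ∀ t, 0 ≤ t → ‖u t‖ ≤ K * Real.exp (b * t)) (hab : b < a) (ha : 0 ≤ a) :
    𝒢.Rel (laplace u a) (a • laplace u a + B (laplace u a) - (u₀ + laplace F a)) := by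
  intro n
  have iu := integrableOn_exp_smul h.continuousOn hb hab
  have iF := integrableOn_exp_smul_of_integrable hF ha
  -- The scalar weight is viewed as an operator valued function, so that the integrated product rule
  -- acts as an integration by parts.
  let k : ℝ → H →L[ℝ] H := fun t => Real.exp (-(a * t)) • ContinuousLinearMap.id ℝ H
  let k' : ℝ → H →L[ℝ] H := fun t => (-a * Real.exp (-(a * t))) • ContinuousLinearMap.id ℝ H
  have hk : ∀ s, HasDerivAt k (k' s) s := fun s => by
    have h1 : HasDerivAt (fun t => Real.exp (-(a * t))) (-a * Real.exp (-(a * s))) s := by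
      have := ((hasDerivAt_id s).const_mul a).fun_neg.exp
      simpa [mul_comm] using this
    exact h1.smul_const (ContinuousLinearMap.id ℝ H)
  have hk' : Continuous k' := by
    have : Continuous fun t => -a * Real.exp (-(a * t)) := by fun_prop
    exact this.smul continuous_const
  let m : ℝ → H := fun s => 𝒢.generator n (u s) + 𝒢.cutoff n (F s - B (u s))
  have hu : ∀ T, 0 ≤ T → IntervalIntegrable u volume 0 T := fun T hT => by
    refine ContinuousOn.intervalIntegrable ?_
    rw [uIcc_of_le hT]
    exact h.continuousOn.mono Icc_subset_Ici_self
  have hF' : ∀ T, 0 ≤ T → IntervalIntegrable F volume 0 T := fun T hT => by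
    rw [intervalIntegrable_iff_integrableOn_Ioc_of_le hT]
    exact hF.mono_set Ioc_subset_Ioi_self
  have hg : ∀ T, 0 ≤ T → IntervalIntegrable (fun s => F s - B (u s)) volume 0 T :=
    fun T hT => (hF' T hT).sub (intervalIntegrable_clm_comp _ (hu T hT))
  have e1 : ∀ t, 0 ≤ t → 𝒢.cutoff n u₀ + ∫ s in (0 : ℝ)..t, m s = 𝒢.cutoff n (u t) := by
    intro t ht
    have h1 := h.rel t ht n
    simp only [map_sub (𝒢.cutoff n) (_ - _)] at h1
    rw [map_sub, ← (𝒢.generator n).intervalIntegral_comp_comm (hu t ht),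
      ← (𝒢.cutoff n).intervalIntegral_comp_comm (hg t ht)] at h1
    simp only [m]
    rw [intervalIntegral.integral_add (intervalIntegrable_clm_comp _ (hu t ht))
      (intervalIntegrable_clm_comp _ (hg t ht)), ← h1]
    abel
  let w : ℝ → H := fun s => 𝒢.generator n (Real.exp (-(a * s)) • u s) +
    𝒢.cutoff n (Real.exp (-(a * s)) • F s - B (Real.exp (-(a * s)) • u s) -
      a • Real.exp (-(a * s)) • u s)
  have e2 : ∀ T, 0 ≤ T → Real.exp (-(a * T)) • 𝒢.cutoff n (u T) =
      𝒢.cutoff n u₀ + ∫ s in (0 : ℝ)..T, w s := by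
    intro T hT
    have h1 := clm_apply_primitive hT hk hk' ((intervalIntegrable_clm_comp (𝒢.generator n)
      (hu T hT)).add (intervalIntegrable_clm_comp (𝒢.cutoff n) (hg T hT))) (𝒢.cutoff n u₀)
    have h2 := e1 T hT
    simp only [m] at h2
    rw [h2] at h1
    simp only [k, k', smul_apply, ContinuousLinearMap.id_apply, mul_zero,
      neg_zero, Real.exp_zero, one_smul] at h1
    rw [h1]
    congr 1
    refine intervalIntegral.integral_congr fun s hs => ?_
    rw [uIcc_of_le hT] at hs
    have h3 := e1 s hs.1
    simp only [m] at h3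
    simp only [w]
    rw [h3]
    simp only [map_sub, ContinuousLinearMap.map_smul_of_tower, smul_add, smul_sub, smul_smul]
    rw [neg_mul, neg_smul]
    abel
  have iw : IntegrableOn w (Ioi 0) := by
    refine Integrable.add ((𝒢.generator n).integrable_comp iu)
      ((𝒢.cutoff n).integrable_comp ((iF.sub (B.integrable_comp iu)).sub (iu.smul a)))
  have l1 : Tendsto (fun T => 𝒢.cutoff n u₀ + ∫ s in (0 : ℝ)..T, w s) atTop
      (𝓝 (𝒢.cutoff n u₀ + ∫ s in Ioi (0 : ℝ), w s)) :=
    (intervalIntegral_tendsto_integral_Ioi 0 iw tendsto_id).const_add _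
  -- This is the boundary term at `T`; it tends to zero because `a` exceeds the growth rate `b`.
  have l2 : Tendsto (fun T => 𝒢.cutoff n u₀ + ∫ s in (0 : ℝ)..T, w s) atTop (𝓝 0) := by
    have h1 : Tendsto (fun T => ‖𝒢.cutoff n‖ * (K * Real.exp (-(a - b) * T))) atTop (𝓝 0) := by
      have : Tendsto (fun T => Real.exp (-(a - b) * T)) atTop (𝓝 0) :=
        Real.tendsto_exp_atBot.comp (tendsto_id.const_mul_atTop_of_neg (by linarith))
      simpa using (this.const_mul K).const_mul ‖𝒢.cutoff n‖
    refine squeeze_zero_norm' ?_ h1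
    filter_upwards [eventually_ge_atTop 0] with T hT
    rw [← e2 T hT, norm_smul, Real.norm_of_nonneg (Real.exp_pos _).le]
    calc _ ≤ Real.exp (-(a * T)) * (‖𝒢.cutoff n‖ * (K * Real.exp (b * T))) := by
          gcongr
          exact ((𝒢.cutoff n).le_opNorm _).trans (by gcongr; exact hb T hT)
      _ = ‖𝒢.cutoff n‖ * (K * (Real.exp (-(a * T)) * Real.exp (b * T))) := by ring
      _ = _ := by rw [← Real.exp_add]; ring_nf
  have l3 := tendsto_nhds_unique l1 l2
  have e3 : ∫ s in Ioi (0 : ℝ), w s = 𝒢.generator n (PML.laplace u a) +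
      𝒢.cutoff n (PML.laplace F a - B (PML.laplace u a) - a • PML.laplace u a) := by
    simp only [w, PML.laplace]
    have h5 : Integrable (fun s => Real.exp (-(a * s)) • F s - B (Real.exp (-(a * s)) • u s))
      (volume.restrict (Ioi 0)) := iF.sub (B.integrable_comp iu)
    have h6 : Integrable (fun s => Real.exp (-(a * s)) • F s - B (Real.exp (-(a * s)) • u s) -
      a • Real.exp (-(a * s)) • u s) (volume.restrict (Ioi 0)) := h5.sub (iu.smul a)
    have h7 : Integrable (fun s => a • Real.exp (-(a * s)) • u s) (volume.restrict (Ioi 0)) :=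
      iu.smul a
    rw [integral_add ((𝒢.generator n).integrable_comp iu) ((𝒢.cutoff n).integrable_comp h6),
      ContinuousLinearMap.integral_comp_comm _ iu, ContinuousLinearMap.integral_comp_comm _ h6,
      integral_sub h5 h7, integral_sub iF (B.integrable_comp iu),
      ContinuousLinearMap.integral_comp_comm _ iu, integral_smul]
  rw [e3] at l3
  simp only [map_add, map_sub] at l3 ⊢
  rw [← sub_eq_zero]
  have l4 := neg_eq_zero.2 l3
  rw [← l4]
  abel

end TruncatedGenerator

end PML

end

open MeasureTheory Filter Topology Set

noncomputable section

namespace PML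

/-! ### Real coordinate stretchings. -/

/-- A smooth change of variables of the line, with derivative at least `1 / 2`. -/
structure Stretch where
  speed : ℝ → ℝ
  toFun : ℝ → ℝ
  inv : ℝ → ℝ
  contDiff_speed : ContDiff ℝ (⊤ : ℕ∞) speed
  contDiff_toFun : ContDiff ℝ (⊤ : ℕ∞) toFun
  contDiff_inv : ContDiff ℝ (⊤ : ℕ∞) inv
  half_le_speed : ∀ x, 1 / 2 ≤ speed x
  hasDerivAt : ∀ x, HasDerivAt toFun (speed x) x
  inv_toFun : ∀ x, inv (toFun x) = x
  toFun_inv : ∀ x, toFun (inv x) = x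

namespace Stretch

theorem speed_pos (S : Stretch) (x : ℝ) : 0 < S.speed x :=
  one_half_pos.trans_le (S.half_le_speed x)

theorem hasDerivAt_inv (S : Stretch) (y : ℝ) : HasDerivAt S.inv (S.speed (S.inv y))⁻¹ y :=
  HasDerivAt.of_local_left_inverse S.contDiff_inv.continuous.continuousAt (S.hasDerivAt _)
    (S.speed_pos _).ne' (Eventually.of_forall S.toFun_inv)

/-- The primitive of `s` is strictly increasing, and its excess over `x / 2` is monotone, which
forces surjectivity. The inverse is smooth because the derivative never vanishes. -/
theorem exists_of_speed {s : ℝ → ℝ} (hs : ContDiff ℝ (⊤ : ℕ∞) s) (h : ∀ x, 1 / 2 ≤ s x) :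
    ∃ S : Stretch, S.speed = s ∧ ∀ x, S.toFun x = ∫ t in (0 : ℝ)..x, s t := by
  let X : ℝ → ℝ := fun x => ∫ t in (0 : ℝ)..x, s t
  have hd : ∀ x, HasDerivAt X (s x) x := fun x =>
    intervalIntegral.integral_hasDerivAt_right (hs.continuous.intervalIntegrable _ _)
      (hs.continuous.stronglyMeasurableAtFilter _ _) hs.continuous.continuousAt
  have hX : ContDiff ℝ (⊤ : ℕ∞) X := by
    rw [contDiff_infty_iff_deriv]
    refine ⟨fun x => (hd x).differentiableAt, ?_⟩
    rwa [show deriv X = s from funext fun x => (hd x).deriv]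
  have hpos : ∀ x, 0 < s x := fun x => one_half_pos.trans_le (h x)
  have hmono : StrictMono X := strictMono_of_deriv_pos fun x => by
    rw [(hd x).deriv]; exact hpos x
  have hmono2 : Monotone fun x => X x - 1 / 2 * x := by
    have hd2 : ∀ x, HasDerivAt (fun x => X x - 1 / 2 * x) (s x - 1 / 2) x := fun x => by
      simpa only [mul_one] using (hd x).fun_sub ((hasDerivAt_id' x).const_mul (1 / 2))
    refine monotone_of_deriv_nonneg (fun x => (hd2 x).differentiableAt) fun x => ?_
    rw [(hd2 x).deriv]
    linarith [h x]
  have hX0 : X 0 = 0 := intervalIntegral.integral_same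
  have htop : Tendsto X atTop atTop := by
    refine tendsto_atTop_mono' _ ?_ (tendsto_id.const_mul_atTop (one_half_pos (α := ℝ)))
    filter_upwards [eventually_ge_atTop 0] with x hx
    have := hmono2 hx
    simp only [hX0, mul_zero, sub_zero] at this
    simp only [id]
    linarith
  have hbot : Tendsto X atBot atBot := by
    refine tendsto_atBot_mono' _ ?_ (tendsto_id.const_mul_atBot (one_half_pos (α := ℝ)))
    filter_upwards [eventually_le_atBot 0] with x hx
    have := hmono2 hx
    simp only [hX0, mul_zero, sub_zero] at this
    simp only [id]
    linarith
  have hsurj := hX.continuous.surjective htop hbot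
  let e : ℝ ≃ₜ ℝ := (hmono.orderIsoOfSurjective X hsurj).toHomeomorph
  have he : ∀ x, e x = X x := fun x => rfl
  exact ⟨⟨s, X, e.symm, hs, hX, e.contDiff_symm_deriv (fun x => (hpos x).ne') hd hX, h, hd,
    e.symm_apply_apply, e.apply_symm_apply⟩, rfl, fun x => rfl⟩

section Product

variable {d : ℕ} (S : Fin d → Stretch)

/-- The diagonal linear map with coefficients `c`. -/
def diagMap (c : Fin d → ℝ) : EuclideanSpace ℝ (Fin d) →L[ℝ] EuclideanSpace ℝ (Fin d) :=
  Matrix.toEuclideanCLM (n := Fin d) (𝕜 := ℝ) (Matrix.diagonal c)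

theorem diagMap_apply (c : Fin d → ℝ) (v : EuclideanSpace ℝ (Fin d)) (j : Fin d) :
    diagMap c v j = c j * v j := by
  rw [diagMap, Matrix.ofLp_toEuclideanCLM, Matrix.mulVec_diagonal]

theorem det_diagMap (c : Fin d → ℝ) : (diagMap c).det = ∏ j, c j := by
  rw [ContinuousLinearMap.det, diagMap, Matrix.coe_toEuclideanCLM_eq_toEuclideanLin,
    Matrix.toEuclideanLin_eq_toLin_orthonormal, LinearMap.det_toLin, Matrix.det_diagonal]

/-- The product change of variables. -/
def map (x : EuclideanSpace ℝ (Fin d)) : EuclideanSpace ℝ (Fin d) :=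
  WithLp.toLp 2 fun j => (S j).toFun (x j)

/-- The inverse of the product change of variables. -/
def mapInv (y : EuclideanSpace ℝ (Fin d)) : EuclideanSpace ℝ (Fin d) :=
  WithLp.toLp 2 fun j => (S j).inv (y j)

/-- The Jacobian determinant of the product change of variables. -/
def jac (x : EuclideanSpace ℝ (Fin d)) : ℝ := ∏ j, (S j).speed (x j)

theorem mapInv_map (x : EuclideanSpace ℝ (Fin d)) : mapInv S (map S x) = x := by
  ext j
  exact (S j).inv_toFun (x j)

theorem map_mapInv (y : EuclideanSpace ℝ (Fin d)) : map S (mapInv S y) = y := by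
  ext j
  exact (S j).toFun_inv (y j)

theorem contDiff_map : ContDiff ℝ (⊤ : ℕ∞) (map S) := by
  rw [contDiff_euclidean]
  intro j
  exact (S j).contDiff_toFun.comp (contDiff_euclidean.1 contDiff_id j)

theorem contDiff_mapInv : ContDiff ℝ (⊤ : ℕ∞) (mapInv S) := by
  rw [contDiff_euclidean]
  intro j
  exact (S j).contDiff_inv.comp (contDiff_euclidean.1 contDiff_id j)

theorem hasFDerivAt_of_components {f : EuclideanSpace ℝ (Fin d) → EuclideanSpace ℝ (Fin d)}
    {g g' : Fin d → ℝ → ℝ} (hf : ∀ x j, f x j = g j (x j)) {x : EuclideanSpace ℝ (Fin d)}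
    (h : ∀ j, HasStrictDerivAt (g j) (g' j (x j)) (x j)) :
    HasFDerivAt f (diagMap fun j => g' j (x j)) x := by
  refine HasStrictFDerivAt.hasFDerivAt (hasStrictFDerivAt_euclidean.2 fun j => ?_)
  have h1 := HasStrictFDerivAt.comp x (h j).hasStrictFDerivAt
    (PiLp.proj 2 (fun _ : Fin d => ℝ) j : EuclideanSpace ℝ (Fin d) →L[ℝ] ℝ).hasStrictFDerivAt
  have h2 : (fun x => f x j) = g j ∘ (PiLp.proj 2 (fun _ : Fin d => ℝ) j :
      EuclideanSpace ℝ (Fin d) →L[ℝ] ℝ) := funext fun x => hf x j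
  have h3 : PiLp.proj 2 (fun _ : Fin d => ℝ) j ∘L diagMap (fun j => g' j (x j)) =
      ContinuousLinearMap.toSpanSingleton ℝ (g' j (x j)) ∘L PiLp.proj 2 (fun _ : Fin d => ℝ) j :=
    ContinuousLinearMap.ext fun v => by simp [diagMap_apply, mul_comm]
  rw [h2, h3]
  exact h1

theorem hasFDerivAt_map (x : EuclideanSpace ℝ (Fin d)) :
    HasFDerivAt (map S) (diagMap fun j => (S j).speed (x j)) x :=
  hasFDerivAt_of_components (g := fun j => (S j).toFun) (g' := fun j => (S j).speed)
    (fun _ _ => rfl) fun j =>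
    (S j).contDiff_toFun.contDiffAt.hasStrictDerivAt' ((S j).hasDerivAt _) (by simp)

theorem hasFDerivAt_mapInv (y : EuclideanSpace ℝ (Fin d)) :
    HasFDerivAt (mapInv S) (diagMap fun j => ((S j).speed ((S j).inv (y j)))⁻¹) y :=
  hasFDerivAt_of_components (g := fun j => (S j).inv)
    (g' := fun j t => ((S j).speed ((S j).inv t))⁻¹)
    (fun _ _ => rfl) fun j =>
    (S j).contDiff_inv.contDiffAt.hasStrictDerivAt' ((S j).hasDerivAt_inv _) (by simp)

theorem jac_pos (x : EuclideanSpace ℝ (Fin d)) : 0 < jac S x :=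
  Finset.prod_pos fun j _ => (S j).speed_pos _

theorem le_jac (x : EuclideanSpace ℝ (Fin d)) : (1 / 2) ^ d ≤ jac S x := by
  have := Finset.prod_le_prod (s := Finset.univ) (f := fun _ : Fin d => (1 / 2 : ℝ))
    (g := fun j => (S j).speed (x j)) (fun _ _ => by norm_num) fun j _ => (S j).half_le_speed _
  rw [Finset.prod_const, Finset.card_fin] at this
  exact this

theorem abs_det (x : EuclideanSpace ℝ (Fin d)) :
    |(diagMap fun j => (S j).speed (x j)).det| = jac S x := by
  rw [det_diagMap]
  exact abs_of_pos (jac_pos S x)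

theorem image_map_univ : map S '' univ = univ :=
  image_univ_of_surjective fun y => ⟨_, map_mapInv S y⟩

theorem injective_map : Function.Injective (map S) :=
  Function.LeftInverse.injective (g := mapInv S) (mapInv_map S)

theorem integral_comp_map {G : Type*} [NormedAddCommGroup G] [NormedSpace ℝ G]
    (g : EuclideanSpace ℝ (Fin d) → G) : ∫ y, g y = ∫ x, jac S x • g (map S x) := by
  have h := integral_image_eq_integral_abs_det_fderiv_smul volume MeasurableSet.univ
    (fun x _ => (hasFDerivAt_map S x).hasFDerivWithinAt) (injective_map S).injOn g
  rw [image_map_univ] at h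
  simpa only [setIntegral_univ, abs_det] using h

theorem integrable_comp_map_iff {G : Type*} [NormedAddCommGroup G] [NormedSpace ℝ G]
    (g : EuclideanSpace ℝ (Fin d) → G) :
    Integrable g ↔ Integrable fun x => jac S x • g (map S x) := by
  have h := integrableOn_image_iff_integrableOn_abs_det_fderiv_smul volume MeasurableSet.univ
    (fun x _ => (hasFDerivAt_map S x).hasFDerivWithinAt) (injective_map S).injOn g
  rw [image_map_univ] at h
  simpa only [integrableOn_univ, abs_det] using h

/-- The preimage of a null set is its image under the differentiable inverse, hence null. This
allows composing `L²` classes and almost everywhere statements with the stretching. -/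
theorem quasiMeasurePreserving_map :
    Measure.QuasiMeasurePreserving (map S) (volume : Measure (EuclideanSpace ℝ (Fin d))) := by
  refine ⟨(contDiff_map S).continuous.measurable, Measure.AbsolutelyContinuous.mk fun s hs h => ?_⟩
  rw [Measure.map_apply (contDiff_map S).continuous.measurable hs]
  have h1 : map S ⁻¹' s = mapInv S '' s :=
    congrFun (image_eq_preimage_of_inverse (map_mapInv S) (mapInv_map S)).symm s
  rw [h1]
  exact addHaar_image_eq_zero_of_differentiableOn_of_addHaar_eq_zero _
    ((contDiff_mapInv S).differentiable (by simp)).differentiableOn h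

/-- Since the Jacobian is at least `2⁻ᵈ`, inserting it costs at most the factor `2ᵈ`, and the change
of variables applies. -/
theorem memLp_comp_map {G : Type*} [NormedAddCommGroup G] {g : EuclideanSpace ℝ (Fin d) → G}
    (hg : MemLp g 2 volume) : MemLp (fun x => g (map S x)) 2 volume := by
  have hm : AEStronglyMeasurable (fun x => g (map S x)) volume :=
    hg.1.comp_quasiMeasurePreserving (quasiMeasurePreserving_map S)
  rw [memLp_two_iff_integrable_sq_norm hm]
  have h1 := (integrable_comp_map_iff S (fun x => ‖g x‖ ^ 2)).1
    ((memLp_two_iff_integrable_sq_norm hg.1).1 hg)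
  refine Integrable.mono' (h1.const_mul (2 ^ d)) (hm.norm.pow 2) (ae_of_all _ fun x => ?_)
  rw [Real.norm_of_nonneg (by positivity), smul_eq_mul, ← mul_assoc]
  refine le_mul_of_one_le_left (by positivity) ?_
  calc (1 : ℝ) = 2 ^ d * (1 / 2) ^ d := by rw [← mul_pow]; norm_num
    _ ≤ _ := by gcongr; exact le_jac S x

end Product

end Stretch

end PML

end

open MeasureTheory Filter Topology Set

noncomputable section

namespace PML

/-! ### Componentwise form of the systems and the algebra of the layer. -/

section Components

variable {d : ℕ} {ι : Type} [Fintype ι] [DecidableEq ι]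

theorem memLp_euclidean {α : Type*} [MeasurableSpace α] {μ : Measure α} {p : ENNReal}
    {f : α → EuclideanSpace ℂ ι} (h : ∀ i, MemLp (fun x => f x i) p μ) : MemLp f p μ := by
  have h1 : f = fun x => ∑ i, ContinuousLinearMap.toSpanSingleton ℂ
      (EuclideanSpace.single i (1 : ℂ)) (f x i) := by
    funext x
    ext j
    simp [Finset.sum_apply, Pi.single_apply]
  rw [h1]
  exact memLp_finsetSum _ fun i _ => ContinuousLinearMap.comp_memLp' _ (h i)

theorem matOp_apply (M : Matrix ι ι ℂ) (v : EuclideanSpace ℂ ι) (i : ι) :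
    matOp M v i = ∑ k, M i k * v k := by
  rw [matOp, Matrix.ofLp_toEuclideanCLM]
  rfl

/-- The stretching argument uses a different test function for each row of the system, hence the
scalar form. -/
theorem weakRel_iff_components {A : Fin d → Matrix ι ι ℂ} {q p : L2 d ι} : WeakRel A q p ↔
    ∀ φ : EuclideanSpace ℝ (Fin d) → ℝ, ContDiff ℝ (⊤ : ℕ∞) φ → HasCompactSupport φ → ∀ i,
      ∫ x, (φ x : ℂ) * p x i =
        ∫ x, ∑ l, ∑ k, (fderiv ℝ φ x (EuclideanSpace.single l 1) : ℂ) * (A l i k * q x k) := by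
  refine forall_congr' fun φ => forall_congr' fun hφ => forall_congr' fun hc => ?_
  have i1 : Integrable (fun x => φ x • p x) :=
    integrable_smul_of_memLp (memLp_of_hasCompactSupport hφ.continuous hc) p
  have i2 : Integrable (fun x => ∑ l, (fderiv ℝ φ x (EuclideanSpace.single l 1)) •
      matOp (A l) (q x)) :=
    integrable_finsetSum _ fun l _ => integrable_smul_matOp (memLp_partial hφ hc _) _ _
  have e1 : ∀ i, (∫ x, φ x • p x) i = ∫ x, (φ x : ℂ) * p x i := fun i => by
    have := (EuclideanSpace.proj i : EuclideanSpace ℂ ι →L[ℂ] ℂ).integral_comp_comm i1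
    simpa using this.symm
  have e2 : ∀ i, (∫ x, ∑ l, (fderiv ℝ φ x (EuclideanSpace.single l 1)) •
      matOp (A l) (q x)) i =
      ∫ x, ∑ l, ∑ k, (fderiv ℝ φ x (EuclideanSpace.single l 1) : ℂ) * (A l i k * q x k) :=
    fun i => by
    have := (EuclideanSpace.proj i : EuclideanSpace ℂ ι →L[ℂ] ℂ).integral_comp_comm i2
    refine this.symm.trans (integral_congr_ae (ae_of_all _ fun x => ?_))
    simp only [map_sum, PiLp.proj_apply, PiLp.smul_apply, matOp_apply, Finset.mul_sum,
      Complex.real_smul]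
  constructor
  · intro h i
    rw [← e1, ← e2, h]
  · intro h
    ext i
    rw [e1, e2, h]

end Components

theorem maxwellA_isHermitian (l : Fin 3) : (maxwellA l).IsHermitian := by
  ext i j
  fin_cases l <;> fin_cases i <;> fin_cases j <;> simp [maxwellA]

theorem pmlA_isHermitian (l : Fin 3) : (pmlA l).IsHermitian :=
  (maxwellA_isHermitian l).fromBlocks (by simp) Matrix.isHermitian_zero

/-- The structure of the curl that makes stretching work: row `j` differentiates component `k` only
in the third direction `l`. -/
theorem maxwellA_eq_zero_or (l j k : Fin 3) :
    maxwellA l j k = 0 ∨ (l ≠ j ∧ l ≠ k ∧ j ≠ k) := by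
  fin_cases l <;> fin_cases j <;> fin_cases k <;> simp [maxwellA]

theorem prod_of_distinct {l j k : Fin 3} (h : l ≠ j ∧ l ≠ k ∧ j ≠ k) (s : Fin 3 → ℝ) :
    ∏ i, s i = s l * s j * s k := by
  rw [Fin.prod_univ_three]
  fin_cases l <;> fin_cases j <;> fin_cases k <;> simp [-mul_eq_mul_right_iff] at h ⊢ <;> ring

theorem pmlB_apply_inr (σ : Fin 3 → ℝ → ℝ) (x : EuclideanSpace ℝ (Fin 3))
    (y : EuclideanSpace ℂ (Fin 3 ⊕ Fin 3)) (j : Fin 3) :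
    matOp (pmlB σ x) y (Sum.inr j) = (σ j (x j) : ℂ) * y (Sum.inr j) - y (Sum.inl j) := by
  rw [matOp, Matrix.ofLp_toEuclideanCLM, pmlB, Matrix.fromBlocks_mulVec, Sum.elim_inr, sigmaMat,
    Pi.add_apply, Matrix.mulVec_diagonal]
  simp [sub_eq_neg_add, Matrix.neg_mulVec]

theorem pmlB_apply_inl (σ : Fin 3 → ℝ → ℝ) (x : EuclideanSpace ℝ (Fin 3))
    (y : EuclideanSpace ℂ (Fin 3 ⊕ Fin 3)) (j : Fin 3) :
    matOp (pmlB σ x) y (Sum.inl j) =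
      (∑ k, (σ k (x k) : ℂ) - 2 * σ j (x j)) * y (Sum.inl j) +
        (∏ k ∈ {j}ᶜ, ((σ j (x j) : ℂ) - σ k (x k))) * y (Sum.inr j) := by
  rw [matOp, Matrix.ofLp_toEuclideanCLM, pmlB, Matrix.fromBlocks_mulVec, Sum.elim_inl, sigmaMat1,
    sigmaMat2, Pi.add_apply, Matrix.mulVec_diagonal, Matrix.mulVec_diagonal, Fin.sum_univ_three]
  have h0 : ({0}ᶜ : Finset (Fin 3)) = {1, 2} := rfl
  have h1 : ({1}ᶜ : Finset (Fin 3)) = {0, 2} := rfl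
  have h2 : ({2}ᶜ : Finset (Fin 3)) = {0, 1} := rfl
  fin_cases j
  · simp [h0, -mul_eq_mul_right_iff]; ring
  · simp [h1, -mul_eq_mul_right_iff]; ring
  · simp [h2, -mul_eq_mul_right_iff]; ring

/-- This identity explains the choice of `Σ⁽¹⁾` and `Σ⁽²⁾`. With `sⱼ = 1 + tⱼ/a`, `V` proportional
to `sⱼ` and `W` to `1/a`, the zero order terms together with `a V` add up to `a` times the product
of the two other stretching factors. -/
theorem stretch_identity {a : ℝ} (ha : a ≠ 0) (t : Fin 3 → ℝ) (j : Fin 3) :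
    a * (1 + t j / a) + (∑ k, t k - 2 * t j) * (1 + t j / a) + (∏ k ∈ {j}ᶜ, (t j - t k)) / a =
      a * ∏ k ∈ {j}ᶜ, (1 + t k / a) := by
  have h0 : ({0}ᶜ : Finset (Fin 3)) = {1, 2} := rfl
  have h1 : ({1}ᶜ : Finset (Fin 3)) = {0, 2} := rfl
  have h2 : ({2}ᶜ : Finset (Fin 3)) = {0, 1} := rfl
  rw [Fin.sum_univ_three]
  fin_cases j
  · simp [h0]; field_simp; ring
  · simp [h1]; field_simp; ring
  · simp [h2]; field_simp; ring

end PML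

end

open MeasureTheory Filter Topology Set

noncomputable section

namespace PML

/-! ### The stretched Maxwell field solves the stationary layer problem. -/

namespace Stretch

variable {d : ℕ} (S : Fin d → Stretch)

/-- The test function `φ / s_j`, in the stretched coordinates. -/
def pushTest (φ : EuclideanSpace ℝ (Fin d) → ℝ) (j : Fin d) (y : EuclideanSpace ℝ (Fin d)) : ℝ :=
  φ (mapInv S y) * ((S j).speed ((S j).inv (y j)))⁻¹

theorem pushTest_map (φ : EuclideanSpace ℝ (Fin d) → ℝ) (j : Fin d)
    (x : EuclideanSpace ℝ (Fin d)) :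
    pushTest S φ j (map S x) = φ x * ((S j).speed (x j))⁻¹ := by
  rw [pushTest, mapInv_map]
  congr 3
  exact (S j).inv_toFun _

theorem contDiff_inv_speed (j : Fin d) :
    ContDiff ℝ (⊤ : ℕ∞) fun t => ((S j).speed ((S j).inv t))⁻¹ :=
  ((S j).contDiff_speed.comp (S j).contDiff_inv).inv fun _ => ((S j).speed_pos _).ne'

theorem contDiff_pushTest {φ : EuclideanSpace ℝ (Fin d) → ℝ} (hφ : ContDiff ℝ (⊤ : ℕ∞) φ)
    (j : Fin d) : ContDiff ℝ (⊤ : ℕ∞) (pushTest S φ j) :=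
  (hφ.comp (contDiff_mapInv S)).mul
    ((contDiff_inv_speed S j).comp (contDiff_euclidean.1 contDiff_id j))

/-- The product change of variables, as a homeomorphism. -/
def homeo : EuclideanSpace ℝ (Fin d) ≃ₜ EuclideanSpace ℝ (Fin d) where
  toFun := map S
  invFun := mapInv S
  left_inv := mapInv_map S
  right_inv := map_mapInv S
  continuous_toFun := (contDiff_map S).continuous
  continuous_invFun := (contDiff_mapInv S).continuous

theorem hasCompactSupport_pushTest {φ : EuclideanSpace ℝ (Fin d) → ℝ}
    (hφ : HasCompactSupport φ) (j : Fin d) : HasCompactSupport (pushTest S φ j) :=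
  (hφ.comp_homeomorph (homeo S).symm).mul_right

/-- The factor `1 / sⱼ` depends on the coordinate `j` only, so a derivative in another direction
does not see it; the chain rule contributes `1 / sₗ`. -/
theorem partial_pushTest {φ : EuclideanSpace ℝ (Fin d) → ℝ} (hφ : ContDiff ℝ (⊤ : ℕ∞) φ)
    {j l : Fin d} (h : l ≠ j) (x : EuclideanSpace ℝ (Fin d)) :
    fderiv ℝ (pushTest S φ j) (map S x) (EuclideanSpace.single l 1) =
      fderiv ℝ φ x (EuclideanSpace.single l 1) * ((S l).speed (x l) * (S j).speed (x j))⁻¹ := by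
  have hinv : ∀ i, (S i).inv ((map S x) i) = x i := fun i => (S i).inv_toFun _
  have h1 : HasFDerivAt (fun y => φ (mapInv S y))
      ((fderiv ℝ φ x).comp (diagMap fun j => ((S j).speed (x j))⁻¹)) (map S x) := by
    have h2 := hasFDerivAt_mapInv S (map S x)
    simp only [hinv] at h2
    have h3 : HasFDerivAt φ (fderiv ℝ φ x) (mapInv S (map S x)) := by
      rw [mapInv_map]
      exact (hφ.differentiable (by simp) x).hasFDerivAt
    exact h3.comp _ h2
  have h4 : HasFDerivAt (fun y : EuclideanSpace ℝ (Fin d) => ((S j).speed ((S j).inv (y j)))⁻¹)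
      _ (map S x) :=
    HasFDerivAt.comp (g := fun t => ((S j).speed ((S j).inv t))⁻¹) (map S x)
      (((contDiff_inv_speed S j).differentiable (by simp)) ((map S x) j)).hasFDerivAt
      (EuclideanSpace.proj j : EuclideanSpace ℝ (Fin d) →L[ℝ] ℝ).hasFDerivAt
  have h5 : HasFDerivAt (pushTest S φ j) _ (map S x) := h1.mul h4
  have h6 : diagMap (fun j => ((S j).speed (x j))⁻¹) (EuclideanSpace.single l (1 : ℝ)) =
      ((S l).speed (x l))⁻¹ • EuclideanSpace.single l (1 : ℝ) := by
    ext i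
    rw [diagMap_apply]
    by_cases hi : i = l
    · subst hi; simp
    · simp [hi]
  rw [h5.fderiv, add_apply, smul_apply, smul_apply, ContinuousLinearMap.comp_apply,
    ContinuousLinearMap.comp_apply, h6, map_smul, hinv, PiLp.proj_apply]
  simp [h.symm]
  ring

end Stretch

/-- The values of the stationary field of the layer, in terms of the stretched Maxwell field. -/
def layerVec (a : ℝ) (s : Fin 3 → ℝ) (v : EuclideanSpace ℂ (Fin 3)) :
    EuclideanSpace ℂ (Fin 3 ⊕ Fin 3) :=
  WithLp.toLp 2 (Sum.elim (fun j => (s j : ℂ) * v j) fun j => (a : ℂ)⁻¹ * v j)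

theorem inV_inl (v : EuclideanSpace ℂ (Fin 3)) (j : Fin 3) : inV v (Sum.inl j) = v j := rfl

theorem inV_inr (v : EuclideanSpace ℂ (Fin 3)) (j : Fin 3) : inV v (Sum.inr j) = 0 := rfl

/-- Coordinate stretching: the stationary layer problem is solved by the stretched solution of
the stationary Maxwell problem. -/
theorem exists_weakRel_pml {σ : Fin 3 → ℝ → ℝ} {L : Fin 3 → ℝ} {a : ℝ} (ha : 0 < a)
    (hσ : ∀ j, ContDiff ℝ (⊤ : ℕ∞) (σ j)) (hM : ∀ j t, |σ j t| ≤ a / 2)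
    (h0 : ∀ j t, |t| ≤ L j → σ j t = 0)
    (hB : MemLp (fun x => matOp (pmlB σ x)) ⊤ volume) {u f : L2 3 (Fin 3)}
    (hf : SupportedIn (box L) f) (h : WeakRel maxwellA u (a • u - f)) :
    ∃ Y : L2 3 (Fin 3 ⊕ Fin 3), WeakRel pmlA Y (a • Y + mulOp hB Y - inV.compLp f) ∧
      ∀ᵐ x, x ∈ box L → ∀ j, Y x (Sum.inl j) = u x j := by
  have hS : ∀ j, ∃ S : Stretch, S.speed = (fun t => 1 + σ j t / a) ∧
      ∀ x, S.toFun x = ∫ t in (0 : ℝ)..x, (1 + σ j t / a) := fun j => by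
    refine Stretch.exists_of_speed (contDiff_const.add ((hσ j).div_const a)) fun t => ?_
    have := (abs_le.1 (hM j t)).1
    have h2 : -(1 / 2) ≤ σ j t / a := by rw [le_div_iff₀ ha]; linarith
    linarith
  choose S hspeed hfun using hS
  have hs : ∀ j t, (S j).speed t = 1 + σ j t / a := fun j t => congrFun (hspeed j) t
  have hs_le : ∀ j t, ‖(S j).speed t‖ ≤ 3 / 2 := fun j t => by
    rw [Real.norm_of_nonneg ((S j).speed_pos t).le, hs]
    have := (abs_le.1 (hM j t)).2
    have h2 : σ j t / a ≤ 1 / 2 := by rw [div_le_iff₀ ha]; linarith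
    linarith
  have hfix : ∀ x ∈ box L, Stretch.map S x = x := fun x hx => by
    ext j
    change (S j).toFun (x j) = x j
    have hc : ∫ t in (0 : ℝ)..x j, (1 + σ j t / a) = ∫ t in (0 : ℝ)..x j, (1 : ℝ) := by
      refine intervalIntegral.integral_congr fun t ht => ?_
      have ht' : |t| ≤ L j := by
        have := abs_sub_left_of_mem_uIcc ht
        simpa using this.trans (by simpa using hx j)
      simp [h0 j t ht']
    rw [hfun, hc]
    simp
  -- The stretching fixes the box pointwise and is injective, so no outer point is sent into the
  -- box.
  have hbox : ∀ x, Stretch.map S x ∈ box L → x ∈ box L := fun x hx => by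
    have := Stretch.injective_map S (hfix _ hx)
    rwa [this] at hx
  have hs1 : ∀ x ∈ box L, ∀ j, (S j).speed (x j) = 1 := fun x hx j => by
    rw [hs, h0 j _ (hx j)]; simp
  have hu := Stretch.memLp_comp_map S (Lp.memLp u)
  have huj : ∀ j, MemLp (fun x => u (Stretch.map S x) j) 2 volume := fun j =>
    ContinuousLinearMap.comp_memLp' (EuclideanSpace.proj j : EuclideanSpace ℂ (Fin 3) →L[ℂ] ℂ) hu
  have hY : MemLp (fun x : EuclideanSpace ℝ (Fin 3) =>
      layerVec a (fun j => (S j).speed (x j)) (u (Stretch.map S x))) 2 volume := by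
    refine memLp_euclidean fun i => ?_
    rcases i with j | j
    · refine MemLp.of_le_mul (c := 3 / 2) (huj j) ?_ (ae_of_all _ fun x => ?_)
      · refine AEStronglyMeasurable.mul ?_ (huj j).1
        exact (Complex.continuous_ofReal.comp ((S j).contDiff_speed.continuous.comp
          (EuclideanSpace.proj j : EuclideanSpace ℝ (Fin 3) →L[ℝ] ℝ).continuous)
          ).aestronglyMeasurable
      · change ‖((S j).speed (x j) : ℂ) * u (Stretch.map S x) j‖ ≤ _
        rw [norm_mul, Complex.norm_real]
        gcongr
        exact hs_le j _
    · exact (huj j).const_mul _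
  have hq := (Stretch.quasiMeasurePreserving_map S).tendsto_ae
  have hp : ∀ᵐ x, (a • u - f) x = a • u x - f x := by
    filter_upwards [Lp.coeFn_sub (a • u) f, Lp.coeFn_smul a u] with x h1 h2
    rw [h1, Pi.sub_apply, h2, Pi.smul_apply]
  refine ⟨hY.toLp, weakRel_iff_components.2 fun φ hφ hc i => ?_, ?_⟩
  swap
  · filter_upwards [hY.coeFn_toLp] with x hx hxb j
    rw [hx, hfix x hxb]
    change ((S j).speed (x j) : ℂ) * u x j = u x j
    rw [hs1 x hxb]
    simp
  have hP : ∀ᵐ x, (a • hY.toLp + mulOp hB hY.toLp - inV.compLp f) x =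
      a • layerVec a (fun j => (S j).speed (x j)) (u (Stretch.map S x)) +
        matOp (pmlB σ x) (layerVec a (fun j => (S j).speed (x j)) (u (Stretch.map S x))) -
        inV (f x) := by
    filter_upwards [Lp.coeFn_sub (a • hY.toLp + mulOp hB hY.toLp) (inV.compLp f),
      Lp.coeFn_add (a • hY.toLp) (mulOp hB hY.toLp), Lp.coeFn_smul a hY.toLp,
      coeFn_mulOp hB hY.toLp, inV.coeFn_compLp f, hY.coeFn_toLp] with x h1 h2 h3 h4 h5 h6
    rw [h1, Pi.sub_apply, h2, Pi.add_apply, h3, Pi.smul_apply, h4, h5, h6]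
  have ha' : (a : ℂ) ≠ 0 := by exact_mod_cast ha.ne'
  rcases i with j | j
  swap
  -- The rows for `W` hold pointwise: `a · v/a + σ v/a - (1 + σ/a) v = 0`.
  · have e1 : (fun x => (φ x : ℂ) *
        (a • hY.toLp + mulOp hB hY.toLp - inV.compLp f) x (Sum.inr j)) =ᵐ[volume] 0 := by
      filter_upwards [hP] with x hx
      rw [hx, PiLp.sub_apply, PiLp.add_apply, PiLp.smul_apply, pmlB_apply_inr, inV_inr]
      change (φ x : ℂ) * (a • ((a : ℂ)⁻¹ * _) + ((σ j (x j) : ℂ) * ((a : ℂ)⁻¹ * _) -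
        ((S j).speed (x j) : ℂ) * _) - 0) = 0
      rw [hs, Complex.real_smul]
      push_cast
      field_simp
      ring
    rw [integral_congr_ae e1]
    simp [pmlA]
  -- Row `j` of Maxwell's equations is tested against `φ / sⱼ` in the stretched variables and pulled
  -- back; the Jacobian then leaves the product of the two other factors in the undifferentiated
  -- terms.
  have hmax := weakRel_iff_components.1 h _ (Stretch.contDiff_pushTest S hφ j)
    (Stretch.hasCompactSupport_pushTest S hc j) j
  replace hmax := ((Stretch.integral_comp_map S _).symm.trans hmax).trans
    (Stretch.integral_comp_map S _)
  have hjac : ∀ x, Stretch.jac S x = (S j).speed (x j) * ∏ k ∈ {j}ᶜ, (S k).speed (x k) :=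
    fun x => Fintype.prod_eq_mul_prod_compl j _
  convert hmax using 1
  · refine integral_congr_ae ?_
    filter_upwards [hP, hq.eventually hp, hq.eventually hf, hf] with x h1 h2 h3 h4
    have hne : ((S j).speed (x j) : ℂ) ≠ 0 := by exact_mod_cast ((S j).speed_pos _).ne'
    -- The support of `f` enters here: in the box nothing is stretched, and outside both sides
    -- vanish.
    have hfx : (∏ k ∈ {j}ᶜ, ((S k).speed (x k) : ℂ)) * f (Stretch.map S x) j = f x j := by
      by_cases hx : x ∈ box L
      · rw [hfix x hx, Finset.prod_eq_one fun k _ => by rw [hs1 x hx]; simp, one_mul]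
      · rw [h3 fun hx' => hx (hbox x hx'), h4 hx]
        simp
    have hid := congrArg (fun r : ℝ => (r : ℂ)) (stretch_identity ha.ne' (fun k => σ k (x k)) j)
    simp only [← hs] at hid
    push_cast at hid
    rw [h1, h2, PiLp.sub_apply, PiLp.add_apply, PiLp.smul_apply, pmlB_apply_inl, inV_inl,
      Stretch.pushTest_map, hjac, ← hfx, PiLp.sub_apply, PiLp.smul_apply]
    simp only [Complex.real_smul]
    push_cast
    change (φ x : ℂ) * ((a : ℂ) * (((S j).speed (x j) : ℂ) * _) + (_ *
      (((S j).speed (x j) : ℂ) * _) + _ * ((a : ℂ)⁻¹ * _)) - _) = _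
    have e2 : ∀ p : ℂ, ((S j).speed (x j) : ℂ) * p * (φ x * ((S j).speed (x j) : ℂ)⁻¹ *
        (a * u (Stretch.map S x) j - f (Stretch.map S x) j)) =
        φ x * (a * p * u (Stretch.map S x) j - p * f (Stretch.map S x) j) := fun p => by
      field_simp
    rw [e2, ← hid]
    ring
  · refine integral_congr_ae ?_
    filter_upwards [hY.coeFn_toLp] with x hx
    rw [Finset.smul_sum]
    refine Finset.sum_congr rfl fun l _ => ?_
    rw [Fintype.sum_sum_type, Finset.smul_sum]
    simp only [pmlA, Matrix.fromBlocks_apply₁₁, Matrix.fromBlocks_apply₁₂, Matrix.zero_apply,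
      zero_mul, mul_zero, Finset.sum_const_zero, add_zero]
    refine Finset.sum_congr rfl fun k _ => ?_
    -- The Jacobian is `sₗ sⱼ sₖ` and the test function contributes `(sₗ sⱼ)⁻¹`; the remaining `sₖ`
    -- is the factor in component `k` of `V`.
    rcases maxwellA_eq_zero_or l j k with h1 | h1
    · simp [h1]
    · rw [hx, Stretch.partial_pushTest S hφ h1.1, Stretch.jac,
        prod_of_distinct h1 (fun i => (S i).speed (x i)), Complex.real_smul]
      change _ * (_ * (((S k).speed (x k) : ℂ) * u (Stretch.map S x) k)) = _
      have n1 : ((S j).speed (x j) : ℂ) ≠ 0 := by exact_mod_cast ((S j).speed_pos _).ne'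
      have n2 : ((S l).speed (x l) : ℂ) ≠ 0 := by exact_mod_cast ((S l).speed_pos _).ne'
      push_cast
      field_simp

end PML

end

open MeasureTheory Filter Topology Set
open scoped Convolution

noncomputable section

namespace PML

/-! ### Smooth approximation of the coefficients, and bounds for the zero order part. -/

/-- Essentially bounded functions vanishing on an interval are limits almost everywhere of
uniformly bounded smooth functions vanishing on this interval. -/
theorem exists_smooth_approx {σ : ℝ → ℝ} {L M : ℝ} (hσ : AEStronglyMeasurable σ volume)
    (hM : ∀ᵐ t, |σ t| ≤ M) (h0 : ∀ᵐ t : ℝ, |t| ≤ L → σ t = 0) :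
    ∃ s : ℕ → ℝ → ℝ, (∀ n, ContDiff ℝ (⊤ : ℕ∞) (s n)) ∧ (∀ n t, |s n t| ≤ M) ∧
      (∀ n t, |t| ≤ L → s n t = 0) ∧ ∀ᵐ t, Tendsto (fun n => s n t) atTop (𝓝 (σ t)) := by
  have hM0 : 0 ≤ M := by
    obtain ⟨t, ht⟩ := hM.exists
    exact (abs_nonneg _).trans ht
  let c : ℕ → ℝ := fun n => ((n : ℝ) + 1)⁻¹
  have hc0 : ∀ n, 0 < c n := fun n => by positivity
  have hclim : Tendsto c atTop (𝓝 0) := by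
    simpa [c] using tendsto_one_div_add_atTop_nhds_zero_nat (𝕜 := ℝ)
  have hclim2 : Tendsto (fun n => 2 * c n) atTop (𝓝 0) := by simpa using hclim.const_mul 2
  let χ : ℕ → ContDiffBump (0 : ℝ) := fun n => ⟨c n, 2 * c n, hc0 n, by linarith [hc0 n]⟩
  -- A margin equal to the mollification radius is removed first, so that the mollified function
  -- still vanishes for `|t| ≤ L`.
  let A : ℕ → Set ℝ := fun n => {t | L + 2 * c n < |t|}
  have hA : ∀ n, MeasurableSet (A n) := fun n =>
    (isOpen_lt continuous_const continuous_abs).measurableSet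
  have hb : ∀ n, ∀ᵐ t, ‖(A n).indicator σ t‖ ≤ M := fun n => by
    filter_upwards [hM] with t ht
    by_cases htA : t ∈ A n
    · rwa [indicator_of_mem htA, Real.norm_eq_abs]
    · rw [indicator_of_notMem htA, norm_zero]
      exact hM0
  have hσL : LocallyIntegrable σ volume :=
    (memLp_top_of_bound hσ M hM).locallyIntegrable le_top
  have hgL : ∀ n, LocallyIntegrable ((A n).indicator σ) volume := fun n =>
    (memLp_top_of_bound (hσ.indicator (hA n)) M (hb n)).locallyIntegrable le_top
  have hz : ∀ n t, |t| ≤ L → ((χ n).normed volume ⋆[ContinuousLinearMap.lsmul ℝ ℝ, volume]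
      (A n).indicator σ) t = 0 := fun n t ht => by
    have h1 : ∀ y ∈ Metric.ball t (χ n).rOut, (A n).indicator σ y = 0 := fun y hy => by
      refine indicator_of_notMem (fun hyA => ?_) _
      have h2 : |y - t| < 2 * c n := hy
      have h3 : L + 2 * c n < |y| := hyA
      have h4 : |y| ≤ |y - t| + |t| := by simpa using abs_add_le (y - t) t
      linarith
    have h5 := h1 t (Metric.mem_ball_self (χ n).rOut_pos)
    rw [(χ n).normed_convolution_eq_right fun y hy => (h1 y hy).trans h5.symm, h5]
  refine ⟨fun n => (χ n).normed volume ⋆[ContinuousLinearMap.lsmul ℝ ℝ, volume]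
    (A n).indicator σ, fun n => ?_, fun n t => ?_, fun n t ht => ?_, ?_⟩
  · exact (χ n).hasCompactSupport_normed.contDiff_convolution_left _ (χ n).contDiff_normed (hgL n)
  · have h1 : ∀ᵐ y, ‖(A n).indicator σ (t - y)‖ ≤ M :=
      (quasiMeasurePreserving_sub_left volume t).tendsto_ae.eventually (hb n)
    beta_reduce
    rw [convolution, ← Real.norm_eq_abs]
    calc _ ≤ ∫ y, (χ n).normed volume y * M :=
          norm_integral_le_of_norm_le ((χ n).integrable_normed.mul_const M) (by
            filter_upwards [h1] with y hy
            rw [ContinuousLinearMap.lsmul_apply, norm_smul,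
              Real.norm_of_nonneg ((χ n).nonneg_normed y)]
            exact mul_le_mul_of_nonneg_left hy ((χ n).nonneg_normed y))
      _ = M := by rw [integral_mul_const, (χ n).integral_normed, one_mul]
  · exact hz n t ht
  · filter_upwards [h0, ContDiffBump.ae_convolution_tendsto_right_of_locallyIntegrable (φ := χ)
      (l := atTop) (K := 2) hclim2 (Eventually.of_forall fun n => le_rfl) hσL] with t ht1 ht2
    by_cases htL : |t| ≤ L
    · rw [ht1 htL]
      exact tendsto_const_nhds.congr fun n => (hz n t htL).symm
    · rw [not_le] at htL
      refine ht2.congr' ?_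
      -- Once twice the radius fits between `L` and `|t|`, the removed margin is invisible to the
      -- mollification at `t`.
      have h1 : ∀ᶠ n in atTop, 2 * c n < (|t| - L) / 2 :=
        hclim2.eventually_lt_const (by linarith)
      filter_upwards [h1] with n hn
      rw [convolution, convolution]
      refine integral_congr_ae (ae_of_all _ fun y => ?_)
      simp only [ContinuousLinearMap.lsmul_apply]
      by_cases hy : y ∈ Function.support ((χ n).normed volume)
      · rw [(χ n).support_normed_eq, mem_ball_zero_iff, Real.norm_eq_abs] at hy
        have h2 : |y| < 2 * c n := hy
        have h3 : t - y ∈ A n := by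
          change L + 2 * c n < |t - y|
          have := abs_sub_abs_le_abs_sub t y
          linarith
        rw [indicator_of_mem h3]
      · rw [Function.notMem_support.1 hy, zero_smul, zero_smul]

/-- The action of the zero order part of the layer system, in terms of the values of `σ`. -/
def layerOp (t : Fin 3 → ℝ) :
    EuclideanSpace ℂ (Fin 3 ⊕ Fin 3) →L[ℂ] EuclideanSpace ℂ (Fin 3 ⊕ Fin 3) :=
  matOp (pmlB (fun j _ => t j) 0)

theorem continuous_layerOp : Continuous layerOp := by
  have h1 : Continuous (Matrix.toEuclideanCLM (n := Fin 3 ⊕ Fin 3) (𝕜 := ℂ)) :=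
    LinearMap.continuous_of_finiteDimensional
      { toFun := Matrix.toEuclideanCLM (n := Fin 3 ⊕ Fin 3) (𝕜 := ℂ)
        map_add' := map_add _
        map_smul' := map_smul _ }
  refine h1.comp (Continuous.matrix_fromBlocks ?_ ?_ continuous_const ?_)
  · refine Continuous.matrix_diagonal (continuous_pi fun j => ?_)
    fin_cases j <;> simp <;> fun_prop
  · refine Continuous.matrix_diagonal (continuous_pi fun j => ?_)
    fin_cases j <;> simp <;> fun_prop
  · refine Continuous.matrix_diagonal (continuous_pi fun j => ?_)
    fun_prop

/-- By compactness of the cube `[-M, M]³`, the bound depends on `M` only and serves `σ` and all its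
approximations. -/
theorem exists_norm_layerOp_le (M : ℝ) :
    ∃ C : ℝ, ∀ t : Fin 3 → ℝ, (∀ j, |t j| ≤ M) → ‖layerOp t‖ ≤ C := by
  obtain ⟨C, hC⟩ := (isCompact_univ_pi fun _ : Fin 3 => isCompact_Icc (a := -M) (b := M)
    ).exists_bound_of_continuousOn continuous_layerOp.continuousOn
  exact ⟨C, fun t ht => hC t fun j _ => abs_le.1 (ht j)⟩

/-- Needed because `σⱼ` is controlled only for almost every value of one coordinate, while the
system lives in space. -/
theorem quasiMeasurePreserving_coord {d : ℕ} (j : Fin d) :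
    Measure.QuasiMeasurePreserving (fun x : EuclideanSpace ℝ (Fin d) => x j) volume volume :=
  (Measure.quasiMeasurePreserving_eval (fun _ : Fin d => (volume : Measure ℝ)) j).comp
    (PiLp.volume_preserving_ofLp (Fin d)).quasiMeasurePreserving

theorem memLp_pmlB {σ : Fin 3 → ℝ → ℝ} (hσ : ∀ j, AEStronglyMeasurable (σ j) volume) {C : ℝ}
    (hC : ∀ᵐ x : EuclideanSpace ℝ (Fin 3), ‖matOp (pmlB σ x)‖ ≤ C) :
    MemLp (fun x => matOp (pmlB σ x)) ⊤ volume := by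
  refine memLp_top_of_bound (C := C) ?_ hC
  refine continuous_layerOp.comp_aestronglyMeasurable (g := layerOp)
    (f := fun (x : EuclideanSpace ℝ (Fin 3)) j => σ j (x j)) ?_
  refine (aemeasurable_pi_lambda _ fun j => ?_).aestronglyMeasurable
  exact ((hσ j).comp_quasiMeasurePreserving (quasiMeasurePreserving_coord j)).aemeasurable

theorem ae_coord {d : ℕ} {P : Fin d → ℝ → Prop} (h : ∀ j, ∀ᵐ t, P j t) :
    ∀ᵐ x : EuclideanSpace ℝ (Fin d), ∀ j, P j (x j) :=
  ae_all_iff.2 fun j => (quasiMeasurePreserving_coord j).tendsto_ae.eventually (h j)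

end PML

end

open MeasureTheory Filter Topology Set

noncomputable section

namespace PML

/-! ### Restriction to the box, and matching of the stationary problems. -/

theorem measurableSet_box (L : Fin 3 → ℝ) : MeasurableSet (box L) := by
  have h : box L = ⋂ j, {x | |x j| ≤ L j} := by ext; simp [box]
  rw [h]
  exact MeasurableSet.iInter fun j => (isClosed_le (by fun_prop) continuous_const).measurableSet

section BoxOp

variable {ι ι' ι'' : Type} [Fintype ι] [Fintype ι'] [Fintype ι'']

theorem memLp_boxOp (L : Fin 3 → ℝ) (T : EuclideanSpace ℂ ι →L[ℂ] EuclideanSpace ℂ ι') :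
    MemLp ((box L).indicator fun _ => T) ⊤ (volume : Measure (EuclideanSpace ℝ (Fin 3))) :=
  (memLp_top_const T).indicator (measurableSet_box L)

/-- The restriction to the box of the image of a field by a linear map. -/
def boxOp (L : Fin 3 → ℝ) (T : EuclideanSpace ℂ ι →L[ℂ] EuclideanSpace ℂ ι') :
    L2 3 ι →L[ℂ] L2 3 ι' :=
  mulOp (memLp_boxOp L T)

theorem coeFn_boxOp (L : Fin 3 → ℝ) (T : EuclideanSpace ℂ ι →L[ℂ] EuclideanSpace ℂ ι')
    (f : L2 3 ι) : ∀ᵐ x, (x ∈ box L → boxOp L T f x = T (f x)) ∧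
      (x ∉ box L → boxOp L T f x = 0) := by
  filter_upwards [coeFn_mulOp (memLp_boxOp L T) f] with x hx
  rw [boxOp, hx]
  exact ⟨fun h => by rw [indicator_of_mem h], fun h => by rw [indicator_of_notMem h]; rfl⟩

/-- Equality in the box becomes an equality of values of bounded operators, which is stable under
limits and Laplace transforms. -/
theorem boxOp_eq_iff {L : Fin 3 → ℝ} {T : EuclideanSpace ℂ ι →L[ℂ] EuclideanSpace ℂ ι''}
    {T' : EuclideanSpace ℂ ι' →L[ℂ] EuclideanSpace ℂ ι''} {f : L2 3 ι} {g : L2 3 ι'} :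
    boxOp L T f = boxOp L T' g ↔ ∀ᵐ x, x ∈ box L → T (f x) = T' (g x) := by
  constructor
  · intro h
    filter_upwards [coeFn_boxOp L T f, coeFn_boxOp L T' g] with x h1 h2 hx
    rw [← h1.1 hx, ← h2.1 hx, h]
  · intro h
    refine Lp.ext ?_
    filter_upwards [coeFn_boxOp L T f, coeFn_boxOp L T' g, h] with x h1 h2 h3
    by_cases hx : x ∈ box L
    · rw [h1.1 hx, h2.1 hx, h3 hx]
    · rw [h1.2 hx, h2.2 hx]

theorem supportedIn_iff {L : Fin 3 → ℝ} {f : L2 3 (Fin 3)} :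
    SupportedIn (box L) f ↔ boxOp L (ContinuousLinearMap.id ℂ _) f = f := by
  constructor
  · intro h
    refine Lp.ext ?_
    filter_upwards [coeFn_boxOp L (ContinuousLinearMap.id ℂ _) f, h] with x h1 h2
    by_cases hx : x ∈ box L
    · rw [h1.1 hx]; rfl
    · rw [h1.2 hx, h2 hx]
  · intro h
    have h1 := coeFn_boxOp L (ContinuousLinearMap.id ℂ _) f
    rw [h] at h1
    filter_upwards [h1] with x hx
    exact hx.2

end BoxOp

/-- `(v, w) ↦ v`. -/
def fstV : EuclideanSpace ℂ (Fin 3 ⊕ Fin 3) →L[ℂ] EuclideanSpace ℂ (Fin 3) :=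
  LinearMap.toContinuousLinearMap
    { toFun := fun y => WithLp.toLp 2 fun j => y (Sum.inl j)
      map_add' := fun _ _ => rfl
      map_smul' := fun _ _ => rfl }

/-- Perfect matching for the stationary problems, with a large real spectral parameter. -/
theorem exists_stationary_matching {σ : Fin 3 → ℝ → ℝ} {L : Fin 3 → ℝ}
    (hσ : ∀ j, MemLp (σ j) ⊤ (volume : Measure ℝ))
    (h0 : ∀ j, ∀ᵐ s : ℝ, |s| ≤ L j → σ j s = 0) :
    ∃ hB : MemLp (fun x => matOp (pmlB σ x)) ⊤ volume, ∃ a₀ : ℝ, ∀ a, a₀ ≤ a →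
      ∀ (u f : L2 3 (Fin 3)) (Y : L2 3 (Fin 3 ⊕ Fin 3)), SupportedIn (box L) f →
      WeakRel maxwellA u (a • u - f) →
      WeakRel pmlA Y (a • Y + mulOp hB Y - inV.compLp f) →
      boxOp L fstV Y = boxOp L (ContinuousLinearMap.id ℂ _) u := by
  obtain ⟨M, hM⟩ : ∃ M : ℝ, ∀ j, ∀ᵐ t, |σ j t| ≤ M := by
    have : ∀ j, ∃ M : ℝ, ∀ᵐ t, |σ j t| ≤ M := fun j =>
      ⟨_, ae_le_lpNorm_exponent_top (hσ j)⟩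
    choose M hM using this
    refine ⟨∑ j, |M j|, fun j => ?_⟩
    filter_upwards [hM j] with t ht
    exact ht.trans ((le_abs_self _).trans
      (Finset.single_le_sum (fun i _ => abs_nonneg (M i)) (Finset.mem_univ j)))
  obtain ⟨C, hC⟩ := exists_norm_layerOp_le M
  have hM0 : 0 ≤ M := by
    obtain ⟨t, ht⟩ := (hM 0).exists
    exact (abs_nonneg _).trans ht
  have hC0 : 0 ≤ C := (norm_nonneg _).trans (hC 0 fun j => by simpa using hM0)
  have hBC : ∀ᵐ x : EuclideanSpace ℝ (Fin 3), ‖matOp (pmlB σ x)‖ ≤ C := by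
    filter_upwards [ae_coord hM] with x hx
    exact hC (fun j => σ j (x j)) hx
  have hB := memLp_pmlB (fun j => (hσ j).1) hBC
  have happ := fun j => exists_smooth_approx (hσ j).1 (hM j) (h0 j)
  choose s hs hsM hs0 hlim using happ
  have hBCn : ∀ n, ∀ᵐ x : EuclideanSpace ℝ (Fin 3), ‖matOp (pmlB (fun j => s j n) x)‖ ≤ C :=
    fun n => ae_of_all _ fun x => hC (fun j => s j n (x j)) fun j => hsM j n _
  have hBn : ∀ n, MemLp (fun x : EuclideanSpace ℝ (Fin 3) => matOp (pmlB (fun j => s j n) x)) ⊤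
      volume := fun n =>
    memLp_pmlB (fun j => (hs j n).continuous.aestronglyMeasurable) (hBCn n)
  -- `a ≥ 2M` keeps the stretching speeds above `1 / 2`; `a ≥ C + 1` makes the constant in the
  -- resolvent estimate at least `1`.
  refine ⟨hB, max (2 * M) C + 1, fun a ha u f Y hf hu hY => ?_⟩
  have ha1 : 2 * M + 1 ≤ a := (add_le_add_left (le_max_left _ _) 1).trans ha
  have ha2 : C + 1 ≤ a := (add_le_add_left (le_max_right _ _) 1).trans ha
  have hst := fun n => exists_weakRel_pml (σ := fun j => s j n) (by linarith : 0 < a)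
    (fun j => hs j n) (fun j t => (hsM j n t).trans (by linarith)) (fun j => hs0 j n) (hBn n) hf hu
  choose Yn hYn hYbox using hst
  -- The difference solves the problem with coefficients `Bₙ` and source `(Bₙ - B) Y`. As `Y` is
  -- fixed, strong convergence of `Bₙ` suffices; almost everywhere convergence of `σ` would not give
  -- convergence in operator norm.
  have hest : ∀ n, ‖Y - Yn n‖ ≤ ‖(mulOp (hBn n) - mulOp hB) Y‖ := fun n => by
    have h1 := ((weakRel_iff_rel pmlA_isHermitian).1 hY).sub
      ((weakRel_iff_rel pmlA_isHermitian).1 (hYn n))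
    rw [show a • Y + mulOp hB Y - inV.compLp f -
      (a • Yn n + mulOp (hBn n) (Yn n) - inV.compLp f) = a • (Y - Yn n) +
      mulOp (hBn n) (Y - Yn n) - (mulOp (hBn n) - mulOp hB) Y by
        rw [smul_sub, map_sub, sub_apply]; abel] at h1
    have h2 := h1.norm_le
    have h3 := norm_mulOp_le (hBn n) hC0 (hBCn n)
    refine le_trans (le_mul_of_one_le_left (norm_nonneg _) ?_) h2
    linarith
  have hdiff : ∀ n, ∀ᵐ x, ((mulOp (hBn n) - mulOp hB) Y) x =
      (layerOp (fun j => s j n (x j)) - layerOp (fun j => σ j (x j))) (Y x) := fun n => by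
    filter_upwards [Lp.coeFn_sub (mulOp (hBn n) Y) (mulOp hB Y), coeFn_mulOp (hBn n) Y,
      coeFn_mulOp hB Y] with x h1 h2 h3
    rw [sub_apply, h1, Pi.sub_apply, h2, h3]
    rfl
  have hzero : Tendsto (fun n => (mulOp (hBn n) - mulOp hB) Y) atTop (𝓝 0) := by
    refine tendsto_zero_of_dominated (G := Y) (C := C + C) (fun n => ?_) ?_
    · filter_upwards [hdiff n, hBC] with x h1 h2
      rw [h1]
      refine (ContinuousLinearMap.le_opNorm _ _).trans ?_
      gcongr
      exact (norm_sub_le _ _).trans (add_le_add (hC _ fun j => hsM j n _) h2)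
    · filter_upwards [ae_all_iff.2 hdiff, ae_coord hlim] with x h1 h2
      simp only [h1]
      have h3 : Tendsto (fun n => layerOp fun j => s j n (x j)) atTop
          (𝓝 (layerOp fun j => σ j (x j))) :=
        (continuous_layerOp.tendsto _).comp (tendsto_pi_nhds.2 h2)
      have h4 := ((ContinuousLinearMap.apply ℂ _ (Y x)).continuous.tendsto _).comp
        (h3.sub_const (layerOp fun j => σ j (x j)))
      rw [sub_self, map_zero] at h4
      exact h4
  have hYlim : Tendsto Yn atTop (𝓝 Y) := by
    rw [tendsto_iff_norm_sub_tendsto_zero]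
    refine squeeze_zero (fun n => norm_nonneg _) (fun n => ?_) (by simpa using hzero.norm)
    rw [norm_sub_rev]
    exact hest n
  refine tendsto_nhds_unique (((boxOp L fstV).continuous.tendsto Y).comp hYlim)
    (tendsto_const_nhds.congr fun n => ?_)
  refine (boxOp_eq_iff.2 ?_).symm
  filter_upwards [hYbox n] with x hx hxb
  ext j
  exact hx hxb j

/-! ### Perfect matching in time. -/

section Laplace

variable {E E' : Type*} [NormedAddCommGroup E] [NormedSpace ℂ E] [CompleteSpace E]
  [NormedAddCommGroup E'] [NormedSpace ℂ E'] [CompleteSpace E']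

theorem laplace_clm (T : E →L[ℂ] E') {u : ℝ → E} {a : ℝ}
    (hu : IntegrableOn (fun t => Real.exp (-(a * t)) • u t) (Ioi 0)) :
    laplace (fun t => T (u t)) a = T (laplace u a) := by
  rw [laplace, laplace, ← T.integral_comp_comm hu]
  simp only [ContinuousLinearMap.map_smul_of_tower]

end Laplace

theorem memLp_matOp_zero {d : ℕ} {ι : Type} [Fintype ι] [DecidableEq ι] :
    MemLp (fun _ : EuclideanSpace ℝ (Fin d) => matOp (0 : Matrix ι ι ℂ)) ⊤ volume :=
  memLp_top_const _

theorem mulOp_zero {d : ℕ} {ι : Type} [Fintype ι] [DecidableEq ι] (f : L2 d ι) :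
    mulOp (memLp_matOp_zero (d := d) (ι := ι)) f = 0 := by
  have h := norm_mulOp_apply_le (memLp_matOp_zero (d := d) (ι := ι)) (C := 0)
    (ae_of_all _ fun x => by simp) f
  rw [zero_mul] at h
  exact norm_le_zero_iff.1 h

/-- Perfect matching for integrable sources. -/
theorem boxOp_eq_of_integrable {σ : Fin 3 → ℝ → ℝ} {L : Fin 3 → ℝ}
    {hB : MemLp (fun x => matOp (pmlB σ x)) ⊤ volume} {a₀ : ℝ}
    (hmatch : ∀ a, a₀ ≤ a → ∀ (u f : L2 3 (Fin 3)) (Y : L2 3 (Fin 3 ⊕ Fin 3)),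
      SupportedIn (box L) f → WeakRel maxwellA u (a • u - f) →
      WeakRel pmlA Y (a • Y + mulOp hB Y - inV.compLp f) →
      boxOp L fstV Y = boxOp L (ContinuousLinearMap.id ℂ _) u)
    {U₀ : L2 3 (Fin 3)} {F : ℝ → L2 3 (Fin 3)} (hU₀ : SupportedIn (box L) U₀)
    (hF : IntegrableOn F (Ioi 0))
    (hsupp : ∀ᵐ t ∂(volume.restrict (Ioi (0 : ℝ))), SupportedIn (box L) (F t))
    {Y : ℝ → L2 3 (Fin 3 ⊕ Fin 3)} {U : ℝ → L2 3 (Fin 3)}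
    (hY : (hyperbolicGenerator pmlA pmlA_isHermitian).IsEvolution (mulOp hB) (inV.compLp U₀)
      (fun t => inV.compLp (F t)) Y)
    (hU : (hyperbolicGenerator maxwellA maxwellA_isHermitian).IsEvolution
      (mulOp memLp_matOp_zero) U₀ F U) {K b K' b' : ℝ}
    (hYb : ∀ t, 0 ≤ t → ‖Y t‖ ≤ K * Real.exp (b * t))
    (hUb : ∀ t, 0 ≤ t → ‖U t‖ ≤ K' * Real.exp (b' * t)) {t : ℝ} (ht : 0 ≤ t) :
    boxOp L fstV (Y t) = boxOp L (ContinuousLinearMap.id ℂ _) (U t) := by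
  let P := boxOp L fstV
  let Q := boxOp L (ContinuousLinearMap.id ℂ (EuclideanSpace ℂ (Fin 3)))
  let J := inV.compLpL 2 (volume : Measure (EuclideanSpace ℝ (Fin 3)))
  have hFJ : IntegrableOn (fun t => inV.compLp (F t)) (Ioi 0) := J.integrable_comp hF
  have key := eqOn_zero_of_laplace_eq_zero (D := fun t => P (Y t) - Q (U t))
    (K := ‖P‖ * |K| + ‖Q‖ * |K'|) (b := max b b') (a₀ := max a₀ (max 0 (max b b' + 1)))
    ((P.continuous.comp_continuousOn hY.continuousOn).sub
      (Q.continuous.comp_continuousOn hU.continuousOn)) (fun t ht => ?_) fun a ha => ?_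
  · exact sub_eq_zero.1 (key ht)
  · have e1 : ‖P (Y t)‖ ≤ ‖P‖ * |K| * Real.exp (max b b' * t) := by
      refine (P.le_opNorm _).trans ?_
      rw [mul_assoc]
      gcongr
      refine (hYb t ht).trans ?_
      gcongr
      · exact le_abs_self K
      · exact le_max_left _ _
    have e2 : ‖Q (U t)‖ ≤ ‖Q‖ * |K'| * Real.exp (max b b' * t) := by
      refine (Q.le_opNorm _).trans ?_
      rw [mul_assoc]
      gcongr
      refine (hUb t ht).trans ?_
      gcongr
      · exact le_abs_self K'
      · exact le_max_right _ _
    rw [add_mul]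
    exact (norm_sub_le _ _).trans (add_le_add e1 e2)
  · have ha0 : a₀ ≤ a := (le_max_left _ _).trans ha
    have ha1 : 0 ≤ a := (le_max_left _ _).trans ((le_max_right _ _).trans ha)
    have ha2 : max b b' < a :=
      (lt_add_one _).trans_le ((le_max_right _ _).trans ((le_max_right _ _).trans ha))
    have hba : b < a := (le_max_left _ _).trans_lt ha2
    have hba' : b' < a := (le_max_right _ _).trans_lt ha2
    have iY := integrableOn_exp_smul hY.continuousOn hYb hba
    have iU := integrableOn_exp_smul hU.continuousOn hUb hba'
    have iF := integrableOn_exp_smul_of_integrable hF ha1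
    have lY := hY.laplace hFJ hYb hba ha1
    have lU := hU.laplace hF hUb hba' ha1
    rw [mulOp_zero, add_zero, ← weakRel_iff_rel] at lU
    have hJ : laplace (fun t => inV.compLp (F t)) a = J (laplace F a) := laplace_clm J iF
    have eJ : inV.compLp (U₀ + laplace F a) =
        inV.compLp U₀ + laplace (fun t => inV.compLp (F t)) a := by
      rw [hJ]
      exact map_add J _ _
    have lY' : WeakRel pmlA (laplace Y a)
        (a • laplace Y a + mulOp hB (laplace Y a) - inV.compLp (U₀ + laplace F a)) := by
      rw [weakRel_iff_rel pmlA_isHermitian, eJ]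
      exact lY
    -- Restriction to the box is a bounded operator, so it commutes with the Laplace transform and
    -- preserves the support of the source.
    have hf : SupportedIn (box L) (U₀ + laplace F a) := by
      rw [supportedIn_iff, map_add, supportedIn_iff.1 hU₀]
      congr 1
      refine (laplace_clm Q iF).symm.trans (integral_congr_ae ?_)
      filter_upwards [hsupp] with s hs
      exact congrArg (fun v => Real.exp (-(a * s)) • v) (supportedIn_iff.1 hs)
    have h1 := hmatch a ha0 _ _ _ hf lU lY'
    have iPY : Integrable (fun t => Real.exp (-(a * t)) • P (Y t)) (volume.restrict (Ioi 0)) := by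
      simpa only [ContinuousLinearMap.map_smul_of_tower] using P.integrable_comp iY
    have iQU : Integrable (fun t => Real.exp (-(a * t)) • Q (U t)) (volume.restrict (Ioi 0)) := by
      simpa only [ContinuousLinearMap.map_smul_of_tower] using Q.integrable_comp iU
    rw [laplace]
    simp only [smul_sub]
    rw [integral_sub iPY iQU]
    exact (congrArg₂ (· - ·) (laplace_clm P iY) (laplace_clm Q iU)).trans (sub_eq_zero.2 h1)

/-- A locally integrable source may have no Laplace transform. For a fixed time `T` it is replaced
by its restriction to `[0, T]`, which is integrable; neither solution changes on `[0, T]`. -/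
theorem perfectlyMatched {σ : Fin 3 → ℝ → ℝ} {L : Fin 3 → ℝ}
    (hσ : ∀ j, MemLp (σ j) ⊤ (volume : Measure ℝ))
    (h0 : ∀ j, ∀ᵐ s : ℝ, |s| ≤ L j → σ j s = 0) : PerfectlyMatched σ L := by
  obtain ⟨hB, a₀, hmatch⟩ := exists_stationary_matching hσ h0
  intro U₀ F hU₀ hFloc hsupp
  let J := inV.compLpL 2 (volume : Measure (EuclideanSpace ℝ (Fin 3)))
  have hF : ∀ T, 0 ≤ T → IntervalIntegrable F volume 0 T := fun T hT =>
    (intervalIntegrable_iff_integrableOn_Icc_of_le hT).2 (hFloc T hT)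
  have hFJ : ∀ T, 0 ≤ T → IntervalIntegrable (fun t => inV.compLp (F t)) volume 0 T :=
    fun T hT => (intervalIntegrable_iff_integrableOn_Icc_of_le hT).2
      (J.integrable_comp (hFloc T hT))
  obtain ⟨Y, hY⟩ := exists_isUniqueSolution pmlA_isHermitian hB (inV.compLp U₀) hFJ
  obtain ⟨U, hU⟩ := exists_isUniqueSolution maxwellA_isHermitian memLp_matOp_zero U₀ hF
  refine ⟨Y, U, hY, hU, fun T hT => ?_⟩
  let FT : ℝ → L2 3 (Fin 3) := (Icc 0 T).indicator F
  have hFT : Integrable FT := (integrable_indicator_iff measurableSet_Icc).2 (hFloc T hT)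
  have hFTJ : Integrable (fun t => inV.compLp (FT t)) := J.integrable_comp hFT
  have bound : ∀ {E : Type} [NormedAddCommGroup E] {G : ℝ → E}, Integrable G →
      ∀ S, 0 ≤ S → ∫ s in (0 : ℝ)..S, ‖G s‖ ≤ ∫ s, ‖G s‖ := fun hG S hS => by
    rw [intervalIntegral.integral_of_le hS]
    exact setIntegral_le_integral hG.norm (ae_of_all _ fun _ => norm_nonneg _)
  obtain ⟨Y', hY', bY'⟩ := (hyperbolicGenerator pmlA pmlA_isHermitian
    ).exists_isEvolution_of_bounded (mulOp hB) (inV.compLp U₀)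
    (fun S _ => hFTJ.intervalIntegrable) (bound hFTJ)
  obtain ⟨U', hU', bU'⟩ := (hyperbolicGenerator maxwellA maxwellA_isHermitian
    ).exists_isEvolution_of_bounded (mulOp memLp_matOp_zero) U₀
    (fun S _ => hFT.intervalIntegrable) (bound hFT)
  have hsuppT : ∀ᵐ t ∂(volume.restrict (Ioi (0 : ℝ))), SupportedIn (box L) (FT t) := by
    filter_upwards [hsupp] with t ht
    by_cases h : t ∈ Icc 0 T
    · rwa [show FT t = F t from indicator_of_mem h F]
    · rw [show FT t = 0 from indicator_of_notMem h F, supportedIn_iff, map_zero]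
  have hFF : ∀ t ∈ Icc 0 T, F t = FT t := fun t ht => (indicator_of_mem ht F).symm
  have eY : Y T = Y' T :=
    ((isSolution_iff_isEvolution pmlA_isHermitian hB hFJ).1 hY.1).eqOn hFJ
      (fun S _ => hFTJ.intervalIntegrable) hY' (fun t ht => by rw [hFF t ht])
      (right_mem_Icc.2 hT)
  have eU : U T = U' T :=
    ((isSolution_iff_isEvolution maxwellA_isHermitian memLp_matOp_zero hF).1 hU.1).eqOn hF
      (fun S _ => hFT.intervalIntegrable) hU' hFF (right_mem_Icc.2 hT)
  have h1 := boxOp_eq_of_integrable hmatch hU₀ hFT.integrableOn hsuppT hY' hU' bY' bU' hT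
  rw [← eY, ← eU] at h1
  filter_upwards [boxOp_eq_iff.1 h1, ae_coord h0] with x h2 h3 hx
  have h4 := h2 hx
  ext j
  have h5 := congrArg (fun v : EuclideanSpace ℂ (Fin 3) => v j) h4
  change Y T x (Sum.inl j) - (σ j (x j) : ℂ) * Y T x (Sum.inr j) = U T x j
  -- In the box `σⱼ` vanishes almost everywhere, so the recovered field reduces to `V`.
  rw [h3 j (hx j), Complex.ofReal_zero, zero_mul, sub_zero]
  exact h5

end PML

end

theorem theorem3p6 (σ : Fin 3 → ℝ → ℝ) (L : Fin 3 → ℝ)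
    (hL : ∀ j, 0 < L j)
    (hσ : ∀ j, MemLp (σ j) ⊤ (volume : Measure ℝ))
    (hvanish : ∀ j, ∀ᵐ s : ℝ, |s| ≤ L j → σ j s = 0) :
    PML.StronglyWellPosed PML.pmlA (PML.pmlB σ) ∧ PML.PerfectlyMatched σ L := by
  obtain ⟨hB, -⟩ := PML.exists_stationary_matching hσ hvanish
  exact ⟨PML.stronglyWellPosed PML.pmlA_isHermitian hB, PML.perfectlyMatched hσ hvanish⟩
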